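/- Let $\mathcal M^m$ be a closed Riemannian manifold, isometrically embedded in some Euclidean space $\mathbb R^Q$, let $\mathcal N^n\subset\mathcal M$ be a closed embedded submanifold, $1\le n<m$, and let $\Sigma$ be a compact smooth surface, possibly with boundary. Let $\mathfrak M^\infty$ be the set of smooth immersions $\Phi:\Sigma\to\mathcal M$ with $\Phi(\partial\Sigma)\subseteq\mathcal N$. For $\Phi\in\mathfrak M^\infty$ let $g_\Phi$ be the induced metric on $\Sigma$, $\mathrm{vol}_\Phi$ its area measure, $\mathrm{II}^\Phi$ the second fundamental form of $\Phi$ in $\mathcal M$, and for $\sigma>0$ $$E_\sigma(\Phi)=\operatorname{area}(\Phi)+\sigma\operatorname{length}(\Phi|_{\partial\Sigma})+\sigma^4\int_\Sigma|\mathrm{II}^\Phi|^4\,\mathrm{vol}_\Phi .$$ For a smooth section $w$ of $\Phi^*T\mathcal M$ put $\|w\|_\Phi=\|w\|_{L^\infty}+\|\nabla w\|_{L^\infty}+\|\nabla^2w\|_{L^4}$, where $\nabla$ is the pull-back of the Levi-Civita connection and norms are taken with respect to the metric of $\mathcal M$ and $g_\Phi$. We say that $\Phi\in\mathfrak M^\infty$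 is $\epsilon$-critical for $E_\sigma$ if $\left|\frac{d}{dt}E_\sigma(\Phi_t)\big|_{t=0}\right|\le\epsilon\,\|w\|_\Phi$ for every smooth family $(\Phi_t)_{|t|<\tau}$ in $\mathfrak M^\infty$ with $\Phi_0=\Phi$ and $w=\frac{d}{dt}\Phi_t\big|_{t=0}$. Let $\sigma_k\in(0,1)$ with $\sigma_k\to0$, and let $\Phi_k\in\mathfrak M^\infty$ have uniformly bounded area, be $\sigma_k^5$-critical for $E_{\sigma_k}$, and satisfy the entropy condition $$\sigma_k\log(1/\sigma_k)\operatorname{length}(\Phi_k|_{\partial\Sigma})+\sigma_k^4\log(1/\sigma_k)\int_\Sigma|\mathrm{II}^{\Phi_k}|^4\,\mathrm{vol}_{\Phi_k}\to0 .$$ Let $\mathbf v_k$ be the $2$-varifold induced by $\Phi_k$, i.e. the push-forward of $\mathrm{vol}_{\Phi_k}$ under $x\mapsto(\Phi_k(x),d\Phi_k(T_x\Sigma))$ to the Grassmannian bundle $\mathrm{Gr}_2(\mathcal M)$ of pairs $(p,\Pi)$ with $p\in\mathcal M$ and $\Pi\subseteq T_p\mathcal M$ a $2$-plane. Then a subsequence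 of $(\mathbf v_k)$ converges, weakly as measures on $\mathrm{Gr}_2(\mathcal M)$, to a varifold $\mathbf v_\infty$ that is free boundary stationary for $(\mathcal M,\mathcal N)$: for every family $(F_t)_{|t|<\tau}$ of diffeomorphisms of $\mathcal M$ with $F_0=\mathrm{id}$, $F_t(\mathcal N)=\mathcal N$ and $F_t(x)$ smooth in $(t,x)$, the mass $\|(F_t)_*\mathbf v_\infty\|(\mathcal M)=\int_{\mathrm{Gr}_2(\mathcal M)}J_\Pi F_t(p)\,d\mathbf v_\infty(p,\Pi)$ is differentiable at $t=0$ with derivative $0$. Here $J_\Pi F_t(p)$ is the Jacobian of $dF_t(p)|_\Pi$. -/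

import Mathlib

open Set Filter Topology MeasureTheory
open scoped Manifold ContDiff Matrix RealInnerProductSpace

noncomputable section

namespace FreeBoundary

/-- The Euclidean space containing the ambient manifold. -/
abbrev Euc (Q : ℕ) : Type := EuclideanSpace ℝ (Fin Q)

/-- The coordinate plane, in which the charts of a surface take values. -/
abbrev Plane : Type := EuclideanSpace ℝ (Fin 2)

/-! ### Submanifolds of Euclidean space -/

section Submanifolds

variable {Q : ℕ}

/-- `A` is a smooth embedded `d`-dimensional submanifold without boundary: around each of its
points a smooth diffeomorphism between open sets straightens `A` to a `d`-dimensional subspace. -/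
def IsEmbeddedSubmanifold (d : ℕ) (A : Set (Euc Q)) : Prop :=
  ∀ p ∈ A, ∃ ψ : OpenPartialHomeomorph (Euc Q) (Euc Q), p ∈ ψ.source ∧
    ContDiffOn ℝ ∞ ψ ψ.source ∧ ContDiffOn ℝ ∞ ψ.symm ψ.target ∧
    ∃ L : Submodule ℝ (Euc Q), Module.finrank ℝ L = d ∧ ψ.IsImage A (L : Set (Euc Q))

/-- The tangent space `T_p A`, as a linear subspace of the ambient Euclidean space. -/
def tangentSpaceAt (A : Set (Euc Q)) (p : Euc Q) : Submodule ℝ (Euc Q) :=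
  Submodule.span ℝ (tangentConeAt ℝ A p)

/-- Orthogonal projection onto `T_p A`. -/
def tangentProj (A : Set (Euc Q)) (p : Euc Q) : Euc Q →L[ℝ] Euc Q :=
  (tangentSpaceAt A p).starProjection

end Submanifolds

/-! ### Geometry of a map read in a chart

In this section `u` is an immersion, and `w` a vector field along `u`, written in a chart of the
surface; both are defined on a relatively open subset of the closed half plane. The metric on the
domain is the one induced by `u`. -/

section LocalGeometry

variable {Q : ℕ}

/-- The partial derivative `∂_i u` in the closed half plane (one-sided on its boundary). -/
def pd (u : Plane → Euc Q) (i : Fin 2) (y : Plane) : Euc Q :=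
  fderivWithin ℝ u (range (𝓡∂ 2)) y (EuclideanSpace.single i 1)

/-- The coefficients `g_{ij} = ⟨∂_i u, ∂_j u⟩` of the induced metric. -/
def metric (u : Plane → Euc Q) (y : Plane) : Matrix (Fin 2) (Fin 2) ℝ :=
  Matrix.of fun i j => ⟪pd u i y, pd u j y⟫

/-- The density `√(det g)` of the area with respect to Lebesgue measure. -/
def areaDensity (u : Plane → Euc Q) (y : Plane) : ℝ :=
  √ (metric u y).det

/-- The squared norm `g^{ij} ⟨a_i, a_j⟩` of a vector-valued 1-form. -/
def normSqOne (g : Matrix (Fin 2) (Fin 2) ℝ) (a : Fin 2 → Euc Q) : ℝ :=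
  ∑ i, ∑ j, g⁻¹ i j * ⟪a i, a j⟫

/-- The squared norm `g^{ik} g^{jl} ⟨b_{ij}, b_{kl}⟩` of a vector-valued bilinear form. -/
def normSqTwo (g : Matrix (Fin 2) (Fin 2) ℝ) (b : Fin 2 → Fin 2 → Euc Q) : ℝ :=
  ∑ i, ∑ j, ∑ k, ∑ l, g⁻¹ i k * g⁻¹ j l * ⟪b i j, b k l⟫

/-- The component `II(∂_i u, ∂_j u)` of the second fundamental form of `u` as an immersion into
`M`: the part of `∂_i ∂_j u` that is tangent to `M` and normal to the immersed surface. -/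
def secondFundForm (M : Set (Euc Q)) (u : Plane → Euc Q) (i j : Fin 2) (y : Plane) : Euc Q :=
  (tangentSpaceAt M (u y) ⊓ (Submodule.span ℝ (range fun k => pd u k y))ᗮ).starProjection
    (pd (pd u j) i y)

/-- `|II|²`. -/
def secondFundFormSq (M : Set (Euc Q)) (u : Plane → Euc Q) (y : Plane) : ℝ :=
  normSqTwo (metric u y) fun i j => secondFundForm M u i j y

/-- The Christoffel symbols `Γ^k_{ij} = g^{kl} ⟨∂_i ∂_j u, ∂_l u⟩` of the induced metric. -/
def christoffel (u : Plane → Euc Q) (k i j : Fin 2) (y : Plane) : ℝ :=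
  ∑ l, (metric u y)⁻¹ k l * ⟪pd (pd u j) i y, pd u l y⟫

/-- The covariant derivative `∇_i w` of a section `w` of the pull-back of `TM`, for the pull-back
of the Levi-Civita connection of `M`. -/
def covDeriv (M : Set (Euc Q)) (u w : Plane → Euc Q) (i : Fin 2) (y : Plane) : Euc Q :=
  tangentProj M (u y) (pd w i y)

/-- The second covariant derivative `∇²_{ij} w = ∇_i (∇_j w) - Γ^k_{ij} ∇_k w`. -/
def covDerivTwo (M : Set (Euc Q)) (u w : Plane → Euc Q) (i j : Fin 2) (y : Plane) : Euc Q :=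
  covDeriv M u (covDeriv M u w j) i y - ∑ k, christoffel u k i j y • covDeriv M u w k y

end LocalGeometry

/-! ### Integration on a compact surface with boundary -/

section Surface

variable (S : Type*) [TopologicalSpace S] [T2Space S] [CompactSpace S]
  [ChartedSpace (EuclideanHalfSpace 2) S] [IsManifold (𝓡∂ 2) ∞ S]

/-- A smooth partition of unity subordinate to the charts of the surface. -/
def chartPartition : SmoothPartitionOfUnity S (𝓡∂ 2) S univ :=
  Classical.choose (SmoothPartitionOfUnity.exists_isSubordinate_chartAt_source (𝓡∂ 2) S)

theorem chartPartition_isSubordinate :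
    (chartPartition S).IsSubordinate fun x => (chartAt (EuclideanHalfSpace 2) x).source :=
  Classical.choose_spec (SmoothPartitionOfUnity.exists_isSubordinate_chartAt_source (𝓡∂ 2) S)


end Surface

section Surface

variable {S : Type*} [TopologicalSpace S] [T2Space S] [CompactSpace S]
  [ChartedSpace (EuclideanHalfSpace 2) S] [IsManifold (𝓡∂ 2) ∞ S] {Q : ℕ}

/-- A function on the surface read in the chart centered at `c`. -/
def inChart (f : S → Euc Q) (c : S) : Plane → Euc Q :=
  f ∘ (extChartAt (𝓡∂ 2) c).symm

/-- The weight of the partition of unity belonging to the chart centered at `c`, read in it. -/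
def chartWeight (c : S) (y : Plane) : ℝ :=
  chartPartition S c ((extChartAt (𝓡∂ 2) c).symm y)

/-- The integral over the surface of the density which reads `D c y dy` in the chart centered
at `c`. Only finitely many summands are nonzero, by compactness. -/
def surfaceIntegral (D : S → Plane → ℝ) : ℝ :=
  ∑ᶠ c : S, ∫ y in (extChartAt (𝓡∂ 2) c).target, chartWeight c y * D c y

/-- The integral over the boundary of the surface of the density which reads `D c (0, s) ds` in
the chart centered at `c`; in the charts, the boundary is the line `{0} × ℝ`. -/
def boundaryIntegral (D : S → Plane → ℝ) : ℝ :=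
  ∑ᶠ c : S, ∫ s in {s : ℝ | (!₂[0, s] : Plane) ∈ (extChartAt (𝓡∂ 2) c).target},
    chartWeight c !₂[0, s] * D c !₂[0, s]

/-- The area of an immersion. -/
def area (Φ : S → Euc Q) : ℝ :=
  surfaceIntegral fun c y => areaDensity (inChart Φ c) y

/-- The length of the restriction of an immersion to the boundary of the surface. -/
def boundaryLength (Φ : S → Euc Q) : ℝ :=
  boundaryIntegral fun c y => ‖pd (inChart Φ c) 1 y‖

/-- The integral of `|II|⁴` with respect to the area. -/
def bendingEnergy (M : Set (Euc Q)) (Φ : S → Euc Q) : ℝ :=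
  surfaceIntegral fun c y =>
    secondFundFormSq M (inChart Φ c) y ^ 2 * areaDensity (inChart Φ c) y

/-- The energy `E_σ`. -/
def energy (M : Set (Euc Q)) (σ : ℝ) (Φ : S → Euc Q) : ℝ :=
  area Φ + σ * boundaryLength Φ + σ ^ 4 * bendingEnergy M Φ

/-- The differential `dΦ(x)`, defined on `T_x S = ℝ²`. -/
def differential (Φ : S → Euc Q) (x : S) : Plane →L[ℝ] Euc Q :=
  mfderiv (𝓡∂ 2) 𝓘(ℝ, Euc Q) Φ x

/-- Smooth immersions into `M` which send the boundary of the surface into `N`. -/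
structure IsAdmissible (M N : Set (Euc Q)) (Φ : S → Euc Q) : Prop where
  smooth : ContMDiff (𝓡∂ 2) 𝓘(ℝ, Euc Q) ∞ Φ
  immersion : ∀ x, Function.Injective (differential Φ x)
  mem_ambient : ∀ x, Φ x ∈ M
  mem_constraint : ∀ x ∈ (𝓡∂ 2).boundary S, Φ x ∈ N

/-- The norm `‖w‖_Φ = ‖w‖_{L^∞} + ‖∇w‖_{L^∞} + ‖∇²w‖_{L⁴}` of a section `w` of the pull-back
of `TM` by `Φ`, with respect to the metrics of `M` and of the immersed surface. -/
def finslerNorm (M : Set (Euc Q)) (Φ w : S → Euc Q) : ℝ :=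
  (⨆ x, ‖w x‖)
  + (⨆ x, √ (normSqOne (metric (inChart Φ x) (extChartAt (𝓡∂ 2) x x)) fun i =>
      covDeriv M (inChart Φ x) (inChart w x) i (extChartAt (𝓡∂ 2) x x)))
  + (surfaceIntegral fun c y =>
      normSqTwo (metric (inChart Φ c) y)
        (fun i j => covDerivTwo M (inChart Φ c) (inChart w c) i j y) ^ 2
      * areaDensity (inChart Φ c) y) ^ (1 / 4 : ℝ)

/-- A smooth one-parameter family, for `|t| < ε`, of admissible immersions starting at `Φ`. -/
structure IsVariation (M N : Set (Euc Q)) (Φ : S → Euc Q) (ε : ℝ) (V : ℝ → S → Euc Q) :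
    Prop where
  pos : 0 < ε
  start : V 0 = Φ
  smooth : ContMDiffOn (𝓘(ℝ, ℝ).prod (𝓡∂ 2)) 𝓘(ℝ, Euc Q) ∞ (fun q : ℝ × S => V q.1 q.2)
    (Ioo (-ε) ε ×ˢ univ)
  admissible : ∀ t ∈ Ioo (-ε) ε, IsAdmissible M N (V t)

/-- `‖dE_σ(Φ)‖_Φ ≤ δ`: the derivative of `E_σ` along any variation of `Φ` is at most `δ` times
the norm of the initial velocity of that variation. -/
def IsAlmostCritical (M N : Set (Euc Q)) (σ δ : ℝ) (Φ : S → Euc Q) : Prop :=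
  ∀ (ε : ℝ) (V : ℝ → S → Euc Q), IsVariation M N Φ ε V →
    |deriv (fun t => energy M σ (V t)) 0|
      ≤ δ * finslerNorm M Φ (fun x => deriv (fun t => V t x) 0)

/-- The area measure `vol_Φ` of an immersion. -/
def areaMeasure [MeasurableSpace S] (Φ : S → Euc Q) : Measure S :=
  Measure.sum fun c : S =>
    ((volume.restrict (extChartAt (𝓡∂ 2) c).target).withDensity fun y =>
      ENNReal.ofReal (chartWeight c y * areaDensity (inChart Φ c) y)).map
      (extChartAt (𝓡∂ 2) c).symm

end Surface

/-! ### Varifolds -/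

section Varifolds

variable {Q : ℕ}

/-- The Grassmannian bundle `Gr_2(M)` of pairs of a point of `M` and a 2-plane tangent to `M`
at that point. -/
@[ext]
structure GrBundle (M : Set (Euc Q)) where
  pt : Euc Q
  plane : Submodule ℝ (Euc Q)
  mem : pt ∈ M
  tangent : plane ≤ tangentSpaceAt M pt
  finrank_eq : Module.finrank ℝ plane = 2

/-- The usual topology of the Grassmannian bundle, where planes are identified with the
orthogonal projections onto them. -/
instance (M : Set (Euc Q)) : TopologicalSpace (GrBundle M) :=
  TopologicalSpace.induced
    (fun q => ((q.pt, q.plane.starProjection) : Euc Q × (Euc Q →L[ℝ] Euc Q))) inferInstance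

instance (M : Set (Euc Q)) : MeasurableSpace (GrBundle M) := borel _

instance (M : Set (Euc Q)) : BorelSpace (GrBundle M) := ⟨rfl⟩

/-- A 2-varifold on the compact set `M`: a finite Borel measure on `Gr_2(M)`. -/
abbrev IsVarifold {M : Set (Euc Q)} (v : Measure (GrBundle M)) : Prop := IsFiniteMeasure v

/-- Convergence of varifolds, i.e. weak convergence of measures on `Gr_2(M)`. -/
def VarifoldTendsto {M : Set (Euc Q)} (v : ℕ → Measure (GrBundle M)) (v' : Measure (GrBundle M)) :
    Prop :=
  ∀ f : C(GrBundle M, ℝ), Tendsto (fun k => ∫ q, f q ∂v k) atTop (𝓝 (∫ q, f q ∂v'))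

/-- The Jacobian of the restriction of a linear map to a plane. -/
def planeJacobian (L : Euc Q →L[ℝ] Euc Q) (P : Submodule ℝ (Euc Q)) : ℝ :=
  √ (Matrix.of fun i j => ⟪L (stdOrthonormalBasis ℝ P i), L (stdOrthonormalBasis ℝ P j)⟫).det

/-- The weight measure `‖F_* v‖` of the push-forward of a varifold by a map:
`‖F_* v‖(A)` is the integral over `{(p, Π) | F p ∈ A}` of the Jacobian of `dF(p)` on `Π`. -/
def pushforwardWeight {M : Set (Euc Q)} (F : Euc Q → Euc Q) (v : Measure (GrBundle M)) :
    Measure (Euc Q) :=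
  (v.withDensity fun q => ENNReal.ofReal (planeJacobian (fderiv ℝ F q.pt) q.plane)).map
    fun q => F q.pt

/-- A smooth family, for `|t| < ε`, of diffeomorphisms of `M` which preserve `N`, starting at the
identity. A map on the compact submanifold `M` is smooth when it is the restriction of a smooth
map on a neighborhood of `M`. -/
structure IsFreeBoundaryIsotopy (M N : Set (Euc Q)) (ε : ℝ) (F : ℝ → Euc Q → Euc Q) : Prop where
  pos : 0 < ε
  smooth : ∃ U : Set (Euc Q), IsOpen U ∧ M ⊆ U ∧
    ContDiffOn ℝ ∞ (fun q : ℝ × Euc Q => F q.1 q.2) (Ioo (-ε) ε ×ˢ U)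
  start : ∀ p ∈ M, F 0 p = p
  bijOn : ∀ t ∈ Ioo (-ε) ε, BijOn (F t) M M
  smooth_inverse : ∀ t ∈ Ioo (-ε) ε, ∃ (G : Euc Q → Euc Q) (U : Set (Euc Q)),
    IsOpen U ∧ M ⊆ U ∧ ContDiffOn ℝ ∞ G U ∧ ∀ p ∈ M, G (F t p) = p
  image_constraint : ∀ t ∈ Ioo (-ε) ε, F t '' N = N

/-- `v` is free boundary stationary for `(M, N)`: for every smooth family `F_t` of diffeomorphisms
of `M` preserving `N`, with `F_0` the identity, the derivative at `t = 0` of the mass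
`‖(F_t)_* v‖(M)` exists and vanishes. -/
def IsFreeBoundaryStationary (M N : Set (Euc Q)) (v : Measure (GrBundle M)) : Prop :=
  ∀ (ε : ℝ) (F : ℝ → Euc Q → Euc Q), IsFreeBoundaryIsotopy M N ε F →
    HasDerivAt (fun t => (pushforwardWeight (F t) v M).toReal) 0 0

variable {S : Type*} [TopologicalSpace S] [T2Space S] [CompactSpace S]
  [ChartedSpace (EuclideanHalfSpace 2) S] [IsManifold (𝓡∂ 2) ∞ S]

theorem IsAdmissible.range_mfderiv_le {M N : Set (Euc Q)} {Φ : S → Euc Q}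
    (h : IsAdmissible M N Φ) (x : S) :
    LinearMap.range (differential Φ x).toLinearMap
      ≤ tangentSpaceAt M (Φ x) := by
  have hd := ((h.smooth.mdifferentiable (by simp)) x).hasMFDerivAt.2
  change HasFDerivWithinAt (inChart Φ x) (differential Φ x) (range (𝓡∂ 2))
    (extChartAt (𝓡∂ 2) x x) at hd
  generalize differential Φ x = D at hd ⊢
  have hu : UniqueDiffWithinAt ℝ (range (𝓡∂ 2)) (extChartAt (𝓡∂ 2) x x) :=
    (𝓡∂ 2).uniqueDiffOn _ (by simp [extChartAt])
  have hmaps := hd.mapsTo_tangent_cone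
  have hsub : ∀ v ∈ tangentConeAt ℝ (range (𝓡∂ 2)) (extChartAt (𝓡∂ 2) x x),
      D v ∈ tangentSpaceAt M (Φ x) := by
    intro v hv
    refine Submodule.subset_span ?_
    have h1 := hmaps hv
    have h2 : inChart Φ x (extChartAt (𝓡∂ 2) x x) = Φ x := by
      exact congrArg Φ (extChartAt_to_inv x)
    rw [h2] at h1
    refine tangentConeAt_mono ?_ h1
    rintro _ ⟨y, -, rfl⟩
    exact h.mem_ambient _
  have hdense := hu.dense_tangentConeAt
  have hspan : Submodule.span ℝ (tangentConeAt ℝ (range (𝓡∂ 2)) (extChartAt (𝓡∂ 2) x x)) = ⊤ := by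
    have hc := Submodule.closed_of_finiteDimensional
      (Submodule.span ℝ (tangentConeAt ℝ (range (𝓡∂ 2)) (extChartAt (𝓡∂ 2) x x)))
    exact SetLike.coe_injective (by rw [← hc.closure_eq, hdense.closure_eq]; rfl)
  rintro _ ⟨v, rfl⟩
  have hv : v ∈ Submodule.span ℝ
      (tangentConeAt ℝ (range (𝓡∂ 2)) (extChartAt (𝓡∂ 2) x x)) := hspan ▸ Submodule.mem_top
  exact (Submodule.span_le (p := (tangentSpaceAt M (Φ x)).comap D.toLinearMap)).2 hsub hv

/-- The point `(Φ(x), dΦ(T_x S))` of the Grassmannian bundle. -/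
def IsAdmissible.tangentPlane {M N : Set (Euc Q)} {Φ : S → Euc Q} (h : IsAdmissible M N Φ)
    (x : S) : GrBundle M where
  pt := Φ x
  plane := LinearMap.range (differential Φ x).toLinearMap
  mem := h.mem_ambient x
  tangent := h.range_mfderiv_le x
  finrank_eq := by
    rw [LinearMap.finrank_range_of_inj (h.immersion x)]
    simp

/-- The varifold induced by an immersion: the push-forward of its area measure. -/
def IsAdmissible.inducedVarifold [MeasurableSpace S] {M N : Set (Euc Q)} {Φ : S → Euc Q}
    (h : IsAdmissible M N Φ) : Measure (GrBundle M) :=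
  (areaMeasure Φ).map h.tangentPlane

end Varifolds

end FreeBoundary

end

noncomputable section

set_option linter.unusedSectionVars false

namespace FreeBoundary

/-! ### Frames, Gram matrices and projections -/

section Frames

variable {Q : ℕ}

/-! Let `F_t` be an isotopy of `M` preserving `N`, with initial velocity `X`. Because `F_t` maps `N`
to itself, `F_t ∘ Φ_k` is an admissible variation of `Φ_k`, and its initial velocity is `X ∘ Φ_k`.
Almost criticality therefore bounds the derivative of the energy along it by `σ_k^5 ‖X ∘ Φ_k‖`. That
derivative is the sum of the first variation of area, which is the integral of `massVariation F`
against the induced varifold, and of `σ_k` and `σ_k^4` times the derivatives of boundary length and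
bending energy.

With constants depending on the isotopy but not on `k`, the length derivative is at most `C ·
length`, the bending derivative at most `C (area + bending)`, and the norm of `X ∘ Φ_k` at most `C
(1 + area + bending)`. Since `log (1/σ_k) ≥ 1` eventually, the entropy condition gives `σ_k · length
→ 0` and `σ_k^4 · bending → 0`, so the first variation of area tends to zero
(`tendsto_integral_massVariation`).

For stationarity of the limit, `Gr_2(M)` is compact and metrizable, so bounded area yields a weakly
convergent subsequence. The integrand `massVariation F` is continuous on `Gr_2(M)`, hence its
integral against the limit is zero; and `hasDerivAt_mass` identifies this integral with the
derivative of mass for every finite varifold.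

The main work is the uniform bending estimate. Its density is a smooth function of `t` and of the
2-jet of `Φ`, but the jets range over a noncompact set. Invariance under change of frame reduces to
orthonormal frames, invariance under tangential changes of the Hessian leaves only its part normal
to the surface, which is the second fundamental form plus a bounded term from the curvature of `M`
in Euclidean space, and homogeneity of degree four reduces this part to a bounded set. The time
derivative inherits all three properties (`timeDeriv_eq_mul`), so compactness bounds it by a
multiple of `1 + |II|⁴` times the area density. -/

theorem contDiffOn_gram {ι X : Type*} [NormedAddCommGroup X] [NormedSpace ℝ X] {s : Set X}
    {n : WithTop ℕ∞} {a : X → ι → Euc Q} (ha : ∀ i, ContDiffOn ℝ n (fun x => a x i) s) (i j : ι) :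
    ContDiffOn ℝ n (fun x => Matrix.gram ℝ (a x) i j) s :=
  (ha i).inner ℝ (ha j)

variable {ι : Type*} [Fintype ι] [DecidableEq ι]

/-- The orthogonal projection onto the span of a frame, written with the Gram matrix. -/
def frameProj (a : ι → Euc Q) (v : Euc Q) : Euc Q :=
  ∑ k, ∑ l, ((Matrix.gram ℝ a)⁻¹ k l * ⟪v, a l⟫) • a k

/-- The residual is orthogonal to each `a j` because the Gram matrix cancels its inverse. The
explicit formula shows that the projection depends smoothly on the frame. -/
theorem starProjection_span_eq_frameProj {a : ι → Euc Q} (h : (Matrix.gram ℝ a).det ≠ 0)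
    (v : Euc Q) : (Submodule.span ℝ (range a)).starProjection v = frameProj a v := by
  refine Submodule.eq_starProjection_of_mem_of_inner_eq_zero
    (K := Submodule.span ℝ (range a)) ?_ ?_
  · exact Submodule.sum_mem _ fun k _ => Submodule.sum_mem _ fun l _ =>
      Submodule.smul_mem _ _ (Submodule.subset_span ⟨k, rfl⟩)
  · intro w hw
    induction hw using Submodule.span_induction with
    | mem x hx =>
      obtain ⟨j, rfl⟩ := hx
      have h1 : (Matrix.gram ℝ a) * (Matrix.gram ℝ a)⁻¹ = 1 :=
        Matrix.mul_nonsing_inv _ (isUnit_iff_ne_zero.2 h)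
      have h2 : ⟪frameProj a v, a j⟫ =
          ∑ l, ((Matrix.gram ℝ a) * (Matrix.gram ℝ a)⁻¹) j l * ⟪v, a l⟫ := by
        simp only [frameProj, sum_inner, inner_smul_left, Matrix.mul_apply, Matrix.gram_apply,
          Finset.sum_mul]
        rw [Finset.sum_comm]
        refine Finset.sum_congr rfl fun l _ => Finset.sum_congr rfl fun k _ => ?_
        rw [real_inner_comm (a j) (a k)]
        simp only [conj_trivial]
        ring
      rw [inner_sub_left, h2, h1]
      simp [Matrix.one_apply]
    | zero => simp
    | add x y _ _ hx hy => rw [inner_add_right, hx, hy, add_zero]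
    | smul c x _ hx => rw [inner_smul_right, hx, mul_zero]

theorem contDiffOn_matrix_det {X : Type*} [NormedAddCommGroup X] [NormedSpace ℝ X] {s : Set X}
    {n : WithTop ℕ∞} {A : X → Matrix ι ι ℝ} (hA : ∀ i j, ContDiffOn ℝ n (fun x => A x i j) s) :
    ContDiffOn ℝ n (fun x => (A x).det) s := by
  simp only [Matrix.det_apply]
  refine ContDiffOn.sum fun τ _ => ?_
  exact (contDiffOn_prod fun i _ => hA _ _).const_smul _

/-- Cramer's rule: an adjugate entry is the determinant of the matrix with one row replaced by a
constant basis vector. -/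
theorem contDiffOn_matrix_inv {X : Type*} [NormedAddCommGroup X] [NormedSpace ℝ X] {s : Set X}
    {n : WithTop ℕ∞} {A : X → Matrix ι ι ℝ} (hA : ∀ i j, ContDiffOn ℝ n (fun x => A x i j) s)
    (hdet : ∀ x ∈ s, (A x).det ≠ 0) (i j : ι) :
    ContDiffOn ℝ n (fun x => (A x)⁻¹ i j) s := by
  simp only [Matrix.inv_def, Matrix.smul_apply, smul_eq_mul, Ring.inverse_eq_inv',
    Matrix.adjugate_apply]
  refine ((contDiffOn_matrix_det hA).inv hdet).mul (contDiffOn_matrix_det fun k l => ?_)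
  by_cases hk : k = j
  · subst hk; simpa using contDiffOn_const
  · simpa [Matrix.updateRow_ne hk] using hA k l

theorem contDiffOn_frameProj {X : Type*} [NormedAddCommGroup X] [NormedSpace ℝ X] {s : Set X}
    {n : WithTop ℕ∞} {a : X → ι → Euc Q} (ha : ∀ i, ContDiffOn ℝ n (fun x => a x i) s)
    (hdet : ∀ x ∈ s, (Matrix.gram ℝ (a x)).det ≠ 0) {v : X → Euc Q} (hv : ContDiffOn ℝ n v s) :
    ContDiffOn ℝ n (fun x => frameProj (a x) (v x)) s := by
  refine ContDiffOn.sum fun k _ => ContDiffOn.sum fun l _ => ?_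
  exact ((contDiffOn_matrix_inv (contDiffOn_gram ha) hdet k l).mul (hv.inner ℝ (ha l))).smul (ha k)

theorem frameProj_mem_span (a : ι → Euc Q) (v : Euc Q) :
    frameProj a v ∈ Submodule.span ℝ (range a) :=
  Submodule.sum_mem _ fun k _ => Submodule.sum_mem _ fun _ _ =>
    Submodule.smul_mem _ _ (Submodule.subset_span ⟨k, rfl⟩)

theorem frameProj_add (a : ι → Euc Q) (v w : Euc Q) :
    frameProj a (v + w) = frameProj a v + frameProj a w := by
  simp only [frameProj, inner_add_left, mul_add, add_smul, Finset.sum_add_distrib]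

theorem frameProj_smul (a : ι → Euc Q) (c : ℝ) (v : Euc Q) :
    frameProj a (c • v) = c • frameProj a v := by
  simp only [frameProj, inner_smul_left, Finset.smul_sum, smul_smul]
  simp only [conj_trivial]
  refine Finset.sum_congr rfl fun l _ => Finset.sum_congr rfl fun k _ => ?_
  congr 1
  ring

theorem frameProj_of_mem {a : ι → Euc Q} (h : (Matrix.gram ℝ a).det ≠ 0) {v : Euc Q}
    (hv : v ∈ Submodule.span ℝ (range a)) : frameProj a v = v := by
  rw [← starProjection_span_eq_frameProj h]
  exact Submodule.starProjection_eq_self_iff.2 hv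

end Frames

/-! ### Change of frame -/

section ChangeOfFrame

variable {Q : ℕ}

theorem gram_change {ι κ : Type*} [Fintype κ] (C : Matrix ι κ ℝ) (e : κ → Euc Q) :
    Matrix.gram ℝ (fun i => ∑ k, C i k • e k) = C * Matrix.gram ℝ e * Cᵀ := by
  ext i j
  simp only [Matrix.gram_apply, sum_inner, inner_sum, inner_smul_left, inner_smul_right,
    Matrix.mul_apply, Matrix.transpose_apply, conj_trivial, Finset.sum_mul, Finset.mul_sum]
  refine Finset.sum_congr rfl fun l _ => Finset.sum_congr rfl fun k _ => ?_
  ring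

theorem inner_eq_sum_coord (x y : Euc Q) : ⟪x, y⟫ = ∑ q, x q * y q := by
  simp [PiLp.inner_apply, mul_comm]

/-- Working one ambient coordinate at a time turns the contraction into a trace, so that frame
invariance becomes cyclicity of the trace. -/
theorem normSqTwo_eq_sum_trace (g : Matrix (Fin 2) (Fin 2) ℝ) (b : Fin 2 → Fin 2 → Euc Q) :
    normSqTwo g b = ∑ q, ((Matrix.of fun i j => b i j q)ᵀ * g⁻¹ * (Matrix.of fun i j => b i j q)
      * (g⁻¹)ᵀ).trace := by
  simp only [normSqTwo, inner_eq_sum_coord, Matrix.trace, Matrix.diag, Matrix.mul_apply,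
    Matrix.transpose_apply, Matrix.of_apply, Fin.sum_univ_two, ← Finset.sum_add_distrib,
    Finset.mul_sum]
  refine Finset.sum_congr rfl fun q _ => ?_
  ring

theorem normSqTwo_change {C : Matrix (Fin 2) (Fin 2) ℝ} (hC : IsUnit C.det)
    (g : Matrix (Fin 2) (Fin 2) ℝ) (b : Fin 2 → Fin 2 → Euc Q) :
    normSqTwo (C * g * Cᵀ) (fun i j => ∑ k, ∑ l, (C i k * C j l) • b k l) = normSqTwo g b := by
  rw [normSqTwo_eq_sum_trace, normSqTwo_eq_sum_trace]
  refine Finset.sum_congr rfl fun q _ => ?_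
  set β : Matrix (Fin 2) (Fin 2) ℝ := Matrix.of fun i j => b i j q with hβ
  have h1 : (Matrix.of fun i j => (∑ k, ∑ l, (C i k * C j l) • b k l) q) = C * β * Cᵀ := by
    ext i j
    simp only [Matrix.of_apply, Matrix.mul_apply, Matrix.transpose_apply, Fin.sum_univ_two,
      PiLp.add_apply, PiLp.smul_apply, smul_eq_mul, hβ]
    ring
  have h2 : C⁻¹ * C = 1 := Matrix.nonsing_inv_mul _ hC
  have h3 : Cᵀ * (Cᵀ)⁻¹ = 1 := Matrix.mul_nonsing_inv _ (by simpa using hC)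
  rw [h1]
  simp only [Matrix.mul_inv_rev, Matrix.transpose_mul, Matrix.transpose_transpose,
    Matrix.transpose_nonsing_inv]
  calc _ = (C * (βᵀ * ((Cᵀ * (Cᵀ)⁻¹) * (g⁻¹ * ((C⁻¹ * C) * (β * ((Cᵀ * (Cᵀ)⁻¹)
        * ((gᵀ)⁻¹ * C⁻¹)))))))).trace := by simp only [Matrix.mul_assoc]
    _ = (βᵀ * g⁻¹ * β * (gᵀ)⁻¹).trace := by
        rw [h2, h3, Matrix.trace_mul_comm]
        simp only [Matrix.one_mul, Matrix.mul_assoc, h2, Matrix.mul_one]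

theorem normSqOne_eq_sum_dot (g : Matrix (Fin 2) (Fin 2) ℝ) (b : Fin 2 → Euc Q) :
    normSqOne g b = ∑ q, (fun i => b i q) ⬝ᵥ (g⁻¹ *ᵥ fun i => b i q) := by
  simp only [normSqOne, inner_eq_sum_coord, dotProduct, Matrix.mulVec, Fin.sum_univ_two,
    ← Finset.sum_add_distrib, Finset.mul_sum]
  refine Finset.sum_congr rfl fun q _ => ?_
  ring

theorem normSqOne_change {C : Matrix (Fin 2) (Fin 2) ℝ} (hC : IsUnit C.det)
    (g : Matrix (Fin 2) (Fin 2) ℝ) (b : Fin 2 → Euc Q) :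
    normSqOne (C * g * Cᵀ) (fun i => ∑ k, C i k • b k) = normSqOne g b := by
  rw [normSqOne_eq_sum_dot, normSqOne_eq_sum_dot]
  refine Finset.sum_congr rfl fun q _ => ?_
  have h1 : (fun i => (∑ k, C i k • b k) q) = C *ᵥ fun i => b i q := by
    ext i
    simp [Matrix.mulVec, dotProduct]
  have h2 : C⁻¹ * C = 1 := Matrix.nonsing_inv_mul _ hC
  have h3 : Cᵀ * (Cᵀ)⁻¹ = 1 := Matrix.mul_nonsing_inv _ (by simpa using hC)
  rw [h1, Matrix.mulVec_mulVec, ← Matrix.vecMul_transpose, ← Matrix.dotProduct_mulVec,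
    Matrix.mulVec_mulVec]
  congr 2
  simp only [Matrix.mul_inv_rev]
  calc _ = (Cᵀ * (Cᵀ)⁻¹) * (g⁻¹ * (C⁻¹ * C)) := by simp only [Matrix.mul_assoc]
    _ = g⁻¹ := by rw [h2, h3]; simp

theorem normSqTwo_one (b : Fin 2 → Fin 2 → Euc Q) :
    normSqTwo 1 b = ∑ i, ∑ j, ‖b i j‖ ^ 2 := by
  simp [normSqTwo, Matrix.one_apply, Fin.sum_univ_two]

theorem normSqOne_one (b : Fin 2 → Euc Q) : normSqOne 1 b = ∑ i, ‖b i‖ ^ 2 := by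
  simp [normSqOne, Matrix.one_apply, Fin.sum_univ_two]

theorem gram_orthonormal {ι : Type*} [DecidableEq ι] {e : ι → Euc Q} (he : Orthonormal ℝ e) :
    Matrix.gram ℝ e = 1 := by
  ext i j
  simp [Matrix.one_apply, orthonormal_iff_ite.1 he i j]

theorem eq_sum_inner_smul {ι : Type*} [Fintype ι] [DecidableEq ι] {e : ι → Euc Q}
    (he : Orthonormal ℝ e) {v : Euc Q} (hv : v ∈ Submodule.span ℝ (range e)) :
    v = ∑ k, ⟪v, e k⟫ • e k := by
  conv_lhs => rw [← frameProj_of_mem (by rw [gram_orthonormal he]; simp) hv]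
  simp [frameProj, gram_orthonormal he, Matrix.one_apply]

/-- A plane has an orthonormal basis, which computes the Jacobian on it. -/
theorem exists_orthonormal_planeJacobian {P : Submodule ℝ (Euc Q)}
    (hP : Module.finrank ℝ P = 2) :
    ∃ f : Fin 2 → Euc Q, Orthonormal ℝ f ∧ Submodule.span ℝ (range f) = P ∧
      ∀ L : Euc Q →L[ℝ] Euc Q, planeJacobian L P = √ (Matrix.gram ℝ fun i => L (f i)).det := by
  let f : Fin 2 → Euc Q := fun i => (stdOrthonormalBasis ℝ P ((finCongr hP.symm) i) : Euc Q)
  refine ⟨f, ?_, ?_, fun L => ?_⟩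
  · exact ((stdOrthonormalBasis ℝ P).orthonormal.comp _ (finCongr hP.symm).injective
      ).comp_linearIsometry (Submodule.subtypeₗᵢ _)
  · have h1 : range f = Subtype.val '' range (stdOrthonormalBasis ℝ P) := by
      rw [← range_comp]
      exact (finCongr hP.symm).surjective.range_comp
        (fun i => (stdOrthonormalBasis ℝ P i : Euc Q))
    have h2 := (stdOrthonormalBasis ℝ P).toBasis.span_eq
    rw [OrthonormalBasis.coe_toBasis] at h2
    have h3 := congrArg (Submodule.map (Submodule.subtype _)) h2
    rw [Submodule.map_span, Submodule.map_top, Submodule.range_subtype] at h3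
    rw [h1]; exact h3
  · rw [planeJacobian, ← Matrix.det_submatrix_equiv_self (finCongr hP.symm)]
    rfl

/-- Every frame of a plane comes from an orthonormal one by an invertible matrix. -/
theorem exists_orthonormal_frame {a : Fin 2 → Euc Q} (ha : (Matrix.gram ℝ a).det ≠ 0) :
    ∃ (e : Fin 2 → Euc Q) (C : Matrix (Fin 2) (Fin 2) ℝ), Orthonormal ℝ e ∧ IsUnit C.det ∧
      (a = fun i => ∑ k, C i k • e k) ∧ Matrix.gram ℝ a = C * Cᵀ ∧
      Submodule.span ℝ (range e) = Submodule.span ℝ (range a) ∧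
      ∀ L : Euc Q →L[ℝ] Euc Q, planeJacobian L (Submodule.span ℝ (range a))
        = √ (Matrix.gram ℝ fun i => L (e i)).det := by
  have hli : LinearIndependent ℝ a := Matrix.linearIndependent_of_det_gram_ne_zero ha
  have hfr : Module.finrank ℝ (Submodule.span ℝ (range a)) = 2 := by
    simpa using finrank_span_eq_card hli
  obtain ⟨e, he, hspan, hJ⟩ := exists_orthonormal_planeJacobian hfr
  let C : Matrix (Fin 2) (Fin 2) ℝ := Matrix.of fun i k => ⟪a i, e k⟫
  have haC : a = fun i => ∑ k, C i k • e k := by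
    ext1 i
    exact eq_sum_inner_smul he (by rw [hspan]; exact Submodule.subset_span ⟨i, rfl⟩)
  have h4 : Matrix.gram ℝ a = C * Cᵀ := by
    rw [haC, gram_change, gram_orthonormal he, Matrix.mul_one]
  refine ⟨e, C, he, ?_, haC, h4, hspan, hJ⟩
  rw [h4] at ha
  simp only [Matrix.det_mul, ne_eq, mul_eq_zero, not_or] at ha
  exact isUnit_iff_ne_zero.2 ha.1

end ChangeOfFrame

/-! ### The Jacobian on a plane -/

section Jacobian

variable {Q : ℕ}

/-- The area density of the image of a frame. -/
theorem sqrt_det_gram_map (L : Euc Q →L[ℝ] Euc Q) {a : Fin 2 → Euc Q}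
    (ha : (Matrix.gram ℝ a).det ≠ 0) :
    √ (Matrix.gram ℝ fun i => L (a i)).det
      = planeJacobian L (Submodule.span ℝ (range a)) * √ (Matrix.gram ℝ a).det := by
  obtain ⟨e, C, he, -, haC, h4, -, hJ⟩ := exists_orthonormal_frame ha
  have h3 : (Matrix.gram ℝ fun i => L (a i)) = C * (Matrix.gram ℝ fun i => L (e i)) * Cᵀ := by
    rw [← gram_change, haC]
    simp
  rw [hJ, h3, h4, ← Real.sqrt_mul']
  · congr 1
    simp only [Matrix.det_mul, Matrix.det_transpose]
    ring
  · rw [Matrix.det_mul, Matrix.det_transpose]; exact mul_self_nonneg _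

/-- The square of the Jacobian of `L` on the range of the orthogonal projection `P`, as a smooth
function of `L` and `P`. -/
def jacobianSq (L P : Euc Q →L[ℝ] Euc Q) : ℝ :=
  ((∑ i, ⟪L (P (EuclideanSpace.single i 1)), L (P (EuclideanSpace.single i 1))⟫) ^ 2
    - ∑ i, ∑ j, ⟪L (P (EuclideanSpace.single i 1)), L (P (EuclideanSpace.single j 1))⟫ ^ 2) / 2

/-- If `G` is the Gram matrix of `L` on an orthonormal basis of `P`, the Gram matrix of the vectors
`L (P e_i)` is `c G cᵀ` with `cᵀ c = 1`. Hence both have the same trace and trace of the square, and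
`det G = ((tr G)² - tr G²) / 2` for a 2 by 2 matrix. This removes the arbitrary choice of basis,
which need not vary smoothly with `P`. -/
theorem planeJacobian_eq_sqrt_jacobianSq (L : Euc Q →L[ℝ] Euc Q) {P : Submodule ℝ (Euc Q)}
    (hP : Module.finrank ℝ P = 2) :
    planeJacobian L P = √ (jacobianSq L P.starProjection) := by
  obtain ⟨f, hf, hspan, hJac⟩ := exists_orthonormal_planeJacobian hP
  rw [hJac]
  congr 1
  let c : Matrix (Fin Q) (Fin 2) ℝ := Matrix.of fun i k => f k i
  set G := Matrix.gram ℝ fun i => L (f i) with hG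
  have hproj : ∀ i, P.starProjection (EuclideanSpace.single i 1) = ∑ k, c i k • f k := by
    intro i
    rw [← hspan, starProjection_span_eq_frameProj (by rw [gram_orthonormal hf]; simp)]
    simp [frameProj, gram_orthonormal hf, Matrix.one_apply, EuclideanSpace.inner_single_left, c]
  have hS : (Matrix.gram ℝ fun i => L (P.starProjection (EuclideanSpace.single i 1)))
      = c * G * cᵀ := by
    rw [hG, ← gram_change]
    congr 1; ext1 i; rw [hproj i]; simp
  have hcc : cᵀ * c = 1 := by
    rw [← gram_orthonormal hf]
    ext i j
    simp [Matrix.mul_apply, c, inner_eq_sum_coord]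
  set S := Matrix.gram ℝ fun i => L (P.starProjection (EuclideanSpace.single i 1)) with hSdef
  have htr1 : S.trace = G.trace := by
    rw [hS, Matrix.trace_mul_comm, ← Matrix.mul_assoc, hcc, Matrix.one_mul]
  have htr2 : (S * S).trace = (G * G).trace := by
    rw [hS]
    calc _ = (c * (G * ((cᵀ * c) * (G * cᵀ)))).trace := by simp only [Matrix.mul_assoc]
      _ = (G * G).trace := by
        rw [hcc, Matrix.trace_mul_comm, Matrix.one_mul, Matrix.mul_assoc, Matrix.mul_assoc, hcc,
          Matrix.mul_one]
  have hsymm : ∀ i j, S i j = S j i := fun i j => by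
    simp only [hSdef, Matrix.gram_apply]; exact real_inner_comm _ _
  have hJ : jacobianSq L P.starProjection = (S.trace ^ 2 - (S * S).trace) / 2 := by
    simp only [jacobianSq, Matrix.trace, Matrix.diag, Matrix.mul_apply]
    congr 2
    refine Finset.sum_congr rfl fun i _ => Finset.sum_congr rfl fun j _ => ?_
    rw [hsymm j i, sq]; rfl
  rw [hJ, htr1, htr2, Matrix.det_fin_two]
  simp only [Matrix.trace, Matrix.diag, Matrix.mul_apply, Fin.sum_univ_two]
  ring

theorem contDiffOn_jacobianSq {X : Type*} [NormedAddCommGroup X] [NormedSpace ℝ X] {s : Set X}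
    {n : WithTop ℕ∞} {L P : X → Euc Q →L[ℝ] Euc Q} (hL : ContDiffOn ℝ n L s)
    (hP : ContDiffOn ℝ n P s) : ContDiffOn ℝ n (fun x => jacobianSq (L x) (P x)) s := by
  have h : ∀ i : Fin Q, ContDiffOn ℝ n (fun x => L x (P x (EuclideanSpace.single i 1))) s :=
    fun i => hL.clm_apply (hP.clm_apply contDiffOn_const)
  unfold jacobianSq
  refine ContDiffOn.div_const (ContDiffOn.sub (ContDiffOn.pow (ContDiffOn.sum fun i _ => ?_) 2)
    (ContDiffOn.sum fun i _ => ContDiffOn.sum fun j _ => ContDiffOn.pow ?_ 2)) 2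
  · exact (h i).inner ℝ (h i)
  · exact (h i).inner ℝ (h j)

theorem planeJacobian_of_fixed {L : Euc Q →L[ℝ] Euc Q} {P : Submodule ℝ (Euc Q)}
    (hP : Module.finrank ℝ P = 2) (hL : ∀ v ∈ P, L v = v) :
    planeJacobian L P = 1 := by
  obtain ⟨f, hf, hspan, hJac⟩ := exists_orthonormal_planeJacobian hP
  have h : (fun i => L (f i)) = f := by
    ext1 i
    exact hL _ (by rw [← hspan]; exact Submodule.subset_span ⟨i, rfl⟩)
  rw [hJac, h, gram_orthonormal hf]
  simp

end Jacobian

/-! ### Tangent spaces of submanifolds -/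

section TangentSpaces

variable {Q : ℕ}

theorem starProjection_congr {K K' : Submodule ℝ (Euc Q)} (h : K = K') :
    K.starProjection = K'.starProjection := by
  subst h; rfl

theorem mem_of_mem_tangentConeAt_submodule {L : Submodule ℝ (Euc Q)} {x v : Euc Q} (hx : x ∈ L)
    (hv : v ∈ tangentConeAt ℝ (L : Set (Euc Q)) x) : v ∈ L := by
  obtain ⟨c, d, -, hd, hcd⟩ := mem_tangentConeAt_iff_exists_seq.1 hv
  refine L.closed_of_finiteDimensional.mem_of_tendsto hcd ?_
  filter_upwards [hd] with n hn
  refine L.smul_mem _ ?_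
  simpa using L.sub_mem hn hx

theorem mem_tangentConeAt_submodule {L : Submodule ℝ (Euc Q)} {x v : Euc Q} (hx : x ∈ L)
    (hv : v ∈ L) : v ∈ tangentConeAt ℝ (L : Set (Euc Q)) x := by
  have h := mem_tangentConeAt_of_segment_subset (x := x) (y := x + v) (s := (L : Set (Euc Q)))
    (L.convex.segment_subset hx (L.add_mem hx hv))
  simpa using h

theorem fderiv_symm_comp_fderiv {ψ : OpenPartialHomeomorph (Euc Q) (Euc Q)}
    (h1 : ContDiffOn ℝ ∞ ψ ψ.source) (h2 : ContDiffOn ℝ ∞ ψ.symm ψ.target) {q : Euc Q}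
    (hq : q ∈ ψ.source) (v : Euc Q) :
    fderiv ℝ ψ.symm (ψ q) (fderiv ℝ ψ q v) = v := by
  have d1 : HasFDerivAt ψ (fderiv ℝ ψ q) q :=
    ((h1.contDiffAt (ψ.open_source.mem_nhds hq)).differentiableAt (by simp)).hasFDerivAt
  have d2 : HasFDerivAt ψ.symm (fderiv ℝ ψ.symm (ψ q)) (ψ q) :=
    ((h2.contDiffAt (ψ.open_target.mem_nhds (ψ.map_source hq))).differentiableAt
      (by simp)).hasFDerivAt
  have d3 := d2.comp q d1
  have d4 : HasFDerivAt (ψ.symm ∘ ψ) (ContinuousLinearMap.id ℝ (Euc Q)) q :=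
    (hasFDerivAt_id q).congr_of_eventuallyEq (ψ.eventually_left_inverse hq)
  exact congrArg (fun A : Euc Q →L[ℝ] Euc Q => A v) (d3.unique d4)

/-- The differentials of the straightening map and of its inverse carry tangent cones to tangent
cones; tangent cones are local, so intersecting with the source or target changes nothing. -/
theorem tangentSpaceAt_eq_map {M : Set (Euc Q)} {ψ : OpenPartialHomeomorph (Euc Q) (Euc Q)}
    (h1 : ContDiffOn ℝ ∞ ψ ψ.source) (h2 : ContDiffOn ℝ ∞ ψ.symm ψ.target)
    {L : Submodule ℝ (Euc Q)} (hL : ψ.IsImage M (L : Set (Euc Q))) {q : Euc Q}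
    (hq : q ∈ ψ.source) (hqM : q ∈ M) :
    tangentSpaceAt M q = L.map (fderiv ℝ ψ.symm (ψ q)).toLinearMap := by
  have hψq : ψ q ∈ L := (hL hq).2 hqM
  apply le_antisymm
  · refine Submodule.span_le.2 fun v hv => ?_
    have d1 : HasFDerivAt ψ (fderiv ℝ ψ q) q :=
      ((h1.contDiffAt (ψ.open_source.mem_nhds hq)).differentiableAt (by simp)).hasFDerivAt
    rw [← tangentConeAt_inter_nhds (ψ.open_source.mem_nhds hq)] at hv
    have h3 := (d1.hasFDerivWithinAt (s := M ∩ ψ.source)).mapsTo_tangent_cone hv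
    refine ⟨fderiv ℝ ψ q v, mem_of_mem_tangentConeAt_submodule hψq (tangentConeAt_mono ?_ h3),
      fderiv_symm_comp_fderiv h1 h2 hq v⟩
    rintro _ ⟨x, ⟨hxM, hxs⟩, rfl⟩
    exact (hL hxs).2 hxM
  · rintro _ ⟨l, hl, rfl⟩
    have d2 : HasFDerivAt ψ.symm (fderiv ℝ ψ.symm (ψ q)) (ψ q) :=
      ((h2.contDiffAt (ψ.open_target.mem_nhds (ψ.map_source hq))).differentiableAt
        (by simp)).hasFDerivAt
    have h4 := mem_tangentConeAt_submodule hψq hl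
    rw [← tangentConeAt_inter_nhds (ψ.open_target.mem_nhds (ψ.map_source hq))] at h4
    have h5 := (d2.hasFDerivWithinAt (s := (L : Set (Euc Q)) ∩ ψ.target)).mapsTo_tangent_cone h4
    rw [ψ.left_inv hq] at h5
    refine Submodule.subset_span (tangentConeAt_mono ?_ h5)
    rintro _ ⟨x, ⟨hxL, hxt⟩, rfl⟩
    exact (hL.symm hxt).2 hxL

/-- The inverse straightening carries a fixed basis of the model subspace to a smooth frame, defined
also off `M` and spanning the tangent space on `M`; `frameProj` of this frame is smooth. -/
theorem exists_local_smooth_tangentProj {M : Set (Euc Q)} {d : ℕ}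
    (hM : IsEmbeddedSubmanifold d M) {p : Euc Q} (hp : p ∈ M) :
    ∃ U, IsOpen U ∧ p ∈ U ∧ ∃ g : Euc Q → Euc Q →L[ℝ] Euc Q, ContDiffOn ℝ ∞ g U ∧
      ∀ q ∈ U, q ∈ M → g q = tangentProj M q := by
  obtain ⟨ψ, hpψ, h1, h2, L, -, hL⟩ := hM p hp
  let ℓ := Module.finBasis ℝ L
  let a : Euc Q → Fin (Module.finrank ℝ L) → Euc Q :=
    fun q i => fderiv ℝ ψ.symm (ψ q) (ℓ i)
  have hspan : ∀ q, Submodule.span ℝ (range (a q))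
      = L.map (fderiv ℝ ψ.symm (ψ q)).toLinearMap := by
    intro q
    have h3 : range (a q) = (fderiv ℝ ψ.symm (ψ q)).toLinearMap '' (L.subtype '' range ℓ) := by
      rw [← range_comp, ← range_comp]; rfl
    rw [h3, Submodule.span_image, Submodule.span_image, ℓ.span_eq, Submodule.map_top,
      Submodule.range_subtype]
  have hinj : ∀ q ∈ ψ.source, Function.Injective (fderiv ℝ ψ.symm (ψ q)) := by
    intro q hq
    have h3 := fderiv_symm_comp_fderiv (ψ := ψ.symm) h2 (by simpa using h1) (ψ.map_source hq)
    simp only [OpenPartialHomeomorph.symm_symm] at h3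
    exact Function.LeftInverse.injective h3
  have hli : ∀ q ∈ ψ.source, (Matrix.gram ℝ (a q)).det ≠ 0 := by
    intro q hq
    rw [Matrix.det_gram_ne_zero_iff_linearIndependent]
    have h4 : LinearIndependent ℝ (fun i => (ℓ i : Euc Q)) :=
      ℓ.linearIndependent.map' L.subtype (by simp)
    exact h4.map' (fderiv ℝ ψ.symm (ψ q)).toLinearMap (LinearMap.ker_eq_bot.2 (hinj q hq))
  refine ⟨ψ.source, ψ.open_source, hpψ, fun q => (Submodule.span ℝ (range (a q))).starProjection,
    ?_, fun q hq hqM => ?_⟩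
  · rw [contDiffOn_clm_apply]
    intro v
    refine ContDiffOn.congr (f := fun q => frameProj (a q) v) ?_ fun q hq =>
      starProjection_span_eq_frameProj (hli q hq) v
    refine contDiffOn_frameProj (fun i => ?_) hli contDiffOn_const
    have h5 : ContDiffOn ℝ ∞ (fderiv ℝ ψ.symm) ψ.target :=
      h2.fderiv_of_isOpen ψ.open_target (by simp)
    exact (h5.comp h1 ψ.mapsTo).clm_apply contDiffOn_const
  · have h6 : Submodule.span ℝ (range (a q)) = tangentSpaceAt M q := by
      rw [tangentSpaceAt_eq_map h1 h2 hL hq hqM, hspan]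
    exact starProjection_congr h6

/-- The projections onto the tangent spaces of a closed submanifold extend to a smooth map. -/
theorem exists_smooth_tangentProj {M : Set (Euc Q)} {d : ℕ}
    (hM : IsEmbeddedSubmanifold d M) (hMc : IsClosed M) :
    ∃ g : Euc Q → Euc Q →L[ℝ] Euc Q, ContDiff ℝ ∞ g ∧ ∀ q ∈ M, g q = tangentProj M q := by
  classical
  -- The prescribed values form a singleton on `M` and the whole space off `M`; both are convex, so
  -- a partition of unity glues the local extensions.
  obtain ⟨g, hg⟩ := exists_contMDiffMap_forall_mem_convex_of_local (n := ⊤) 𝓘(ℝ, Euc Q)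
    (t := fun q => if q ∈ M then {tangentProj M q} else univ) (by
      intro q
      split_ifs
      exacts [convex_singleton _, convex_univ]) (by
      intro q
      by_cases hq : q ∈ M
      · obtain ⟨U, hU, hqU, g, hg, hgM⟩ := exists_local_smooth_tangentProj hM hq
        refine ⟨U, hU.mem_nhds hqU, g, hg.contMDiffOn, fun y hy => ?_⟩
        by_cases hyM : y ∈ M
        · simp [hyM, hgM y hy hyM]
        · simp [hyM]
      · refine ⟨Mᶜ, hMc.isOpen_compl.mem_nhds hq, fun _ => 0, contMDiffOn_const, fun y hy => ?_⟩
        have : y ∉ M := hy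
        simp [this])
  refine ⟨g, g.contMDiff.contDiff, fun q hq => ?_⟩
  simpa [hq] using hg q

end TangentSpaces

/-! ### Differentiation under the integral sign -/

/-- The tube lemma gives one time interval during which all points `(t, j x)` stay in `O`;
compactness then bounds the time derivative, which justifies domination. Since time enters only
through `Ψ`, the same statement serves the surface, its boundary and the Grassmannian bundle. -/
theorem hasDerivAt_setIntegral_of_contDiffOn {X W : Type*} [TopologicalSpace X]
    [MeasurableSpace X] [OpensMeasurableSpace X] [NormedAddCommGroup W] [NormedSpace ℝ W]
    {μ : Measure X} [IsFiniteMeasureOnCompacts μ] {K : Set X} (hK : IsCompact K)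
    (hKm : MeasurableSet K) {χ : X → ℝ} (hχ : ContinuousOn χ K) {j : X → W}
    (hj : ContinuousOn j K) {Ψ : ℝ × W → ℝ} {O : Set (ℝ × W)} (hO : IsOpen O)
    (hΨ : ContDiffOn ℝ 1 Ψ O) (h0 : ∀ x ∈ K, ((0 : ℝ), j x) ∈ O) :
    HasDerivAt (fun t : ℝ => ∫ x in K, χ x * Ψ (t, j x) ∂μ)
      (∫ x in K, χ x * fderiv ℝ Ψ (0, j x) (1, 0) ∂μ) 0 := by
  obtain ⟨V, W', hV, -, h0V, hKW, hVW⟩ := generalized_tube_lemma (isCompact_singleton (x := (0:ℝ)))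
    (hK.image_of_continuousOn hj) hO (by
      rintro ⟨t, w⟩ ⟨ht, x, hx, rfl⟩
      obtain rfl : t = 0 := ht
      exact h0 x hx)
  obtain ⟨δ, hδ, hδV⟩ := Metric.nhds_basis_closedBall.mem_iff.1 (hV.mem_nhds (h0V rfl))
  have hmem : ∀ t ∈ Metric.closedBall (0 : ℝ) δ, ∀ x ∈ K, (t, j x) ∈ O := fun t ht x hx =>
    hVW ⟨hδV ht, hKW ⟨x, hx, rfl⟩⟩
  have hD : ContinuousOn (fun z => fderiv ℝ Ψ z (1, 0)) O :=
    (hΨ.continuousOn_fderiv_of_isOpen hO le_rfl).clm_apply continuousOn_const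
  have hcomp : IsCompact (Metric.closedBall (0 : ℝ) δ ×ˢ (j '' K)) :=
    (isCompact_closedBall _ _).prod (hK.image_of_continuousOn hj)
  obtain ⟨C, hC⟩ := hcomp.exists_bound_of_continuousOn (hD.mono (by
    rintro ⟨t, w⟩ ⟨ht, x, hx, rfl⟩
    exact hmem t ht x hx))
  obtain ⟨C', hC'⟩ := hK.exists_bound_of_continuousOn hχ
  have hcont : ∀ t ∈ Metric.closedBall (0 : ℝ) δ,
      ContinuousOn (fun x => χ x * Ψ (t, j x)) K := fun t ht =>
    hχ.mul (hΨ.continuousOn.comp (continuousOn_const.prodMk hj) fun x hx => hmem t ht x hx)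
  have hfin : IsFiniteMeasure (μ.restrict K) := ⟨by simpa using hK.measure_lt_top⟩
  refine (hasDerivAt_integral_of_dominated_loc_of_deriv_le (μ := μ.restrict K)
    (F := fun t x => χ x * Ψ (t, j x)) (F' := fun t x => χ x * fderiv ℝ Ψ (t, j x) (1, 0))
    (bound := fun _ => C' * C) (Metric.closedBall_mem_nhds (0 : ℝ) hδ) ?_ ?_ ?_ ?_ ?_ ?_).2
  · filter_upwards [Metric.closedBall_mem_nhds (0 : ℝ) hδ] with t ht
    exact ((hcont t ht).integrableOn_compact' hK hKm).aestronglyMeasurable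
  · exact (hcont 0 (Metric.mem_closedBall_self hδ.le)).integrableOn_compact' hK hKm
  · refine ContinuousOn.integrableOn_compact' hK hKm (hχ.mul (hD.comp
      (continuousOn_const.prodMk hj) fun x hx => ?_)) |>.aestronglyMeasurable
    exact hmem 0 (Metric.mem_closedBall_self hδ.le) x hx
  · refine (ae_restrict_iff' hKm).2 (.of_forall fun x hx t ht => ?_)
    rw [norm_mul]
    exact mul_le_mul (hC' x hx) (hC (t, j x) ⟨ht, x, hx, rfl⟩) (norm_nonneg _)
      ((norm_nonneg _).trans (hC' x hx))
  · exact integrable_const _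
  · refine (ae_restrict_iff' hKm).2 (.of_forall fun x hx t ht => ?_)
    have h1 : HasFDerivAt Ψ (fderiv ℝ Ψ (t, j x)) (t, j x) :=
      ((hΨ.contDiffAt (hO.mem_nhds (hmem t ht x hx))).differentiableAt (by simp)).hasFDerivAt
    have h2 : HasDerivAt (fun t : ℝ => (t, j x)) ((1 : ℝ), (0 : W)) t :=
      (hasDerivAt_id t).prodMk (hasDerivAt_const t (j x))
    exact (h1.comp_hasDerivAt t h2).const_mul _

/-! ### Compactness -/

section Compactness

variable {Q : ℕ} {M : Set (Euc Q)}

/-- A point of the Grassmannian bundle as a point and an orthogonal projection. -/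
def GrBundle.toProd (q : GrBundle M) : Euc Q × (Euc Q →L[ℝ] Euc Q) :=
  (q.pt, q.plane.starProjection)

theorem GrBundle.isEmbedding_toProd : IsEmbedding (GrBundle.toProd (M := M)) where
  eq_induced := rfl
  injective := by
    intro q q' h
    have h1 : q.pt = q'.pt := congrArg Prod.fst h
    have h2 : q.plane.starProjection = q'.plane.starProjection := congrArg Prod.snd h
    refine GrBundle.ext h1 ?_
    rw [← Submodule.range_starProjection q.plane, ← Submodule.range_starProjection q'.plane, h2]

theorem GrBundle.continuous_toProd : Continuous (GrBundle.toProd (M := M)) :=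
  isEmbedding_toProd.continuous

theorem GrBundle.metrizableSpace : TopologicalSpace.MetrizableSpace (GrBundle M) :=
  isEmbedding_toProd.metrizableSpace

/-- In the space of pairs `(p, A)` the bundle is cut out by closed conditions on a bounded set: `A`
is a self-adjoint idempotent, `g p * A = A` expresses tangency, and trace two expresses the
dimension. Continuity of `g` is what makes tangency a closed condition. -/
theorem GrBundle.compactSpace (hMc : IsCompact M) {g : Euc Q → Euc Q →L[ℝ] Euc Q}
    (hg : Continuous g) (hgM : ∀ q ∈ M, g q = tangentProj M q) : CompactSpace (GrBundle M) := by
  have hrange : range (GrBundle.toProd (M := M)) =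
      {x | x.1 ∈ M ∧ ‖x.2‖ ≤ 1 ∧ IsStarProjection x.2 ∧ g x.1 * x.2 = x.2 ∧
        LinearMap.trace ℝ (Euc Q) x.2.toLinearMap = 2} := by
    ext ⟨p, A⟩
    constructor
    · rintro ⟨q, hq⟩
      obtain ⟨rfl, rfl⟩ := Prod.mk.inj hq
      refine ⟨q.mem, Submodule.starProjection_norm_le _, isStarProjection_starProjection, ?_, ?_⟩
      · ext1 v
        have h1 : q.plane.starProjection v ∈ tangentSpaceAt M q.pt :=
          q.tangent (Submodule.starProjection_apply_mem _ v)
        rw [hgM _ q.mem]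
        exact Submodule.starProjection_eq_self_iff.2 h1
      · have h2 : LinearMap.IsProj q.plane q.plane.starProjection.toLinearMap :=
          ⟨fun v => Submodule.starProjection_apply_mem _ v,
            fun v hv => Submodule.starProjection_eq_self_iff.2 hv⟩
        rw [h2.trace, q.finrank_eq]
        norm_num
    · rintro ⟨hp, -, hA, hgA, htr⟩
      dsimp only at hp hA hgA htr
      obtain ⟨_, h3⟩ := isStarProjection_iff_eq_starProjection_range.1 hA
      have h4 : LinearMap.IsProj A.toLinearMap.range A.toLinearMap := by
        refine ⟨fun v => ⟨v, rfl⟩, ?_⟩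
        rintro _ ⟨v, rfl⟩
        exact congrArg (fun B : Euc Q →L[ℝ] Euc Q => B v) hA.isIdempotentElem
      refine ⟨⟨p, A.toLinearMap.range, hp, ?_, ?_⟩, Prod.ext rfl h3.symm⟩
      · rintro _ ⟨v, rfl⟩
        have h5 : g p (A v) = A v := congrArg (fun B : Euc Q →L[ℝ] Euc Q => B v) hgA
        rw [hgM p hp] at h5
        exact Submodule.starProjection_eq_self_iff.1 h5
      · rw [h4.trace] at htr
        exact_mod_cast htr
  have hclosed : IsClosed {x : Euc Q × (Euc Q →L[ℝ] Euc Q) | IsStarProjection x.2 ∧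
      g x.1 * x.2 = x.2 ∧ LinearMap.trace ℝ (Euc Q) x.2.toLinearMap = 2} := by
    have h1 : {x : Euc Q × (Euc Q →L[ℝ] Euc Q) | IsStarProjection x.2 ∧
      g x.1 * x.2 = x.2 ∧ LinearMap.trace ℝ (Euc Q) x.2.toLinearMap = 2} =
      {x | x.2 * x.2 = x.2} ∩ {x | star x.2 = x.2} ∩ {x | g x.1 * x.2 = x.2} ∩
        {x | LinearMap.trace ℝ (Euc Q) x.2.toLinearMap = 2} := by
      ext x
      constructor
      · rintro ⟨h, h', h''⟩
        exact ⟨⟨⟨h.isIdempotentElem, h.isSelfAdjoint⟩, h'⟩, h''⟩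
      · rintro ⟨⟨⟨h, h'⟩, h''⟩, h3⟩
        exact ⟨⟨h, h'⟩, h'', h3⟩
    rw [h1]
    have htr : Continuous fun A : Euc Q →L[ℝ] Euc Q =>
        LinearMap.trace ℝ (Euc Q) A.toLinearMap :=
      ((LinearMap.trace ℝ (Euc Q)).comp
        (ContinuousLinearMap.coeLM ℝ : (Euc Q →L[ℝ] Euc Q) →ₗ[ℝ] _)).continuous_of_finiteDimensional
    refine (((isClosed_eq ?_ ?_).inter (isClosed_eq ?_ ?_)).inter (isClosed_eq ?_ ?_)).inter
      (isClosed_eq ?_ ?_)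
    · fun_prop
    · fun_prop
    · exact (ContinuousLinearMap.adjoint (𝕜 := ℝ) (E := Euc Q) (F := Euc Q)).continuous.comp
        continuous_snd
    · fun_prop
    · exact (hg.comp continuous_fst).mul continuous_snd
    · fun_prop
    · exact htr.comp continuous_snd
    · fun_prop
  have hcomp : IsCompact (range (GrBundle.toProd (M := M))) := by
    refine ((hMc.prod (isCompact_closedBall (0 : Euc Q →L[ℝ] Euc Q) 1)).inter_right
      hclosed).of_isClosed_subset ?_ ?_
    · rw [hrange]
      have : {x : Euc Q × (Euc Q →L[ℝ] Euc Q) | x.1 ∈ M ∧ ‖x.2‖ ≤ 1 ∧ IsStarProjection x.2 ∧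
          g x.1 * x.2 = x.2 ∧ LinearMap.trace ℝ (Euc Q) x.2.toLinearMap = 2} =
          (M ×ˢ Metric.closedBall 0 1) ∩ {x | IsStarProjection x.2 ∧
          g x.1 * x.2 = x.2 ∧ LinearMap.trace ℝ (Euc Q) x.2.toLinearMap = 2} := by
        ext x; simp [and_assoc]
      rw [this]
      exact (hMc.isClosed.prod Metric.isClosed_closedBall).inter hclosed
    · rw [hrange]
      rintro x ⟨h1, h2, h3⟩
      exact ⟨⟨h1, by simpa using h2⟩, h3⟩
  refine ⟨(isEmbedding_toProd.isCompact_iff).2 ?_⟩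
  rwa [image_univ]


/-- Sequential Banach–Alaoglu in the dual of `C(X)` supplies the subsequence and a limit functional.
Compactness of the set of measures of bounded mass supplies a cluster point of that subsequence,
which must represent the functional. -/
theorem exists_subseq_tendsto_of_mass_le {X : Type*} [TopologicalSpace X] [CompactSpace X]
    [TopologicalSpace.MetrizableSpace X] [MeasurableSpace X] [BorelSpace X]
    (μ : ℕ → Measure X) {C : ℝ} (hμ : ∀ k, μ k univ ≤ ENNReal.ofReal C) :
    ∃ φ : ℕ → ℕ, StrictMono φ ∧ ∃ ν : Measure X, IsFiniteMeasure ν ∧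
      ∀ f : C(X, ℝ), Tendsto (fun k => ∫ x, f x ∂μ (φ k)) atTop (𝓝 (∫ x, f x ∂ν)) := by
  have hfin : ∀ k, IsFiniteMeasure (μ k) := fun k => ⟨(hμ k).trans_lt ENNReal.ofReal_lt_top⟩
  have hint : ∀ k (f : C(X, ℝ)), Integrable f (μ k) := fun k f =>
    f.continuous.integrable_of_hasCompactSupport (HasCompactSupport.of_compactSpace _)
  have hC0 : ∀ k, (μ k).real univ ≤ max C 0 := fun k => by
    refine ENNReal.toReal_le_of_le_ofReal (le_max_right _ _) ((hμ k).trans ?_)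
    exact ENNReal.ofReal_le_ofReal (le_max_left _ _)
  let T : ℕ → C(X, ℝ) →ₗ[ℝ] ℝ := fun k =>
    { toFun := fun f => ∫ x, f x ∂μ k
      map_add' := fun f f' => integral_add (hint k f) (hint k f')
      map_smul' := fun c f => integral_const_mul c f }
  have hT : ∀ k f, ‖T k f‖ ≤ max C 0 * ‖f‖ := fun k f => by
    refine (norm_integral_le_of_norm_le_const (μ := μ k)
      (.of_forall fun x => f.norm_coe_le_norm x)).trans ?_
    rw [mul_comm]
    exact mul_le_mul_of_nonneg_right (hC0 k) (norm_nonneg _)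
  let Λ : ℕ → WeakDual ℝ C(X, ℝ) := fun k =>
    StrongDual.toWeakDual ((T k).mkContinuous (max C 0) (hT k))
  obtain ⟨Λ', -, φ, hφ, hΛ⟩ := (WeakDual.isSeqCompact_closedBall ℝ C(X, ℝ) 0 (max C 0))
    (x := Λ) (fun k => by
      simp only [mem_preimage, mem_closedBall_zero_iff]
      exact LinearMap.mkContinuous_norm_le _ (le_max_right _ _) (hT k))
  have hlim : ∀ f : C(X, ℝ), Tendsto (fun k => ∫ x, f x ∂μ (φ k)) atTop (𝓝 (Λ' f)) := fun f =>
    ((WeakDual.eval_continuous f).tendsto Λ').comp hΛ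
  let m : ℕ → FiniteMeasure X := fun k => ⟨μ (φ k), hfin _⟩
  obtain ⟨ν, -, hν⟩ := (isCompact_setOfPred_finiteMeasure_le_of_compactSpace X
    (max C 0).toNNReal) (f := map m atTop) (by
      refine le_principal_iff.2 (mem_map.2 (univ_mem' fun k => ?_))
      change (m k).mass ≤ _
      rw [← NNReal.coe_le_coe, Real.coe_toNNReal _ (le_max_right _ _)]
      exact hC0 (φ k))
  refine ⟨φ, hφ, ν, inferInstance, fun f => ?_⟩
  have hev : Continuous fun ρ : FiniteMeasure X => ∫ x, f x ∂(ρ : Measure X) :=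
    FiniteMeasure.continuous_integral_boundedContinuousFunction
      (BoundedContinuousFunction.mkOfCompact f)
  have h1 : MapClusterPt (∫ x, f x ∂(ν : Measure X)) atTop (fun k => ∫ x, f x ∂μ (φ k)) :=
    MapClusterPt.continuousAt_comp (f := fun ρ : FiniteMeasure X => ∫ x, f x ∂(ρ : Measure X))
      hev.continuousAt hν
  -- This further subsequence may depend on `f`; it only serves to identify the limit, since the
  -- integrals along `φ` already converge.
  obtain ⟨ψ, hψ, hlim'⟩ := h1.tendsto_subseq
  have h2 : Λ' f = ∫ x, f x ∂(ν : Measure X) :=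
    tendsto_nhds_unique ((hlim f).comp hψ.tendsto_atTop) hlim'
  rw [← h2]
  exact hlim f

end Compactness

/-! ### Partial derivatives in the half plane -/

section PartialDerivatives

variable {Q : ℕ}

theorem pd_eq_of_hasFDerivWithinAt {u : Plane → Euc Q} {u' : Plane →L[ℝ] Euc Q} {y : Plane}
    (hy : y ∈ range (𝓡∂ 2)) (h : HasFDerivWithinAt u u' (range (𝓡∂ 2)) y) (i : Fin 2) :
    pd u i y = u' (EuclideanSpace.single i 1) := by
  rw [pd, h.fderivWithin ((𝓡∂ 2).uniqueDiffOn y hy)]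

theorem pd_comp {G : Euc Q → Euc Q} {u : Plane → Euc Q} {y : Plane} (hy : y ∈ range (𝓡∂ 2))
    (hG : DifferentiableAt ℝ G (u y)) (hu : DifferentiableWithinAt ℝ u (range (𝓡∂ 2)) y)
    (i : Fin 2) : pd (fun z => G (u z)) i y = fderiv ℝ G (u y) (pd u i y) :=
  pd_eq_of_hasFDerivWithinAt hy (hG.hasFDerivAt.comp_hasFDerivWithinAt y hu.hasFDerivWithinAt) i

theorem pd_clm_comp {B : Euc Q → Euc Q →L[ℝ] Euc Q} {u v : Plane → Euc Q} {y : Plane}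
    (hy : y ∈ range (𝓡∂ 2)) (hB : DifferentiableAt ℝ B (u y))
    (hu : DifferentiableWithinAt ℝ u (range (𝓡∂ 2)) y)
    (hv : DifferentiableWithinAt ℝ v (range (𝓡∂ 2)) y) (i : Fin 2) :
    pd (fun z => B (u z) (v z)) i y
      = fderiv ℝ B (u y) (pd u i y) (v y) + B (u y) (pd v i y) := by
  have h := (hB.hasFDerivAt.comp_hasFDerivWithinAt y hu.hasFDerivWithinAt).clm_apply
    hv.hasFDerivWithinAt
  refine (pd_eq_of_hasFDerivWithinAt hy h i).trans ?_
  simp [pd, add_comm]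

theorem pd_congr {f g : Plane → Euc Q} {T : Set Plane} {y : Plane}
    (hT : T ∈ 𝓝[range (𝓡∂ 2)] y) (hy : y ∈ T) (h : EqOn f g T) (i : Fin 2) :
    pd f i y = pd g i y := by
  rw [pd, pd, Filter.EventuallyEq.fderivWithin_eq (h.eventuallyEq_of_mem hT) (h hy)]

theorem contDiffOn_pd {u : Plane → Euc Q} {T : Set Plane} (hTr : T ⊆ range (𝓡∂ 2))
    (hT : ∀ y ∈ T, T ∈ 𝓝[range (𝓡∂ 2)] y) (hu : ContDiffOn ℝ ∞ u T) (i : Fin 2) :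
    ContDiffOn ℝ ∞ (pd u i) T := by
  intro y hy
  have h1 : ContDiffWithinAt ℝ ∞ u (range (𝓡∂ 2)) y :=
    (hu y hy).mono_of_mem_nhdsWithin (hT y hy)
  have h2 := h1.fderivWithin_right (𝓡∂ 2).uniqueDiffOn (m := ∞) (by simp) (hTr hy)
  exact (h2.clm_apply contDiffWithinAt_const).mono hTr

theorem ContDiffOn.differentiableWithinAt_range {u : Plane → Euc Q} {T : Set Plane}
    (hT : ∀ y ∈ T, T ∈ 𝓝[range (𝓡∂ 2)] y) (hu : ContDiffOn ℝ ∞ u T) {y : Plane} (hy : y ∈ T) :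
    DifferentiableWithinAt ℝ u (range (𝓡∂ 2)) y :=
  ((hu y hy).mono_of_mem_nhdsWithin (hT y hy)).differentiableWithinAt (by simp)

/-- The first partial derivatives at a point. -/
def frame (u : Plane → Euc Q) (y : Plane) : Fin 2 → Euc Q := fun i => pd u i y

/-- The second partial derivatives at a point. -/
def hess (u : Plane → Euc Q) (y : Plane) : Fin 2 → Fin 2 → Euc Q := fun i j => pd (pd u j) i y

theorem metric_eq_gram (u : Plane → Euc Q) (y : Plane) :
    metric u y = Matrix.gram ℝ (frame u y) := rfl

/-- The Christoffel correction is exactly the part of the Hessian tangent to the surface; hence the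
second covariant derivative sees only the remaining part. -/
theorem sum_christoffel_smul (u : Plane → Euc Q) (i j : Fin 2) (y : Plane) :
    ∑ k, christoffel u k i j y • frame u y k = frameProj (frame u y) (hess u y i j) := by
  simp only [christoffel, frameProj, Finset.sum_smul]
  rfl

theorem starProjection_inf_orthogonal {T A : Submodule ℝ (Euc Q)} (h : A ≤ T) (v : Euc Q) :
    (T ⊓ Aᗮ).starProjection v = T.starProjection v - A.starProjection v := by
  refine Submodule.eq_starProjection_of_mem_of_inner_eq_zero ⟨?_, ?_⟩ ?_
  · exact T.sub_mem (T.starProjection_apply_mem v) (h (A.starProjection_apply_mem v))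
  · refine (Submodule.mem_orthogonal _ _).2 fun w hw => ?_
    have h1 : ⟪w, v - T.starProjection v⟫ = 0 :=
      (Submodule.mem_orthogonal _ _).1 (T.sub_starProjection_mem_orthogonal v) w (h hw)
    have h2 : ⟪w, v - A.starProjection v⟫ = 0 :=
      (Submodule.mem_orthogonal _ _).1 (A.sub_starProjection_mem_orthogonal v) w hw
    rw [inner_sub_right] at *
    linarith
  · rintro w ⟨hwT, hwA⟩
    have h1 : ⟪w, v - T.starProjection v⟫ = 0 :=
      (Submodule.mem_orthogonal _ _).1 (T.sub_starProjection_mem_orthogonal v) w hwT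
    have h2 : ⟪A.starProjection v, w⟫ = 0 :=
      (Submodule.mem_orthogonal _ _).1 hwA _ (A.starProjection_apply_mem v)
    rw [real_inner_comm, sub_sub_eq_add_sub, add_sub_right_comm, inner_add_right, h1,
      real_inner_comm, h2, add_zero]

end PartialDerivatives

/-! ### Admissible maps in charts -/

section Charts

variable {S : Type*} [TopologicalSpace S] [ChartedSpace (EuclideanHalfSpace 2) S] {Q : ℕ}

theorem chartTarget_subset_range (c : S) : (extChartAt (𝓡∂ 2) c).target ⊆ range (𝓡∂ 2) :=
  extChartAt_target_subset_range c

theorem chartTarget_mem_nhdsWithin (c : S) :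
    ∀ y ∈ (extChartAt (𝓡∂ 2) c).target,
      (extChartAt (𝓡∂ 2) c).target ∈ 𝓝[range (𝓡∂ 2)] y := fun _ hy =>
  extChartAt_target_mem_nhdsWithin_of_mem hy

variable {M N : Set (Euc Q)} {Φ : S → Euc Q}

theorem IsAdmissible.inChart_mem (h : IsAdmissible M N Φ) (c : S) (y : Plane) :
    inChart Φ c y ∈ M := h.mem_ambient _

variable [IsManifold (𝓡∂ 2) ∞ S]

theorem contDiffOn_inChart (hΦ : ContMDiff (𝓡∂ 2) 𝓘(ℝ, Euc Q) ∞ Φ) (c : S) :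
    ContDiffOn ℝ ∞ (inChart Φ c) (extChartAt (𝓡∂ 2) c).target :=
  contMDiffOn_iff_contDiffOn.1 (hΦ.comp_contMDiffOn (contMDiffOn_extChartAt_symm c))

/-- The inverse chart has invertible differential, also at boundary points. This transfers
injectivity and range of the differential to the coordinate frame. -/
theorem pd_inChart_eq (hΦ : ContMDiff (𝓡∂ 2) 𝓘(ℝ, Euc Q) ∞ Φ) (c : S) {y : Plane}
    (hy : y ∈ (extChartAt (𝓡∂ 2) c).target) :
    ∃ B : Plane ≃L[ℝ] Plane, ∀ i, pd (inChart Φ c) i y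
      = differential Φ ((extChartAt (𝓡∂ 2) c).symm y) (B (EuclideanSpace.single i 1)) := by
  have : IsManifold (𝓡∂ 2) 1 S := IsManifold.of_le (n := ∞) (by simp)
  obtain ⟨B, hB⟩ := isInvertible_mfderivWithin_extChartAt_symm (I := 𝓡∂ 2) hy
  refine ⟨B, fun i => ?_⟩
  have h1 : HasMFDerivWithinAt 𝓘(ℝ, Plane) 𝓘(ℝ, Euc Q) (inChart Φ c) (range (𝓡∂ 2)) y
      ((mfderiv (𝓡∂ 2) 𝓘(ℝ, Euc Q) Φ ((extChartAt (𝓡∂ 2) c).symm y)).comp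
        (mfderivWithin 𝓘(ℝ, Plane) (𝓡∂ 2) (extChartAt (𝓡∂ 2) c).symm (range (𝓡∂ 2)) y)) :=
    HasMFDerivAt.comp_hasMFDerivWithinAt y
      ((hΦ.mdifferentiable (by simp)) _).hasMFDerivAt
      (mdifferentiableWithinAt_extChartAt_symm hy).hasMFDerivWithinAt
  rw [pd_eq_of_hasFDerivWithinAt (chartTarget_subset_range c hy)
    (hasMFDerivWithinAt_iff_hasFDerivWithinAt.1 h1), ← hB]
  rfl

theorem span_frame_inChart (hΦ : ContMDiff (𝓡∂ 2) 𝓘(ℝ, Euc Q) ∞ Φ) (c : S) {y : Plane}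
    (hy : y ∈ (extChartAt (𝓡∂ 2) c).target) :
    Submodule.span ℝ (range (frame (inChart Φ c) y))
      = (differential Φ ((extChartAt (𝓡∂ 2) c).symm y)).toLinearMap.range := by
  obtain ⟨B, hB⟩ := pd_inChart_eq hΦ c hy
  set D := differential Φ ((extChartAt (𝓡∂ 2) c).symm y)
  have h1 : range (frame (inChart Φ c) y)
      = D.toLinearMap '' (B.toLinearEquiv.toLinearMap ''
        range (fun i : Fin 2 => (EuclideanSpace.single i 1 : Plane))) := by
    rw [← range_comp, ← range_comp]
    exact congrArg range (funext hB)
  have h2 : Submodule.span ℝ (range (fun i : Fin 2 => (EuclideanSpace.single i 1 : Plane))) = ⊤ := by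
    have h3 : (fun i : Fin 2 => (EuclideanSpace.single i 1 : Plane))
        = EuclideanSpace.basisFun (Fin 2) ℝ := by ext1 i; simp
    rw [h3, ← OrthonormalBasis.coe_toBasis]
    exact Module.Basis.span_eq _
  rw [h1, Submodule.span_image, Submodule.span_image, h2, Submodule.map_top]
  rw [LinearEquiv.range, Submodule.map_top]

theorem IsAdmissible.linearIndependent_frame (h : IsAdmissible M N Φ) (c : S) {y : Plane}
    (hy : y ∈ (extChartAt (𝓡∂ 2) c).target) :
    LinearIndependent ℝ (frame (inChart Φ c) y) := by
  obtain ⟨B, hB⟩ := pd_inChart_eq h.smooth c hy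
  have h1 : frame (inChart Φ c) y = fun i =>
      ((differential Φ ((extChartAt (𝓡∂ 2) c).symm y)).toLinearMap ∘ₗ
        B.toLinearEquiv.toLinearMap) (EuclideanSpace.single i 1) := funext hB
  rw [h1]
  have h2 := (EuclideanSpace.basisFun (Fin 2) ℝ).toBasis.linearIndependent
  simp only [OrthonormalBasis.coe_toBasis] at h2
  have h3 : (fun i : Fin 2 => (EuclideanSpace.single i 1 : Plane))
      = EuclideanSpace.basisFun (Fin 2) ℝ := by ext1 i; simp
  refine LinearIndependent.map' (v := fun i : Fin 2 => (EuclideanSpace.single i 1 : Plane))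
    (by rw [h3]; exact h2) _ ?_
  rw [LinearMap.ker_eq_bot]
  exact (h.immersion _).comp B.injective

theorem IsAdmissible.det_gram_frame_ne_zero (h : IsAdmissible M N Φ) (c : S) {y : Plane}
    (hy : y ∈ (extChartAt (𝓡∂ 2) c).target) :
    (Matrix.gram ℝ (frame (inChart Φ c) y)).det ≠ 0 :=
  Matrix.det_gram_ne_zero_iff_linearIndependent.2 (h.linearIndependent_frame c hy)

variable [T2Space S] [CompactSpace S]

theorem IsAdmissible.frame_mem (h : IsAdmissible M N Φ) (c : S) {y : Plane}
    (hy : y ∈ (extChartAt (𝓡∂ 2) c).target) (i : Fin 2) :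
    frame (inChart Φ c) y i ∈ tangentSpaceAt M (inChart Φ c y) := by
  obtain ⟨B, hB⟩ := pd_inChart_eq h.smooth c hy
  rw [frame, hB]
  exact h.range_mfderiv_le _ ⟨_, rfl⟩

variable {g : Euc Q → Euc Q →L[ℝ] Euc Q}

theorem IsAdmissible.proj_frame (h : IsAdmissible M N Φ) (hgM : ∀ q ∈ M, g q = tangentProj M q)
    (c : S) {y : Plane} (hy : y ∈ (extChartAt (𝓡∂ 2) c).target) (i : Fin 2) :
    g (inChart Φ c y) (frame (inChart Φ c) y i) = frame (inChart Φ c) y i := by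
  rw [hgM _ (h.inChart_mem c y)]
  exact Submodule.starProjection_eq_self_iff.2 (h.frame_mem c hy i)

/-- The component of the Hessian normal to the ambient manifold is determined by the frame. -/
theorem IsAdmissible.hess_eq (h : IsAdmissible M N Φ) (hg : ContDiff ℝ ∞ g)
    (hgM : ∀ q ∈ M, g q = tangentProj M q)
    (c : S) {y : Plane} (hy : y ∈ (extChartAt (𝓡∂ 2) c).target) (i j : Fin 2) :
    hess (inChart Φ c) y i j = fderiv ℝ g (inChart Φ c y) (frame (inChart Φ c) y i)
      (frame (inChart Φ c) y j) + g (inChart Φ c y) (hess (inChart Φ c) y i j) := by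
  have hT := chartTarget_mem_nhdsWithin c
  have hTr := chartTarget_subset_range c
  have hu := contDiffOn_inChart h.smooth c
  have h1 := pd_clm_comp (B := g) (hTr hy) ((hg.differentiable (by simp)) _)
    (ContDiffOn.differentiableWithinAt_range hT hu hy)
    (ContDiffOn.differentiableWithinAt_range hT (contDiffOn_pd hTr hT hu j) hy) i
  -- The identity `g(u) ∂_j u = ∂_j u` is differentiated in direction `i`.
  have h2 := pd_congr (hT y hy) hy (f := fun z => g (inChart Φ c z) (pd (inChart Φ c) j z))
    (g := pd (inChart Φ c) j) (fun z hz => h.proj_frame hgM c hz j) i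
  rw [h1] at h2
  exact h2.symm

/-- The surface's tangent plane lies in that of `M`, so the projection onto its orthogonal
complement there is a difference of two projections. Both depend smoothly on the jet. -/
theorem IsAdmissible.secondFundForm_eq (h : IsAdmissible M N Φ)
    (hgM : ∀ q ∈ M, g q = tangentProj M q)
    (c : S) {y : Plane} (hy : y ∈ (extChartAt (𝓡∂ 2) c).target) (i j : Fin 2) :
    secondFundForm M (inChart Φ c) i j y = g (inChart Φ c y) (hess (inChart Φ c) y i j)
      - frameProj (frame (inChart Φ c) y) (hess (inChart Φ c) y i j) := by
  rw [secondFundForm, starProjection_inf_orthogonal, hgM _ (h.inChart_mem c y),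
    ← starProjection_span_eq_frameProj (h.det_gram_frame_ne_zero c hy)]
  · rfl
  · refine Submodule.span_le.2 ?_
    rintro _ ⟨k, rfl⟩
    exact h.frame_mem c hy k

end Charts

/-! ### Integrals over the surface as finite sums over compact sets -/

section SurfaceIntegrals

variable {S : Type*} [TopologicalSpace S] [T2Space S] [CompactSpace S]
  [ChartedSpace (EuclideanHalfSpace 2) S] [IsManifold (𝓡∂ 2) ∞ S]

theorem finite_active_charts : {c : S | (Function.support (chartPartition S c)).Nonempty}.Finite :=
  (chartPartition S).locallyFinite.finite_nonempty_of_compact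

variable (S) in
/-- The centers of the charts with a nonvanishing weight. -/
def activeCharts : Finset S := (finite_active_charts (S := S)).toFinset

theorem chartWeight_eq_zero_of_notMem {c : S} (hc : c ∉ activeCharts S) (y : Plane) :
    chartWeight c y = 0 := by
  by_contra h
  exact hc ((finite_active_charts (S := S)).mem_toFinset.2 ⟨_, h⟩)

/-- The support of the weight belonging to a chart, read in the chart. -/
def weightSupport (c : S) : Set Plane :=
  extChartAt (𝓡∂ 2) c '' tsupport (chartPartition S c)

theorem tsupport_subset_source (c : S) :
    tsupport (chartPartition S c) ⊆ (extChartAt (𝓡∂ 2) c).source := by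
  rw [extChartAt_source]
  exact chartPartition_isSubordinate S c

theorem isCompact_weightSupport (c : S) : IsCompact (weightSupport c) :=
  (isClosed_tsupport _).isCompact.image_of_continuousOn
    ((continuousOn_extChartAt c).mono (tsupport_subset_source c))

theorem weightSupport_subset (c : S) : weightSupport c ⊆ (extChartAt (𝓡∂ 2) c).target := by
  rintro _ ⟨x, hx, rfl⟩
  exact (extChartAt (𝓡∂ 2) c).map_source (tsupport_subset_source c hx)

theorem chartWeight_eq_zero {c : S} {y : Plane} (hy : y ∈ (extChartAt (𝓡∂ 2) c).target)
    (h : y ∉ weightSupport c) : chartWeight c y = 0 := by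
  by_contra h0
  refine h ⟨(extChartAt (𝓡∂ 2) c).symm y, subset_tsupport _ h0, ?_⟩
  exact (extChartAt (𝓡∂ 2) c).right_inv hy

theorem chartWeight_nonneg (c : S) (y : Plane) : 0 ≤ chartWeight c y :=
  (chartPartition S).nonneg c _

theorem continuousOn_chartWeight (c : S) :
    ContinuousOn (chartWeight c) (extChartAt (𝓡∂ 2) c).target :=
  (chartPartition S c).contMDiff.continuous.comp_continuousOn (continuousOn_extChartAt_symm c)

theorem measurableSet_chartTarget (c : S) : MeasurableSet (extChartAt (𝓡∂ 2) c).target := by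
  rw [extChartAt_target]
  exact (((chartAt (EuclideanHalfSpace 2) c).open_target.preimage
    (𝓡∂ 2).continuous_symm).measurableSet).inter (𝓡∂ 2).isClosed_range.measurableSet

/-- Chart targets are not compact, but the weights vanish off compact subsets and only finitely many
are nonzero; this is the form in which integrals can be differentiated and estimated. -/
theorem surfaceIntegral_eq_sum (D : S → Plane → ℝ) :
    surfaceIntegral D = ∑ c ∈ activeCharts S, ∫ y in weightSupport c, chartWeight c y * D c y := by
  rw [surfaceIntegral, finsum_eq_sum_of_support_subset (s := activeCharts S)]
  · refine Finset.sum_congr rfl fun c _ => ?_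
    refine setIntegral_eq_of_subset_of_forall_sdiff_eq_zero (measurableSet_chartTarget c)
      (weightSupport_subset c) fun y hy => ?_
    rw [chartWeight_eq_zero hy.1 hy.2, zero_mul]
  · intro c hc
    by_contra h
    refine hc ?_
    simp [chartWeight_eq_zero_of_notMem h]

/-- The part of the boundary line in the support of the weight belonging to a chart. -/
def boundaryWeightSupport (c : S) : Set ℝ := {s : ℝ | (!₂[0, s] : Plane) ∈ weightSupport c}

theorem continuous_boundaryLine : Continuous fun s : ℝ => (!₂[0, s] : Plane) := by
  refine (PiLp.continuous_toLp 2 _).comp (continuous_pi fun i => ?_)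
  fin_cases i
  · exact continuous_const
  · exact continuous_id

theorem isCompact_boundaryWeightSupport (c : S) : IsCompact (boundaryWeightSupport c) := by
  have h : Topology.IsClosedEmbedding fun s : ℝ => (!₂[0, s] : Plane) := by
    refine Isometry.isClosedEmbedding (Isometry.of_dist_eq fun s t => ?_)
    simp [EuclideanSpace.dist_eq, Real.sqrt_sq_eq_abs, Real.dist_eq]
  exact h.isCompact_preimage (isCompact_weightSupport c)

theorem boundaryIntegral_eq_sum (D : S → Plane → ℝ) :
    boundaryIntegral D = ∑ c ∈ activeCharts S,
      ∫ s in boundaryWeightSupport c, chartWeight c !₂[0, s] * D c !₂[0, s] := by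
  rw [boundaryIntegral, finsum_eq_sum_of_support_subset (s := activeCharts S)]
  · refine Finset.sum_congr rfl fun c _ => ?_
    refine setIntegral_eq_of_subset_of_forall_sdiff_eq_zero
      (continuous_boundaryLine.measurable (measurableSet_chartTarget c))
      (fun s hs => weightSupport_subset c hs) fun y hy => ?_
    rw [chartWeight_eq_zero hy.1 hy.2, zero_mul]
  · intro c hc
    by_contra h
    refine hc ?_
    simp [chartWeight_eq_zero_of_notMem h]

theorem surfaceIntegral_nonneg {D : S → Plane → ℝ} (h : ∀ c y, 0 ≤ D c y) :
    0 ≤ surfaceIntegral D := by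
  rw [surfaceIntegral_eq_sum]
  exact Finset.sum_nonneg fun c _ => integral_nonneg fun y =>
    mul_nonneg (chartWeight_nonneg c y) (h c y)

theorem boundaryIntegral_nonneg {D : S → Plane → ℝ} (h : ∀ c y, 0 ≤ D c y) :
    0 ≤ boundaryIntegral D := by
  rw [boundaryIntegral_eq_sum]
  exact Finset.sum_nonneg fun c _ => integral_nonneg fun y =>
    mul_nonneg (chartWeight_nonneg c _) (h c _)

theorem surfaceIntegral_congr {D D' : S → Plane → ℝ}
    (h : ∀ c, ∀ y ∈ (extChartAt (𝓡∂ 2) c).target, D c y = D' c y) :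
    surfaceIntegral D = surfaceIntegral D' := by
  rw [surfaceIntegral_eq_sum, surfaceIntegral_eq_sum]
  refine Finset.sum_congr rfl fun c _ => ?_
  refine setIntegral_congr_fun (isCompact_weightSupport c).measurableSet fun y hy => ?_
  simp only [h c y (weightSupport_subset c hy)]

theorem boundaryIntegral_congr {D D' : S → Plane → ℝ}
    (h : ∀ c, ∀ y ∈ (extChartAt (𝓡∂ 2) c).target, D c y = D' c y) :
    boundaryIntegral D = boundaryIntegral D' := by
  rw [boundaryIntegral_eq_sum, boundaryIntegral_eq_sum]
  refine Finset.sum_congr rfl fun c _ => ?_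
  refine setIntegral_congr_fun (isCompact_boundaryWeightSupport c).measurableSet fun y hy => ?_
  simp only [h c _ (weightSupport_subset c hy)]

theorem integrableOn_chartWeight_mul (c : S) {f : Plane → ℝ}
    (hf : ContinuousOn f (extChartAt (𝓡∂ 2) c).target) :
    IntegrableOn (fun y => chartWeight c y * f y) (weightSupport c) :=
  (((continuousOn_chartWeight c).mul hf).mono (weightSupport_subset c)).integrableOn_compact
    (isCompact_weightSupport c)

theorem integrableOn_boundary_chartWeight_mul (c : S) {f : Plane → ℝ}
    (hf : ContinuousOn f (extChartAt (𝓡∂ 2) c).target) :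
    IntegrableOn (fun s : ℝ => chartWeight c !₂[0, s] * f !₂[0, s]) (boundaryWeightSupport c) :=
  (((continuousOn_chartWeight c).mul hf).comp continuous_boundaryLine.continuousOn
    (fun _ hs => weightSupport_subset c hs)).integrableOn_compact
    (isCompact_boundaryWeightSupport c)

theorem abs_surfaceIntegral_le {D B : S → Plane → ℝ}
    (hB : ∀ c, ContinuousOn (B c) (extChartAt (𝓡∂ 2) c).target)
    (h : ∀ c, ∀ y ∈ (extChartAt (𝓡∂ 2) c).target, |D c y| ≤ B c y) :
    |surfaceIntegral D| ≤ surfaceIntegral B := by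
  rw [surfaceIntegral_eq_sum, surfaceIntegral_eq_sum]
  refine (Finset.abs_sum_le_sum_abs _ _).trans (Finset.sum_le_sum fun c _ => ?_)
  rw [← Real.norm_eq_abs]
  refine norm_integral_le_of_norm_le (integrableOn_chartWeight_mul c (hB c)) ?_
  refine (ae_restrict_iff' (isCompact_weightSupport c).measurableSet).2 (.of_forall fun y hy => ?_)
  rw [norm_mul, Real.norm_of_nonneg (chartWeight_nonneg c y)]
  exact mul_le_mul_of_nonneg_left (h c y (weightSupport_subset c hy)) (chartWeight_nonneg c y)

theorem abs_boundaryIntegral_le {D B : S → Plane → ℝ}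
    (hB : ∀ c, ContinuousOn (B c) (extChartAt (𝓡∂ 2) c).target)
    (h : ∀ c, ∀ y ∈ (extChartAt (𝓡∂ 2) c).target, |D c y| ≤ B c y) :
    |boundaryIntegral D| ≤ boundaryIntegral B := by
  rw [boundaryIntegral_eq_sum, boundaryIntegral_eq_sum]
  refine (Finset.abs_sum_le_sum_abs _ _).trans (Finset.sum_le_sum fun c _ => ?_)
  rw [← Real.norm_eq_abs]
  refine norm_integral_le_of_norm_le (integrableOn_boundary_chartWeight_mul c (hB c)) ?_
  refine (ae_restrict_iff' (isCompact_boundaryWeightSupport c).measurableSet).2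
    (.of_forall fun y hy => ?_)
  rw [norm_mul, Real.norm_of_nonneg (chartWeight_nonneg c _)]
  exact mul_le_mul_of_nonneg_left (h c _ (weightSupport_subset c hy)) (chartWeight_nonneg c _)

theorem surfaceIntegral_add {D D' : S → Plane → ℝ}
    (hD : ∀ c, ContinuousOn (D c) (extChartAt (𝓡∂ 2) c).target)
    (hD' : ∀ c, ContinuousOn (D' c) (extChartAt (𝓡∂ 2) c).target) :
    surfaceIntegral (fun c y => D c y + D' c y) = surfaceIntegral D + surfaceIntegral D' := by
  simp only [surfaceIntegral_eq_sum, ← Finset.sum_add_distrib]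
  refine Finset.sum_congr rfl fun c _ => ?_
  rw [← integral_add (integrableOn_chartWeight_mul c (hD c))
    (integrableOn_chartWeight_mul c (hD' c))]
  simp only [mul_add]

theorem surfaceIntegral_const_mul (r : ℝ) (D : S → Plane → ℝ) :
    surfaceIntegral (fun c y => r * D c y) = r * surfaceIntegral D := by
  simp only [surfaceIntegral_eq_sum, Finset.mul_sum]
  refine Finset.sum_congr rfl fun c _ => ?_
  rw [← integral_const_mul]
  simp only [mul_left_comm]

theorem boundaryIntegral_const_mul (r : ℝ) (D : S → Plane → ℝ) :
    boundaryIntegral (fun c y => r * D c y) = r * boundaryIntegral D := by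
  simp only [boundaryIntegral_eq_sum, Finset.mul_sum]
  refine Finset.sum_congr rfl fun c _ => ?_
  rw [← integral_const_mul]
  simp only [mul_left_comm]

variable {W : Type*} [NormedAddCommGroup W] [NormedSpace ℝ W]

/-- Here `j` is the jet of the initial map: composing with an isotopy moves the whole time
dependence into one function `Ψ`, the same in every chart. -/
theorem hasDerivAt_surfaceIntegral {D : ℝ → S → Plane → ℝ} {j : S → Plane → W} {ε : ℝ}
    (hε : 0 < ε) (hj : ∀ c, ContinuousOn (j c) (extChartAt (𝓡∂ 2) c).target)
    {Ψ : ℝ × W → ℝ} {O : Set (ℝ × W)} (hO : IsOpen O) (hΨ : ContDiffOn ℝ 1 Ψ O)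
    (h0 : ∀ c, ∀ y ∈ (extChartAt (𝓡∂ 2) c).target, ((0 : ℝ), j c y) ∈ O)
    (hD : ∀ t ∈ Ioo (-ε) ε, ∀ c, ∀ y ∈ (extChartAt (𝓡∂ 2) c).target, D t c y = Ψ (t, j c y)) :
    HasDerivAt (fun t => surfaceIntegral (D t))
      (surfaceIntegral fun c y => fderiv ℝ Ψ (0, j c y) (1, 0)) 0 := by
  have h1 : HasDerivAt (fun t => ∑ c ∈ activeCharts S,
      ∫ y in weightSupport c, chartWeight c y * Ψ (t, j c y))
      (surfaceIntegral fun c y => fderiv ℝ Ψ (0, j c y) (1, 0)) 0 := by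
    rw [surfaceIntegral_eq_sum]
    refine HasDerivAt.fun_sum fun c _ => ?_
    exact hasDerivAt_setIntegral_of_contDiffOn (isCompact_weightSupport c)
      (isCompact_weightSupport c).measurableSet
      ((continuousOn_chartWeight c).mono (weightSupport_subset c))
      ((hj c).mono (weightSupport_subset c)) hO hΨ fun y hy => h0 c y (weightSupport_subset c hy)
  refine h1.congr_of_eventuallyEq ?_
  filter_upwards [Ioo_mem_nhds (neg_lt_zero.2 hε) hε] with t ht
  rw [surfaceIntegral_congr (hD t ht), surfaceIntegral_eq_sum]

theorem hasDerivAt_boundaryIntegral {D : ℝ → S → Plane → ℝ} {j : S → Plane → W} {ε : ℝ}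
    (hε : 0 < ε) (hj : ∀ c, ContinuousOn (j c) (extChartAt (𝓡∂ 2) c).target)
    {Ψ : ℝ × W → ℝ} {O : Set (ℝ × W)} (hO : IsOpen O) (hΨ : ContDiffOn ℝ 1 Ψ O)
    (h0 : ∀ c, ∀ y ∈ (extChartAt (𝓡∂ 2) c).target, ((0 : ℝ), j c y) ∈ O)
    (hD : ∀ t ∈ Ioo (-ε) ε, ∀ c, ∀ y ∈ (extChartAt (𝓡∂ 2) c).target, D t c y = Ψ (t, j c y)) :
    HasDerivAt (fun t => boundaryIntegral (D t))
      (boundaryIntegral fun c y => fderiv ℝ Ψ (0, j c y) (1, 0)) 0 := by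
  have h1 : HasDerivAt (fun t => ∑ c ∈ activeCharts S,
      ∫ s in boundaryWeightSupport c, chartWeight c !₂[0, s] * Ψ (t, j c !₂[0, s]))
      (boundaryIntegral fun c y => fderiv ℝ Ψ (0, j c y) (1, 0)) 0 := by
    rw [boundaryIntegral_eq_sum]
    refine HasDerivAt.fun_sum fun c _ => ?_
    exact hasDerivAt_setIntegral_of_contDiffOn (j := fun s => j c !₂[0, s])
      (isCompact_boundaryWeightSupport c) (isCompact_boundaryWeightSupport c).measurableSet
      ((continuousOn_chartWeight c).comp continuous_boundaryLine.continuousOn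
        (fun _ hs => weightSupport_subset c hs))
      ((hj c).comp continuous_boundaryLine.continuousOn
        (fun _ hs => weightSupport_subset c hs)) hO hΨ
      fun y hy => h0 c _ (weightSupport_subset c hy)
  refine h1.congr_of_eventuallyEq ?_
  filter_upwards [Ioo_mem_nhds (neg_lt_zero.2 hε) hε] with t ht
  rw [boundaryIntegral_congr (hD t ht), boundaryIntegral_eq_sum]

end SurfaceIntegrals

/-! ### The induced varifold -/

section InducedVarifold

variable {S : Type*} [TopologicalSpace S] [T2Space S] [CompactSpace S]
  [ChartedSpace (EuclideanHalfSpace 2) S] [IsManifold (𝓡∂ 2) ∞ S] {Q : ℕ}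
  {M N : Set (Euc Q)} {Φ : S → Euc Q}

theorem areaDensity_eq (u : Plane → Euc Q) (y : Plane) :
    areaDensity u y = √ (Matrix.gram ℝ (frame u y)).det := rfl

theorem areaDensity_nonneg (u : Plane → Euc Q) (y : Plane) : 0 ≤ areaDensity u y :=
  Real.sqrt_nonneg _

theorem IsAdmissible.contDiffOn_frame (h : IsAdmissible M N Φ) (c : S) (i : Fin 2) :
    ContDiffOn ℝ ∞ (fun y => frame (inChart Φ c) y i) (extChartAt (𝓡∂ 2) c).target :=
  contDiffOn_pd (chartTarget_subset_range c) (chartTarget_mem_nhdsWithin c)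
    (contDiffOn_inChart h.smooth c) i

theorem IsAdmissible.contDiffOn_hess (h : IsAdmissible M N Φ) (c : S) (i j : Fin 2) :
    ContDiffOn ℝ ∞ (fun y => hess (inChart Φ c) y i j) (extChartAt (𝓡∂ 2) c).target :=
  contDiffOn_pd (chartTarget_subset_range c) (chartTarget_mem_nhdsWithin c)
    (h.contDiffOn_frame c j) i

theorem IsAdmissible.continuousOn_areaDensity (h : IsAdmissible M N Φ) (c : S) :
    ContinuousOn (areaDensity (inChart Φ c)) (extChartAt (𝓡∂ 2) c).target :=
  (contDiffOn_matrix_det (contDiffOn_gram (h.contDiffOn_frame c))).continuousOn.sqrt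

/-- Near each point the plane is spanned by a smooth coordinate frame, whose projection is given by
`frameProj`. -/
theorem IsAdmissible.continuous_tangentPlane (h : IsAdmissible M N Φ) :
    Continuous h.tangentPlane := by
  rw [GrBundle.isEmbedding_toProd.continuous_iff]
  refine h.smooth.continuous.prodMk (continuous_iff_continuousAt.2 fun x => ?_)
  have h1 : ContinuousOn (fun y => (Submodule.span ℝ (range (frame (inChart Φ x) y))).starProjection)
      (extChartAt (𝓡∂ 2) x).target := by
    refine ContDiffOn.continuousOn (𝕜 := ℝ) (n := ∞) (contDiffOn_clm_apply.2 fun v => ?_)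
    exact (contDiffOn_frameProj (h.contDiffOn_frame x)
      (fun y hy => h.det_gram_frame_ne_zero x hy) contDiffOn_const).congr fun y hy =>
      starProjection_span_eq_frameProj (h.det_gram_frame_ne_zero x hy) v
  have h2 := (h1.comp (continuousOn_extChartAt x) (extChartAt (𝓡∂ 2) x).mapsTo).continuousAt
    (extChartAt_source_mem_nhds x)
  refine h2.congr ?_
  filter_upwards [extChartAt_source_mem_nhds (I := 𝓡∂ 2) x] with z hz
  refine starProjection_congr ?_
  rw [span_frame_inChart h.smooth x ((extChartAt (𝓡∂ 2) x).map_source hz),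
    (extChartAt (𝓡∂ 2) x).left_inv hz]
  rfl

variable [MeasurableSpace S] [BorelSpace S]

/-- The contribution of one chart to the area measure. -/
def chartAreaMeasure (Φ : S → Euc Q) (c : S) : Measure S :=
  ((volume.restrict (extChartAt (𝓡∂ 2) c).target).withDensity fun y =>
    ENNReal.ofReal (chartWeight c y * areaDensity (inChart Φ c) y)).map
    (extChartAt (𝓡∂ 2) c).symm

theorem areaMeasure_eq_sum (Φ : S → Euc Q) :
    areaMeasure Φ = ∑ c ∈ activeCharts S, chartAreaMeasure Φ c := by
  refine Measure.ext fun A hA => ?_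
  rw [areaMeasure, Measure.sum_apply _ hA, Measure.finsetSum_apply, tsum_eq_sum]
  · rfl
  · intro c hc
    simp [chartWeight_eq_zero_of_notMem hc]

theorem IsAdmissible.integrableOn_weighted_areaDensity (h : IsAdmissible M N Φ) (c : S) :
    IntegrableOn (fun y => chartWeight c y * areaDensity (inChart Φ c) y)
      (extChartAt (𝓡∂ 2) c).target := by
  refine (integrableOn_chartWeight_mul c (h.continuousOn_areaDensity c)).of_forall_sdiff_eq_zero
    (measurableSet_chartTarget c) fun y hy => ?_
  rw [chartWeight_eq_zero hy.1 hy.2, zero_mul]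

theorem IsAdmissible.isFiniteMeasure_chartAreaMeasure (h : IsAdmissible M N Φ) (c : S) :
    IsFiniteMeasure (chartAreaMeasure Φ c) := by
  have := isFiniteMeasure_withDensity_ofReal (h.integrableOn_weighted_areaDensity c).2
  unfold chartAreaMeasure
  infer_instance

theorem IsAdmissible.isFiniteMeasure_inducedVarifold (h : IsAdmissible M N Φ) :
    IsFiniteMeasure h.inducedVarifold := by
  have := h.isFiniteMeasure_chartAreaMeasure
  have h1 : IsFiniteMeasure (areaMeasure Φ) := by
    rw [areaMeasure_eq_sum]
    infer_instance
  unfold IsAdmissible.inducedVarifold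
  infer_instance

theorem IsAdmissible.integral_chartAreaMeasure (h : IsAdmissible M N Φ) (c : S) {f : S → ℝ}
    (hf : Continuous f) : ∫ x, f x ∂chartAreaMeasure Φ c
      = ∫ y in weightSupport c,
        chartWeight c y * (areaDensity (inChart Φ c) y * f ((extChartAt (𝓡∂ 2) c).symm y)) := by
  have hm : AEMeasurable (extChartAt (𝓡∂ 2) c).symm
      (volume.restrict (extChartAt (𝓡∂ 2) c).target) :=
    (continuousOn_extChartAt_symm c).aemeasurable (measurableSet_chartTarget c)
  rw [chartAreaMeasure, integral_map (hm.mono_ac (withDensity_absolutelyContinuous _ _))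
    hf.aestronglyMeasurable, integral_withDensity_eq_integral_toReal_smul₀]
  · simp only [smul_eq_mul]
    rw [← setIntegral_eq_of_subset_of_forall_sdiff_eq_zero (measurableSet_chartTarget c)
      (weightSupport_subset c) fun y hy => ?_]
    · refine integral_congr_ae (.of_forall fun y => ?_)
      dsimp only
      rw [ENNReal.toReal_ofReal (mul_nonneg (chartWeight_nonneg c y) (areaDensity_nonneg _ y)),
        mul_assoc]
    · rw [chartWeight_eq_zero hy.1 hy.2, zero_mul]
  · exact (h.integrableOn_weighted_areaDensity c).aestronglyMeasurable.aemeasurable.ennreal_ofReal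
  · exact .of_forall fun _ => ENNReal.ofReal_lt_top

theorem IsAdmissible.integral_inducedVarifold (h : IsAdmissible M N Φ) (f : C(GrBundle M, ℝ)) :
    ∫ q, f q ∂h.inducedVarifold = surfaceIntegral fun c y =>
      areaDensity (inChart Φ c) y * f (h.tangentPlane ((extChartAt (𝓡∂ 2) c).symm y)) := by
  have := h.isFiniteMeasure_chartAreaMeasure
  have hc := h.continuous_tangentPlane
  rw [inducedVarifold, integral_map hc.aemeasurable
    f.continuous.aestronglyMeasurable, areaMeasure_eq_sum, integral_finsetSum_measure,
    surfaceIntegral_eq_sum]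
  · exact Finset.sum_congr rfl fun c _ =>
      h.integral_chartAreaMeasure c (f.continuous.comp hc)
  · intro c _
    exact (f.continuous.comp hc).integrable_of_hasCompactSupport (HasCompactSupport.of_compactSpace _)

theorem IsAdmissible.inducedVarifold_univ (h : IsAdmissible M N Φ) :
    h.inducedVarifold univ = ENNReal.ofReal (area Φ) := by
  have := h.isFiniteMeasure_inducedVarifold
  have h1 := h.integral_inducedVarifold 1
  simp only [ContinuousMap.one_apply, integral_const, smul_eq_mul, mul_one] at h1
  rw [area, ← h1, ofReal_measureReal]

end InducedVarifold

/-! ### Smooth families of maps -/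

section Slices

variable {Q : ℕ} {Y : Type*} [NormedAddCommGroup Y] [NormedSpace ℝ Y] {ε : ℝ} {U : Set (Euc Q)}
  {G : ℝ → Euc Q → Y}

theorem contDiffOn_slice (hG : ContDiffOn ℝ ∞ (fun q : ℝ × Euc Q => G q.1 q.2) (Ioo (-ε) ε ×ˢ U))
    {t : ℝ} (ht : t ∈ Ioo (-ε) ε) : ContDiffOn ℝ ∞ (G t) U :=
  hG.comp (contDiffOn_const.prodMk contDiffOn_id) fun _ hp => ⟨ht, hp⟩

/-- The spatial derivative is the full space-time derivative restricted to spatial directions. -/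
theorem contDiffOn_fderiv_slice (hU : IsOpen U)
    (hG : ContDiffOn ℝ ∞ (fun q : ℝ × Euc Q => G q.1 q.2) (Ioo (-ε) ε ×ˢ U)) :
    ContDiffOn ℝ ∞ (fun q : ℝ × Euc Q => fderiv ℝ (G q.1) q.2) (Ioo (-ε) ε ×ˢ U) := by
  have hO : IsOpen (Ioo (-ε) ε ×ˢ U) := isOpen_Ioo.prod hU
  have h1 : ContDiffOn ℝ ∞ (fun q : ℝ × Euc Q =>
      (fderiv ℝ (fun q : ℝ × Euc Q => G q.1 q.2) q).comp (ContinuousLinearMap.inr ℝ ℝ (Euc Q)))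
      (Ioo (-ε) ε ×ˢ U) :=
    (hG.fderiv_of_isOpen hO (by simp)).clm_comp contDiffOn_const
  refine h1.congr ?_
  rintro ⟨t, p⟩ hq
  have h2 : HasFDerivAt (fun q : ℝ × Euc Q => G q.1 q.2) _ (t, p) :=
    ((hG.contDiffAt (hO.mem_nhds hq)).differentiableAt (by simp)).hasFDerivAt
  exact (h2.comp p (hasFDerivAt_prodMk_right t p)).fderiv

theorem contDiffOn_velocity (hε : 0 < ε) (hU : IsOpen U)
    (hG : ContDiffOn ℝ ∞ (fun q : ℝ × Euc Q => G q.1 q.2) (Ioo (-ε) ε ×ˢ U)) :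
    ContDiffOn ℝ ∞ (fun p => deriv (fun t => G t p) 0) U := by
  have hO : IsOpen (Ioo (-ε) ε ×ˢ U) := isOpen_Ioo.prod hU
  have h0 : (0 : ℝ) ∈ Ioo (-ε) ε := ⟨neg_lt_zero.2 hε, hε⟩
  have h1 : ContDiffOn ℝ ∞ (fun p : Euc Q =>
      fderiv ℝ (fun q : ℝ × Euc Q => G q.1 q.2) (0, p) (1, 0)) U :=
    ((hG.fderiv_of_isOpen hO (by simp)).comp (contDiffOn_const.prodMk contDiffOn_id)
      fun _ hp => ⟨h0, hp⟩).clm_apply contDiffOn_const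
  refine h1.congr fun p hp => ?_
  have h2 : HasFDerivAt (fun q : ℝ × Euc Q => G q.1 q.2) _ (0, p) :=
    ((hG.contDiffAt (hO.mem_nhds ⟨h0, hp⟩)).differentiableAt (by simp)).hasFDerivAt
  have h3 : HasDerivAt (fun t : ℝ => (t, p)) ((1 : ℝ), (0 : Euc Q)) 0 :=
    (hasDerivAt_id _).prodMk (hasDerivAt_const _ p)
  exact (h2.comp_hasDerivAt (0 : ℝ) h3).deriv

variable {W : Type*} [NormedAddCommGroup W] [NormedSpace ℝ W]

/-- The derivative with respect to the first variable at `0`. -/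
def timeDeriv (Ψ : ℝ × W → ℝ) (w : W) : ℝ := fderiv ℝ Ψ (0, w) (1, 0)

theorem hasDerivAt_timeDeriv {Ψ : ℝ × W → ℝ} {O : Set (ℝ × W)} (hO : IsOpen O)
    (hΨ : ContDiffOn ℝ 1 Ψ O) {w : W} (hw : ((0 : ℝ), w) ∈ O) :
    HasDerivAt (fun t => Ψ (t, w)) (timeDeriv Ψ w) 0 := by
  have h2 : HasFDerivAt Ψ _ (0, w) :=
    ((hΨ.contDiffAt (hO.mem_nhds hw)).differentiableAt (by simp)).hasFDerivAt
  have h3 : HasDerivAt (fun t : ℝ => (t, w)) ((1 : ℝ), (0 : W)) 0 :=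
    (hasDerivAt_id _).prodMk (hasDerivAt_const _ w)
  exact h2.comp_hasDerivAt (0 : ℝ) h3

theorem continuousOn_timeDeriv {Ψ : ℝ × W → ℝ} {O : Set (ℝ × W)} (hO : IsOpen O)
    (hΨ : ContDiffOn ℝ 1 Ψ O) {K : Set W} (hK : ∀ w ∈ K, ((0 : ℝ), w) ∈ O) :
    ContinuousOn (timeDeriv Ψ) K :=
  ((hΨ.continuousOn_fderiv_of_isOpen hO le_rfl).comp
    (continuousOn_const.prodMk continuousOn_id) hK).clm_apply continuousOn_const

/-- Homogeneity and frame invariance of a density hold at each small time with a factor independent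
of time, and so pass to the derivative by its uniqueness. -/
theorem timeDeriv_eq_mul {Ψ : ℝ × W → ℝ} {O : Set (ℝ × W)} (hO : IsOpen O)
    (hΨ : ContDiffOn ℝ 1 Ψ O) {w w' : W} (hw : ((0 : ℝ), w) ∈ O) (hw' : ((0 : ℝ), w') ∈ O)
    {r : ℝ} (h : ∀ᶠ t in 𝓝 (0 : ℝ), Ψ (t, w) = r * Ψ (t, w')) :
    timeDeriv Ψ w = r * timeDeriv Ψ w' :=
  ((hasDerivAt_timeDeriv hO hΨ hw).unique
    (((hasDerivAt_timeDeriv hO hΨ hw').const_mul r).congr_of_eventuallyEq h))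

end Slices

/-! ### Variations induced by isotopies -/

section Isotopies

variable {Q : ℕ} {M N : Set (Euc Q)} {ε : ℝ} {F : ℝ → Euc Q → Euc Q} {U : Set (Euc Q)}

theorem IsFreeBoundaryIsotopy.zero_mem (hF : IsFreeBoundaryIsotopy M N ε F) :
    (0 : ℝ) ∈ Ioo (-ε) ε := ⟨neg_lt_zero.2 hF.pos, hF.pos⟩

theorem differentiableAt_slice (hU : IsOpen U)
    (hs : ContDiffOn ℝ ∞ (fun q : ℝ × Euc Q => F q.1 q.2) (Ioo (-ε) ε ×ˢ U))
    {t : ℝ} (ht : t ∈ Ioo (-ε) ε) {p : Euc Q} (hp : p ∈ U) : DifferentiableAt ℝ (F t) p :=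
  ((contDiffOn_slice hs ht).contDiffAt (hU.mem_nhds hp)).differentiableAt (by simp)

/-- `F 0` is the identity only on `M`, so its ambient derivative is determined only on tangent
vectors: two derivatives within `M` agree on the tangent cone. -/
theorem IsFreeBoundaryIsotopy.fderiv_zero (hF : IsFreeBoundaryIsotopy M N ε F) (hU : IsOpen U)
    (hMU : M ⊆ U) (hs : ContDiffOn ℝ ∞ (fun q : ℝ × Euc Q => F q.1 q.2) (Ioo (-ε) ε ×ˢ U))
    {p : Euc Q} (hp : p ∈ M) {v : Euc Q} (hv : v ∈ tangentSpaceAt M p) :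
    fderiv ℝ (F 0) p v = v := by
  have h1 : HasFDerivWithinAt (F 0) (fderiv ℝ (F 0) p) M p :=
    (differentiableAt_slice hU hs hF.zero_mem (hMU hp)).hasFDerivAt.hasFDerivWithinAt
  have h2 : HasFDerivWithinAt (F 0) (ContinuousLinearMap.id ℝ (Euc Q)) M p :=
    (hasFDerivWithinAt_id p M).congr (fun x hx => hF.start x hx) (hF.start p hp)
  have h3 := h1.unique_on h2
  induction hv using Submodule.span_induction with
  | mem x hx => exact h3 hx
  | zero => simp
  | add x y _ _ hx hy => rw [map_add, hx, hy]
  | smul c x _ hx => rw [map_smul, hx]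

theorem IsFreeBoundaryIsotopy.fderiv_mem (hF : IsFreeBoundaryIsotopy M N ε F) (hU : IsOpen U)
    (hMU : M ⊆ U) (hs : ContDiffOn ℝ ∞ (fun q : ℝ × Euc Q => F q.1 q.2) (Ioo (-ε) ε ×ˢ U))
    {t : ℝ} (ht : t ∈ Ioo (-ε) ε) {p : Euc Q} (hp : p ∈ M) {v : Euc Q}
    (hv : v ∈ tangentSpaceAt M p) : fderiv ℝ (F t) p v ∈ tangentSpaceAt M (F t p) := by
  have h1 : HasFDerivWithinAt (F t) (fderiv ℝ (F t) p) M p :=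
    (differentiableAt_slice hU hs ht (hMU hp)).hasFDerivAt.hasFDerivWithinAt
  refine (Submodule.span_le (p := (tangentSpaceAt M (F t p)).comap
    (fderiv ℝ (F t) p).toLinearMap)).2 (fun x hx => ?_) hv
  refine Submodule.subset_span (tangentConeAt_mono ?_ (h1.mapsTo_tangent_cone hx))
  rintro _ ⟨x, hx, rfl⟩
  exact (hF.bijOn t ht).mapsTo hx

variable {S : Type*} [TopologicalSpace S] [T2Space S] [CompactSpace S]
  [ChartedSpace (EuclideanHalfSpace 2) S] [IsManifold (𝓡∂ 2) ∞ S] {Φ : S → Euc Q}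

/-- The smooth left inverse of `F t` on `M` recovers `Φ`, so the chain rule forces the composition
to be an immersion. The boundary condition survives because `F t` maps `N` into `N`. -/
theorem IsFreeBoundaryIsotopy.isAdmissible_comp (hF : IsFreeBoundaryIsotopy M N ε F)
    (hΦ : IsAdmissible M N Φ) {t : ℝ} (ht : t ∈ Ioo (-ε) ε) :
    IsAdmissible M N (fun x => F t (Φ x)) := by
  obtain ⟨U, hU, hMU, hs⟩ := hF.smooth
  have hsm : ContMDiff (𝓡∂ 2) 𝓘(ℝ, Euc Q) ∞ (fun x => F t (Φ x)) :=
    (contDiffOn_slice hs ht).contMDiffOn.comp_contMDiff hΦ.smooth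
      fun x => hMU (hΦ.mem_ambient x)
  have hmem : ∀ x, F t (Φ x) ∈ M := fun x => (hF.bijOn t ht).mapsTo (hΦ.mem_ambient x)
  refine ⟨hsm, fun x => ?_, hmem, fun x hx => ?_⟩
  · obtain ⟨G, U', hU', hMU', hG, hGF⟩ := hF.smooth_inverse t ht
    have h1 : G ∘ (fun x => F t (Φ x)) = Φ := funext fun x => hGF _ (hΦ.mem_ambient x)
    have h2 : MDifferentiableAt 𝓘(ℝ, Euc Q) 𝓘(ℝ, Euc Q) G (F t (Φ x)) :=
      ((hG.contDiffAt (hU'.mem_nhds (hMU' (hmem x)))).differentiableAt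
        (by simp)).mdifferentiableAt
    have h3 := mfderiv_comp x h2 ((hsm.mdifferentiable (by simp)) x)
    rw [h1] at h3
    have h4 := hΦ.immersion x
    rw [differential, h3] at h4
    exact Function.Injective.of_comp h4
  · rw [← hF.image_constraint t ht]
    exact ⟨Φ x, hΦ.mem_constraint x hx, rfl⟩

theorem IsFreeBoundaryIsotopy.isVariation (hF : IsFreeBoundaryIsotopy M N ε F)
    (hΦ : IsAdmissible M N Φ) : IsVariation M N Φ ε (fun t x => F t (Φ x)) where
  pos := hF.pos
  start := funext fun x => hF.start _ (hΦ.mem_ambient x)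
  smooth := by
    obtain ⟨U, hU, hMU, hs⟩ := hF.smooth
    have h1 : ContMDiff (𝓘(ℝ, ℝ).prod (𝓡∂ 2)) 𝓘(ℝ, ℝ × Euc Q) ∞
        (fun q : ℝ × S => (q.1, Φ q.2)) :=
      contMDiff_fst.prodMk_space (hΦ.smooth.comp contMDiff_snd)
    exact hs.contMDiffOn.comp h1.contMDiffOn fun q hq => ⟨hq.1, hMU (hΦ.mem_ambient _)⟩
  admissible := fun _ ht => hF.isAdmissible_comp hΦ ht

theorem frame_isotopy_comp (hΦ : IsAdmissible M N Φ) (hU : IsOpen U) (hMU : M ⊆ U)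
    (hs : ContDiffOn ℝ ∞ (fun q : ℝ × Euc Q => F q.1 q.2) (Ioo (-ε) ε ×ˢ U))
    {t : ℝ} (ht : t ∈ Ioo (-ε) ε) (c : S) {y : Plane} (hy : y ∈ (extChartAt (𝓡∂ 2) c).target) :
    frame (inChart (fun x => F t (Φ x)) c) y
      = fun i => fderiv ℝ (F t) (inChart Φ c y) (frame (inChart Φ c) y i) := by
  ext1 i
  exact pd_comp (chartTarget_subset_range c hy)
    (differentiableAt_slice hU hs ht (hMU (hΦ.inChart_mem c y)))
    (ContDiffOn.differentiableWithinAt_range (chartTarget_mem_nhdsWithin c)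
      (contDiffOn_inChart hΦ.smooth c) hy) i

theorem hess_isotopy_comp (hΦ : IsAdmissible M N Φ) (hU : IsOpen U) (hMU : M ⊆ U)
    (hs : ContDiffOn ℝ ∞ (fun q : ℝ × Euc Q => F q.1 q.2) (Ioo (-ε) ε ×ˢ U))
    {t : ℝ} (ht : t ∈ Ioo (-ε) ε) (c : S) {y : Plane} (hy : y ∈ (extChartAt (𝓡∂ 2) c).target)
    (i j : Fin 2) :
    hess (inChart (fun x => F t (Φ x)) c) y i j
      = fderiv ℝ (fderiv ℝ (F t)) (inChart Φ c y) (frame (inChart Φ c) y i)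
          (frame (inChart Φ c) y j)
        + fderiv ℝ (F t) (inChart Φ c y) (hess (inChart Φ c) y i j) := by
  have hT := chartTarget_mem_nhdsWithin c
  have hTr := chartTarget_subset_range c
  have hu := contDiffOn_inChart hΦ.smooth c
  have h1 : DifferentiableAt ℝ (fderiv ℝ (F t)) (inChart Φ c y) :=
    (((contDiffOn_slice hs ht).fderiv_of_isOpen hU (m := ∞) (by simp)).contDiffAt
      (hU.mem_nhds (hMU (hΦ.inChart_mem c y)))).differentiableAt (by simp)
  rw [hess, pd_congr (hT y hy) hy (f := pd (inChart (fun x => F t (Φ x)) c) j) (g := fun z => fderiv ℝ (F t) (inChart Φ c z)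
    (pd (inChart Φ c) j z)) (fun z hz => congrFun (frame_isotopy_comp hΦ hU hMU hs ht c hz) j) i]
  exact pd_clm_comp (hTr hy) h1 (ContDiffOn.differentiableWithinAt_range hT hu hy)
    (ContDiffOn.differentiableWithinAt_range hT (contDiffOn_pd hTr hT hu j) hy) i

end Isotopies

/-! ### First variation of the area -/

section AreaVariation

variable {Q : ℕ} {M N : Set (Euc Q)} {ε : ℝ} {F : ℝ → Euc Q → Euc Q} {U : Set (Euc Q)}

/-- The Jacobian of the differential of `F_t` at a point on the range of a projection. -/
def areaJet (F : ℝ → Euc Q → Euc Q) (x : ℝ × (Euc Q × (Euc Q →L[ℝ] Euc Q))) : ℝ :=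
  √ (jacobianSq (fderiv ℝ (F x.1) x.2.1) x.2.2)

/-- The domain on which `areaJet` is smooth. -/
def areaJetDomain (F : ℝ → Euc Q → Euc Q) (ε : ℝ) (U : Set (Euc Q)) :
    Set (ℝ × (Euc Q × (Euc Q →L[ℝ] Euc Q))) :=
  {x | x.1 ∈ Ioo (-ε) ε ∧ x.2.1 ∈ U} ∩ {x | jacobianSq (fderiv ℝ (F x.1) x.2.1) x.2.2 ≠ 0}

theorem contDiffOn_jacobianSq_isotopy (hU : IsOpen U)
    (hs : ContDiffOn ℝ ∞ (fun q : ℝ × Euc Q => F q.1 q.2) (Ioo (-ε) ε ×ˢ U)) :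
    ContDiffOn ℝ 1 (fun x : ℝ × (Euc Q × (Euc Q →L[ℝ] Euc Q)) =>
      jacobianSq (fderiv ℝ (F x.1) x.2.1) x.2.2) {x | x.1 ∈ Ioo (-ε) ε ∧ x.2.1 ∈ U} := by
  have h1 : ContDiffOn ℝ 1 (fun x : ℝ × (Euc Q × (Euc Q →L[ℝ] Euc Q)) =>
      fderiv ℝ (F x.1) x.2.1) {x | x.1 ∈ Ioo (-ε) ε ∧ x.2.1 ∈ U} :=
    ((contDiffOn_fderiv_slice hU hs).of_le (by simp)).comp
      (g := fun q : ℝ × Euc Q => fderiv ℝ (F q.1) q.2)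
      (f := fun x : ℝ × (Euc Q × (Euc Q →L[ℝ] Euc Q)) => (x.1, x.2.1))
      (contDiff_fst.prodMk (contDiff_fst.comp contDiff_snd)).contDiffOn fun x hx => ⟨hx.1, hx.2⟩
  have h2 : ContDiffOn ℝ 1 (fun x : ℝ × (Euc Q × (Euc Q →L[ℝ] Euc Q)) => x.2.2)
      {x | x.1 ∈ Ioo (-ε) ε ∧ x.2.1 ∈ U} := (contDiff_snd.comp contDiff_snd).contDiffOn
  exact contDiffOn_jacobianSq h1 h2

theorem isOpen_areaJetDomain (hU : IsOpen U)
    (hs : ContDiffOn ℝ ∞ (fun q : ℝ × Euc Q => F q.1 q.2) (Ioo (-ε) ε ×ˢ U)) :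
    IsOpen (areaJetDomain F ε U) := by
  have hO : IsOpen {x : ℝ × (Euc Q × (Euc Q →L[ℝ] Euc Q)) | x.1 ∈ Ioo (-ε) ε ∧ x.2.1 ∈ U} :=
    (isOpen_Ioo.preimage continuous_fst).inter
      (hU.preimage (continuous_fst.comp continuous_snd))
  exact (contDiffOn_jacobianSq_isotopy hU hs).continuousOn.isOpen_inter_preimage hO
    isOpen_compl_singleton

theorem contDiffOn_areaJet (hU : IsOpen U)
    (hs : ContDiffOn ℝ ∞ (fun q : ℝ × Euc Q => F q.1 q.2) (Ioo (-ε) ε ×ˢ U)) :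
    ContDiffOn ℝ 1 (areaJet F) (areaJetDomain F ε U) :=
  ((contDiffOn_jacobianSq_isotopy hU hs).mono inter_subset_left).sqrt fun _ hx => hx.2

theorem planeJacobian_nonneg (L : Euc Q →L[ℝ] Euc Q) (P : Submodule ℝ (Euc Q)) :
    0 ≤ planeJacobian L P := Real.sqrt_nonneg _

theorem areaJet_toProd (t : ℝ) (q : GrBundle M) :
    areaJet F (t, q.toProd) = planeJacobian (fderiv ℝ (F t) q.pt) q.plane :=
  (planeJacobian_eq_sqrt_jacobianSq _ q.finrank_eq).symm

/-- At time zero the Jacobian on a tangent plane is one, so the square root is evaluated away from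
its singularity. -/
theorem IsFreeBoundaryIsotopy.mem_areaJetDomain (hF : IsFreeBoundaryIsotopy M N ε F)
    (hU : IsOpen U) (hMU : M ⊆ U)
    (hs : ContDiffOn ℝ ∞ (fun q : ℝ × Euc Q => F q.1 q.2) (Ioo (-ε) ε ×ˢ U)) (q : GrBundle M) :
    ((0 : ℝ), q.toProd) ∈ areaJetDomain F ε U := by
  refine ⟨⟨hF.zero_mem, hMU q.mem⟩, fun h => ?_⟩
  have h1 := areaJet_toProd (F := F) 0 q
  rw [planeJacobian_of_fixed q.finrank_eq
    fun v hv => hF.fderiv_zero hU hMU hs q.mem (q.tangent hv)] at h1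
  rw [areaJet] at h1
  dsimp only at h h1
  rw [h] at h1
  simp at h1

/-- The integrand of the first variation of the mass. -/
def massVariation (F : ℝ → Euc Q → Euc Q) (q : GrBundle M) : ℝ := timeDeriv (areaJet F) q.toProd

/-- Continuity makes the integrand an admissible test function for varifold convergence; this is how
the first variation passes to the limit. -/
theorem IsFreeBoundaryIsotopy.continuous_massVariation (hF : IsFreeBoundaryIsotopy M N ε F) :
    Continuous (massVariation (M := M) F) := by
  obtain ⟨U, hU, hMU, hs⟩ := hF.smooth
  have h1 := continuousOn_timeDeriv (isOpen_areaJetDomain hU hs) (contDiffOn_areaJet hU hs)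
    (K := range (GrBundle.toProd (M := M))) (by
      rintro _ ⟨q, rfl⟩
      exact hF.mem_areaJetDomain hU hMU hs q)
  exact h1.comp_continuous GrBundle.continuous_toProd fun q => ⟨q, rfl⟩

theorem IsFreeBoundaryIsotopy.continuous_planeJacobian (hF : IsFreeBoundaryIsotopy M N ε F)
    {t : ℝ} (ht : t ∈ Ioo (-ε) ε) :
    Continuous fun q : GrBundle M => planeJacobian (fderiv ℝ (F t) q.pt) q.plane := by
  obtain ⟨U, hU, hMU, hs⟩ := hF.smooth
  simp only [← areaJet_toProd]
  refine Real.continuous_sqrt.comp ((contDiffOn_jacobianSq_isotopy hU hs).continuousOn.comp_continuous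
    (continuous_const.prodMk GrBundle.continuous_toProd) fun q => ⟨ht, hMU q.mem⟩)

theorem IsFreeBoundaryIsotopy.hasDerivAt_integral_planeJacobian
    (hF : IsFreeBoundaryIsotopy M N ε F) [CompactSpace (GrBundle M)]
    (v : Measure (GrBundle M)) [IsFiniteMeasure v] :
    HasDerivAt (fun t => ∫ q : GrBundle M, planeJacobian (fderiv ℝ (F t) q.pt) q.plane ∂v)
      (∫ q, massVariation F q ∂v) 0 := by
  obtain ⟨U, hU, hMU, hs⟩ := hF.smooth
  have h1 := hasDerivAt_setIntegral_of_contDiffOn (μ := v) (isCompact_univ (X := GrBundle M))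
    MeasurableSet.univ (χ := fun _ => 1) continuousOn_const
    GrBundle.continuous_toProd.continuousOn (isOpen_areaJetDomain hU hs)
    (contDiffOn_areaJet hU hs) fun q _ => hF.mem_areaJetDomain hU hMU hs q
  simp only [areaJet_toProd, one_mul, Measure.restrict_univ] at h1
  exact h1

theorem IsFreeBoundaryIsotopy.pushforwardWeight_toReal (hF : IsFreeBoundaryIsotopy M N ε F)
    (hM : IsClosed M) (v : Measure (GrBundle M)) {t : ℝ} (ht : t ∈ Ioo (-ε) ε) :
    (pushforwardWeight (F t) v M).toReal
      = ∫ q : GrBundle M, planeJacobian (fderiv ℝ (F t) q.pt) q.plane ∂v := by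
  have hJ := hF.continuous_planeJacobian ht
  obtain ⟨U, hU, hMU, hs⟩ := hF.smooth
  have hc : Continuous fun q : GrBundle M => F t q.pt :=
    (contDiffOn_slice hs ht).continuousOn.comp_continuous
      (continuous_fst.comp GrBundle.continuous_toProd) fun q => hMU q.mem
  have h1 : (fun q : GrBundle M => F t q.pt) ⁻¹' M = univ :=
    eq_univ_of_forall fun q => (hF.bijOn t ht).mapsTo q.mem
  rw [pushforwardWeight, Measure.map_apply hc.measurable hM.measurableSet, h1,
    withDensity_apply _ MeasurableSet.univ, Measure.restrict_univ,
    integral_eq_lintegral_of_nonneg_ae (.of_forall fun q => planeJacobian_nonneg _ _)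
      hJ.aestronglyMeasurable]

theorem IsFreeBoundaryIsotopy.hasDerivAt_mass (hF : IsFreeBoundaryIsotopy M N ε F)
    [CompactSpace (GrBundle M)] (hM : IsClosed M) (v : Measure (GrBundle M)) [IsFiniteMeasure v] :
    HasDerivAt (fun t => (pushforwardWeight (F t) v M).toReal) (∫ q, massVariation F q ∂v) 0 := by
  refine (hF.hasDerivAt_integral_planeJacobian v).congr_of_eventuallyEq ?_
  filter_upwards [isOpen_Ioo.mem_nhds hF.zero_mem] with t ht
  exact hF.pushforwardWeight_toReal hM v ht

variable {S : Type*} [TopologicalSpace S] [T2Space S] [CompactSpace S]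
  [ChartedSpace (EuclideanHalfSpace 2) S] [IsManifold (𝓡∂ 2) ∞ S] [MeasurableSpace S]
  [BorelSpace S] {Φ : S → Euc Q}

/-- In a chart, `F t` multiplies the area density by its Jacobian on the tangent plane. Thus the
first variation of area depends on the immersion only through its varifold. -/
theorem IsFreeBoundaryIsotopy.area_comp (hF : IsFreeBoundaryIsotopy M N ε F)
    (hΦ : IsAdmissible M N Φ) {t : ℝ} (ht : t ∈ Ioo (-ε) ε) :
    area (fun x => F t (Φ x))
      = ∫ q : GrBundle M, planeJacobian (fderiv ℝ (F t) q.pt) q.plane ∂hΦ.inducedVarifold := by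
  have hJ := hF.continuous_planeJacobian ht
  obtain ⟨U, hU, hMU, hs⟩ := hF.smooth
  have h1 := hΦ.integral_inducedVarifold ⟨_, hJ⟩
  simp only [ContinuousMap.coe_mk] at h1
  rw [h1, area]
  refine surfaceIntegral_congr fun c y hy => ?_
  rw [areaDensity_eq, frame_isotopy_comp hΦ hU hMU hs ht c hy,
    sqrt_det_gram_map _ (hΦ.det_gram_frame_ne_zero c hy), span_frame_inChart hΦ.smooth c hy,
    mul_comm]
  rfl

theorem IsFreeBoundaryIsotopy.hasDerivAt_area (hF : IsFreeBoundaryIsotopy M N ε F)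
    [CompactSpace (GrBundle M)] (hΦ : IsAdmissible M N Φ) :
    HasDerivAt (fun t => area (fun x => F t (Φ x)))
      (∫ q, massVariation F q ∂hΦ.inducedVarifold) 0 := by
  have := hΦ.isFiniteMeasure_inducedVarifold
  refine (hF.hasDerivAt_integral_planeJacobian hΦ.inducedVarifold).congr_of_eventuallyEq ?_
  filter_upwards [isOpen_Ioo.mem_nhds hF.zero_mem] with t ht
  exact hF.area_comp hΦ ht

end AreaVariation

/-! ### First variation of the boundary length -/

section LengthVariation

variable {Q : ℕ} {M N : Set (Euc Q)} {ε : ℝ} {F : ℝ → Euc Q → Euc Q} {U : Set (Euc Q)}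
  {g : Euc Q → Euc Q →L[ℝ] Euc Q}

theorem mem_tangentSpaceAt_of_proj (hgM : ∀ q ∈ M, g q = tangentProj M q) {p v : Euc Q}
    (hp : p ∈ M) (h : g p v = v) : v ∈ tangentSpaceAt M p := by
  rw [hgM p hp] at h
  exact Submodule.starProjection_eq_self_iff.1 h

/-- The length of the image of a vector under the differential of `F_t`. -/
def lengthJet (F : ℝ → Euc Q → Euc Q) (x : ℝ × (Euc Q × Euc Q)) : ℝ :=
  ‖fderiv ℝ (F x.1) x.2.1 x.2.2‖

/-- The domain on which `lengthJet` is smooth. -/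
def lengthJetDomain (F : ℝ → Euc Q → Euc Q) (ε : ℝ) (U : Set (Euc Q)) :
    Set (ℝ × (Euc Q × Euc Q)) :=
  {x | x.1 ∈ Ioo (-ε) ε ∧ x.2.1 ∈ U} ∩ {x | fderiv ℝ (F x.1) x.2.1 x.2.2 ≠ 0}

theorem contDiffOn_fderiv_apply (hU : IsOpen U)
    (hs : ContDiffOn ℝ ∞ (fun q : ℝ × Euc Q => F q.1 q.2) (Ioo (-ε) ε ×ˢ U)) :
    ContDiffOn ℝ 1 (fun x : ℝ × (Euc Q × Euc Q) => fderiv ℝ (F x.1) x.2.1 x.2.2)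
      {x | x.1 ∈ Ioo (-ε) ε ∧ x.2.1 ∈ U} := by
  have h1 : ContDiffOn ℝ 1 (fun x : ℝ × (Euc Q × Euc Q) =>
      fderiv ℝ (F x.1) x.2.1) {x | x.1 ∈ Ioo (-ε) ε ∧ x.2.1 ∈ U} :=
    ((contDiffOn_fderiv_slice hU hs).of_le (by simp)).comp
      (g := fun q : ℝ × Euc Q => fderiv ℝ (F q.1) q.2)
      (f := fun x : ℝ × (Euc Q × Euc Q) => (x.1, x.2.1))
      (contDiff_fst.prodMk (contDiff_fst.comp contDiff_snd)).contDiffOn fun x hx => ⟨hx.1, hx.2⟩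
  exact h1.clm_apply (contDiff_snd.comp contDiff_snd).contDiffOn

theorem isOpen_lengthJetDomain (hU : IsOpen U)
    (hs : ContDiffOn ℝ ∞ (fun q : ℝ × Euc Q => F q.1 q.2) (Ioo (-ε) ε ×ˢ U)) :
    IsOpen (lengthJetDomain F ε U) := by
  have hO : IsOpen {x : ℝ × (Euc Q × Euc Q) | x.1 ∈ Ioo (-ε) ε ∧ x.2.1 ∈ U} :=
    (isOpen_Ioo.preimage continuous_fst).inter
      (hU.preimage (continuous_fst.comp continuous_snd))
  exact (contDiffOn_fderiv_apply hU hs).continuousOn.isOpen_inter_preimage hO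
    isOpen_compl_singleton

theorem contDiffOn_lengthJet (hU : IsOpen U)
    (hs : ContDiffOn ℝ ∞ (fun q : ℝ × Euc Q => F q.1 q.2) (Ioo (-ε) ε ×ˢ U)) :
    ContDiffOn ℝ 1 (lengthJet F) (lengthJetDomain F ε U) :=
  ((contDiffOn_fderiv_apply hU hs).mono inter_subset_left).norm ℝ fun _ hx => hx.2

theorem IsFreeBoundaryIsotopy.mem_lengthJetDomain (hF : IsFreeBoundaryIsotopy M N ε F)
    (hU : IsOpen U) (hMU : M ⊆ U)
    (hs : ContDiffOn ℝ ∞ (fun q : ℝ × Euc Q => F q.1 q.2) (Ioo (-ε) ε ×ˢ U)) {p v : Euc Q}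
    (hp : p ∈ M) (hv : v ∈ tangentSpaceAt M p) (hv0 : v ≠ 0) :
    ((0 : ℝ), (p, v)) ∈ lengthJetDomain F ε U := by
  refine ⟨⟨hF.zero_mem, hMU hp⟩, ?_⟩
  change fderiv ℝ (F 0) p v ≠ 0
  rwa [hF.fderiv_zero hU hMU hs hp hv]

/-- The derivative is positively homogeneous of degree one in `v`, and bounded on the compact unit
tangent bundle. -/
theorem IsFreeBoundaryIsotopy.exists_timeDeriv_lengthJet_le (hF : IsFreeBoundaryIsotopy M N ε F)
    (hMc : IsCompact M) (hg : Continuous g) (hgM : ∀ q ∈ M, g q = tangentProj M q)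
    (hU : IsOpen U) (hMU : M ⊆ U)
    (hs : ContDiffOn ℝ ∞ (fun q : ℝ × Euc Q => F q.1 q.2) (Ioo (-ε) ε ×ˢ U)) :
    ∃ C, 0 ≤ C ∧ ∀ p ∈ M, ∀ v ∈ tangentSpaceAt M p, v ≠ 0 →
      |timeDeriv (lengthJet F) (p, v)| ≤ C * ‖v‖ := by
  -- The unit tangent bundle of `M`; tangency is written as a closed equation.
  let K : Set (Euc Q × Euc Q) := (M ×ˢ Metric.sphere 0 1) ∩ {x | g x.1 x.2 = x.2}
  have hK : IsCompact K := (hMc.prod (isCompact_sphere 0 1)).inter_right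
    (isClosed_eq ((hg.comp continuous_fst).clm_apply continuous_snd) continuous_snd)
  have hO := isOpen_lengthJetDomain hU hs
  have hΨ := contDiffOn_lengthJet hU hs
  have hKO : ∀ w ∈ K, ((0 : ℝ), w) ∈ lengthJetDomain F ε U := by
    rintro ⟨p, v⟩ ⟨⟨hp, hv⟩, hgv⟩
    exact hF.mem_lengthJetDomain hU hMU hs hp (mem_tangentSpaceAt_of_proj hgM hp hgv)
      (ne_zero_of_mem_unit_sphere ⟨v, hv⟩)
  obtain ⟨C, hC⟩ := hK.exists_bound_of_continuousOn (continuousOn_timeDeriv hO hΨ hKO)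
  refine ⟨max C 0, le_max_right _ _, fun p hp v hv hv0 => ?_⟩
  have hv' : ‖v‖⁻¹ • v ∈ tangentSpaceAt M p := Submodule.smul_mem _ _ hv
  have hn : ‖v‖ ≠ 0 := norm_ne_zero_iff.2 hv0
  have hmem : (p, ‖v‖⁻¹ • v) ∈ K := by
    refine ⟨⟨hp, ?_⟩, ?_⟩
    · simp [norm_smul, hn]
    · change g p _ = _
      rw [hgM p hp]
      exact Submodule.starProjection_eq_self_iff.2 hv'
  have h1 : timeDeriv (lengthJet F) (p, v) = ‖v‖ * timeDeriv (lengthJet F) (p, ‖v‖⁻¹ • v) := by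
    refine timeDeriv_eq_mul hO hΨ (hF.mem_lengthJetDomain hU hMU hs hp hv hv0) (hKO _ hmem)
      (.of_forall fun t => ?_)
    simp only [lengthJet, map_smul, norm_smul, norm_inv, norm_norm]
    field_simp
  rw [h1, abs_mul, abs_norm, mul_comm]
  exact mul_le_mul_of_nonneg_right ((hC _ hmem).trans (le_max_left _ _)) (norm_nonneg _)

variable {S : Type*} [TopologicalSpace S] [T2Space S] [CompactSpace S]
  [ChartedSpace (EuclideanHalfSpace 2) S] [IsManifold (𝓡∂ 2) ∞ S]

theorem IsFreeBoundaryIsotopy.exists_hasDerivAt_boundaryLength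
    (hF : IsFreeBoundaryIsotopy M N ε F) (hMc : IsCompact M) (hg : Continuous g)
    (hgM : ∀ q ∈ M, g q = tangentProj M q) :
    ∃ C, 0 ≤ C ∧ ∀ Φ : S → Euc Q, IsAdmissible M N Φ → ∃ r,
      HasDerivAt (fun t => boundaryLength (fun x => F t (Φ x))) r 0 ∧
      |r| ≤ C * boundaryLength Φ := by
  obtain ⟨U, hU, hMU, hs⟩ := hF.smooth
  obtain ⟨C, hC0, hC⟩ := hF.exists_timeDeriv_lengthJet_le hMc hg hgM hU hMU hs
  refine ⟨C, hC0, fun Φ hΦ => ⟨_, hasDerivAt_boundaryIntegral (W := Euc Q × Euc Q)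
    (j := fun c y => (inChart Φ c y, frame (inChart Φ c) y 1))
    hF.pos (fun c => (contDiffOn_inChart hΦ.smooth c).continuousOn.prodMk
      (hΦ.contDiffOn_frame c 1).continuousOn)
    (isOpen_lengthJetDomain hU hs) (contDiffOn_lengthJet hU hs) (fun c y hy => ?_)
    fun t ht c y hy => ?_, ?_⟩⟩
  · exact hF.mem_lengthJetDomain hU hMU hs (hΦ.inChart_mem c y) (hΦ.frame_mem c hy 1)
      ((hΦ.linearIndependent_frame c hy).ne_zero 1)
  · exact congrArg norm (congrFun (frame_isotopy_comp hΦ hU hMU hs ht c hy) 1)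
  · rw [boundaryLength, ← boundaryIntegral_const_mul]
    refine abs_boundaryIntegral_le (fun c => continuousOn_const.mul
      (hΦ.contDiffOn_frame c 1).continuousOn.norm) fun c y hy => ?_
    exact hC _ (hΦ.inChart_mem c y) _ (hΦ.frame_mem c hy 1)
      ((hΦ.linearIndependent_frame c hy).ne_zero 1)

end LengthVariation

/-! ### The bending density -/

section BendingDensity

variable {Q : ℕ}

/-- The components of a bilinear form after a change of frame. -/
def changeTwo (C : Matrix (Fin 2) (Fin 2) ℝ) (b : Fin 2 → Fin 2 → Euc Q) :
    Fin 2 → Fin 2 → Euc Q := fun i j => ∑ k, ∑ l, (C i k * C j l) • b k l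

theorem changeTwo_changeTwo (C D : Matrix (Fin 2) (Fin 2) ℝ) (b : Fin 2 → Fin 2 → Euc Q) :
    changeTwo C (changeTwo D b) = changeTwo (C * D) b := by
  ext i j q
  simp only [changeTwo, Fin.sum_univ_two, Matrix.mul_apply, PiLp.add_apply, PiLp.smul_apply,
    smul_eq_mul]
  ring

theorem changeTwo_one (b : Fin 2 → Fin 2 → Euc Q) : changeTwo 1 b = b := by
  ext i j q
  simp [changeTwo, Matrix.one_apply]

theorem changeTwo_add (C : Matrix (Fin 2) (Fin 2) ℝ) (b b' : Fin 2 → Fin 2 → Euc Q) :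
    changeTwo C (fun i j => b i j + b' i j)
      = fun i j => changeTwo C b i j + changeTwo C b' i j := by
  ext1 i; ext1 j
  simp only [changeTwo, smul_add, Finset.sum_add_distrib]

theorem changeTwo_map (C : Matrix (Fin 2) (Fin 2) ℝ) (L : Euc Q →ₗ[ℝ] Euc Q)
    (b : Fin 2 → Fin 2 → Euc Q) :
    (fun i j => L (changeTwo C b i j)) = changeTwo C fun i j => L (b i j) := by
  ext1 i; ext1 j
  simp only [changeTwo, map_sum, map_smul]

theorem changeTwo_bilin (C : Matrix (Fin 2) (Fin 2) ℝ) (B : Euc Q →L[ℝ] Euc Q →L[ℝ] Euc Q)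
    (e : Fin 2 → Euc Q) :
    (fun i j => B (∑ k, C i k • e k) (∑ l, C j l • e l))
      = changeTwo C fun i j => B (e i) (e j) := by
  ext1 i; ext1 j
  simp only [changeTwo, map_sum, map_smul, _root_.sum_apply,
    _root_.smul_apply, Finset.smul_sum, smul_smul]
  rw [Finset.sum_comm]
  simp only [mul_comm]

/-- `frameProj` as a linear map. -/
def frameProjₗ (a : Fin 2 → Euc Q) : Euc Q →ₗ[ℝ] Euc Q where
  toFun := frameProj a
  map_add' := frameProj_add a
  map_smul' := frameProj_smul a

theorem span_change {C : Matrix (Fin 2) (Fin 2) ℝ} (hC : IsUnit C.det) {e : Fin 2 → Euc Q}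
    (he : (Matrix.gram ℝ e).det ≠ 0) :
    Submodule.span ℝ (range fun i => ∑ k, C i k • e k) = Submodule.span ℝ (range e) := by
  have h1 : (Matrix.gram ℝ fun i => ∑ k, C i k • e k).det ≠ 0 := by
    rw [gram_change]
    simp [he, hC.ne_zero]
  refine Submodule.eq_of_le_of_finrank_eq (Submodule.span_le.2 ?_) ?_
  · rintro _ ⟨i, rfl⟩
    exact Submodule.sum_mem _ fun k _ => Submodule.smul_mem _ _ (Submodule.subset_span ⟨k, rfl⟩)
  · rw [finrank_span_eq_card (Matrix.linearIndependent_of_det_gram_ne_zero h1),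
      finrank_span_eq_card (Matrix.linearIndependent_of_det_gram_ne_zero he)]

theorem frameProj_change {C : Matrix (Fin 2) (Fin 2) ℝ} (hC : IsUnit C.det) {e : Fin 2 → Euc Q}
    (he : (Matrix.gram ℝ e).det ≠ 0) (v : Euc Q) :
    frameProj (fun i => ∑ k, C i k • e k) v = frameProj e v := by
  have h1 : (Matrix.gram ℝ fun i => ∑ k, C i k • e k).det ≠ 0 := by
    rw [gram_change]
    simp [he, hC.ne_zero]
  rw [← starProjection_span_eq_frameProj h1, ← starProjection_span_eq_frameProj he,
    starProjection_congr (span_change hC he)]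

theorem normSqTwo_smul (G : Matrix (Fin 2) (Fin 2) ℝ) (r : ℝ) (b : Fin 2 → Fin 2 → Euc Q) :
    normSqTwo G (fun i j => r • b i j) = r ^ 2 * normSqTwo G b := by
  simp only [normSqTwo, inner_smul_left, inner_smul_right, Finset.mul_sum, conj_trivial]
  refine Finset.sum_congr rfl fun i _ => Finset.sum_congr rfl fun j _ =>
    Finset.sum_congr rfl fun k _ => Finset.sum_congr rfl fun l _ => ?_
  ring

/-- The density of the bending energy of an immersion with first derivatives `a` and second
derivatives `b`, where `A` is the projection onto the tangent space of the ambient manifold. -/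
def bendDensity (A : Euc Q →L[ℝ] Euc Q) (a : Fin 2 → Euc Q) (b : Fin 2 → Fin 2 → Euc Q) : ℝ :=
  normSqTwo (Matrix.gram ℝ a) (fun i j => A (b i j) - frameProj a (b i j)) ^ 2
    * √ (Matrix.gram ℝ a).det

theorem bendDensity_smul (A : Euc Q →L[ℝ] Euc Q) (a : Fin 2 → Euc Q)
    (b : Fin 2 → Fin 2 → Euc Q) (r : ℝ) :
    bendDensity A a (fun i j => r • b i j) = r ^ 4 * bendDensity A a b := by
  have h1 : (fun i j => A (r • b i j) - frameProj a (r • b i j))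
      = fun i j => r • (A (b i j) - frameProj a (b i j)) := by
    ext1 i; ext1 j
    rw [map_smul, frameProj_smul, smul_sub]
  rw [bendDensity, h1, normSqTwo_smul, bendDensity]
  ring

/-- Both projections fix vectors tangent to the surface, so their difference kills them. The
tangential Hessian, which no geometric quantity controls, can therefore be discarded. -/
theorem bendDensity_add_tangential {A : Euc Q →L[ℝ] Euc Q} {a : Fin 2 → Euc Q}
    (ha : (Matrix.gram ℝ a).det ≠ 0) (hA : ∀ v ∈ Submodule.span ℝ (range a), A v = v)
    (b τ : Fin 2 → Fin 2 → Euc Q) (hτ : ∀ i j, τ i j ∈ Submodule.span ℝ (range a)) :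
    bendDensity A a (fun i j => b i j + τ i j) = bendDensity A a b := by
  have h1 : (fun i j => A (b i j + τ i j) - frameProj a (b i j + τ i j))
      = fun i j => A (b i j) - frameProj a (b i j) := by
    ext1 i; ext1 j
    rw [map_add, frameProj_add, hA _ (hτ i j), frameProj_of_mem ha (hτ i j)]
    abel
  rw [bendDensity, h1, bendDensity]

/-- The norm is frame independent; only the area factor changes. -/
theorem bendDensity_change (A : Euc Q →L[ℝ] Euc Q) {C : Matrix (Fin 2) (Fin 2) ℝ}
    (hC : IsUnit C.det) {e : Fin 2 → Euc Q} (he : (Matrix.gram ℝ e).det ≠ 0)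
    (b : Fin 2 → Fin 2 → Euc Q) :
    bendDensity A (fun i => ∑ k, C i k • e k) (changeTwo C b) = |C.det| * bendDensity A e b := by
  have h1 : (fun i j => A (changeTwo C b i j)
      - frameProj (fun i => ∑ k, C i k • e k) (changeTwo C b i j))
      = changeTwo C fun i j => A (b i j) - frameProj e (b i j) := by
    simp only [frameProj_change hC he]
    exact changeTwo_map C (A.toLinearMap - frameProjₗ e) b
  rw [bendDensity, h1, gram_change]
  unfold changeTwo
  rw [normSqTwo_change hC, bendDensity]
  have h2 : √ (C * Matrix.gram ℝ e * Cᵀ).det = |C.det| * √ (Matrix.gram ℝ e).det := by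
    rw [← Real.sqrt_sq_eq_abs, ← Real.sqrt_mul (sq_nonneg _)]
    congr 1
    simp only [Matrix.det_mul, Matrix.det_transpose]
    ring
  rw [h2]
  ring

variable {X : Type*} [NormedAddCommGroup X] [NormedSpace ℝ X] {s : Set X} {n : WithTop ℕ∞}

theorem contDiffOn_normSqTwo {G : X → Matrix (Fin 2) (Fin 2) ℝ}
    (hG : ∀ i j, ContDiffOn ℝ n (fun x => G x i j) s) (hdet : ∀ x ∈ s, (G x).det ≠ 0)
    {b : X → Fin 2 → Fin 2 → Euc Q} (hb : ∀ i j, ContDiffOn ℝ n (fun x => b x i j) s) :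
    ContDiffOn ℝ n (fun x => normSqTwo (G x) (b x)) s := by
  refine ContDiffOn.sum fun i _ => ContDiffOn.sum fun j _ => ContDiffOn.sum fun k _ =>
    ContDiffOn.sum fun l _ => ?_
  exact ((contDiffOn_matrix_inv hG hdet i k).mul (contDiffOn_matrix_inv hG hdet j l)).mul
    ((hb i j).inner ℝ (hb k l))

theorem contDiffOn_bendDensity {A : X → Euc Q →L[ℝ] Euc Q} (hA : ContDiffOn ℝ n A s)
    {a : X → Fin 2 → Euc Q} (ha : ∀ i, ContDiffOn ℝ n (fun x => a x i) s)
    (hdet : ∀ x ∈ s, (Matrix.gram ℝ (a x)).det ≠ 0)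
    {b : X → Fin 2 → Fin 2 → Euc Q} (hb : ∀ i j, ContDiffOn ℝ n (fun x => b x i j) s) :
    ContDiffOn ℝ n (fun x => bendDensity (A x) (a x) (b x)) s := by
  refine ((contDiffOn_normSqTwo (contDiffOn_gram ha) hdet fun i j => ?_).pow 2).mul
    ((contDiffOn_matrix_det (contDiffOn_gram ha)).sqrt hdet)
  exact (hA.clm_apply (hb i j)).sub (contDiffOn_frameProj ha hdet (hb i j))

end BendingDensity

/-! ### Normalized frames -/

section NormalizedFrames

variable {Q : ℕ} {M N : Set (Euc Q)} {g : Euc Q → Euc Q →L[ℝ] Euc Q}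
  {S : Type*} [TopologicalSpace S] [T2Space S] [CompactSpace S]
  [ChartedSpace (EuclideanHalfSpace 2) S] [IsManifold (𝓡∂ 2) ∞ S] {Φ : S → Euc Q}

theorem normSqTwo_changeTwo {C : Matrix (Fin 2) (Fin 2) ℝ} (hC : IsUnit C.det)
    (b : Fin 2 → Fin 2 → Euc Q) :
    normSqTwo (C * Cᵀ) (changeTwo C b) = ∑ i, ∑ j, ‖b i j‖ ^ 2 := by
  have h := normSqTwo_change hC 1 b
  rw [Matrix.mul_one, normSqTwo_one] at h
  exact h

theorem norm_add_sq_le (x y : Euc Q) : ‖x + y‖ ^ 2 ≤ 2 * ‖x‖ ^ 2 + 2 * ‖y‖ ^ 2 := by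
  have h1 := norm_add_le x y
  have h2 : ‖x + y‖ ^ 2 ≤ (‖x‖ + ‖y‖) ^ 2 := by gcongr
  nlinarith [sq_nonneg (‖x‖ - ‖y‖)]

/-- In an orthonormal frame of the immersed surface, the Hessian without its tangential part is
controlled by the second fundamental form. -/
theorem IsAdmissible.exists_normalized_frame (h : IsAdmissible M N Φ) (hg : ContDiff ℝ ∞ g)
    (hgM : ∀ q ∈ M, g q = tangentProj M q) {κ : ℝ} (hκ : ∀ p ∈ M, ‖fderiv ℝ g p‖ ≤ κ)
    (c : S) {y : Plane} (hy : y ∈ (extChartAt (𝓡∂ 2) c).target) :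
    ∃ (e : Fin 2 → Euc Q) (C : Matrix (Fin 2) (Fin 2) ℝ) (H : Fin 2 → Fin 2 → Euc Q),
      Orthonormal ℝ e ∧ IsUnit C.det ∧ (frame (inChart Φ c) y = fun i => ∑ k, C i k • e k) ∧
      metric (inChart Φ c) y = C * Cᵀ ∧
      Submodule.span ℝ (range e) = Submodule.span ℝ (range (frame (inChart Φ c) y)) ∧
      (fun i j => hess (inChart Φ c) y i j
        - frameProj (frame (inChart Φ c) y) (hess (inChart Φ c) y i j)) = changeTwo C H ∧
      ∑ i, ∑ j, ‖H i j‖ ^ 2 ≤ 2 * secondFundFormSq M (inChart Φ c) y + 8 * κ ^ 2 := by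
  obtain ⟨e, C, he, hC, ha, hgram, hspan, -⟩ :=
    exists_orthonormal_frame (h.det_gram_frame_ne_zero c hy)
  set p := inChart Φ c y with hp
  -- Gauss decomposition of the nontangential Hessian in the frame `e`: `H₁` is the second
  -- fundamental form in `M`, and `H₂` the part normal to `M`, bounded by `κ` because `e` is
  -- orthonormal.
  let H₁ := changeTwo C⁻¹ fun i j => secondFundForm M (inChart Φ c) i j y
  let H₂ : Fin 2 → Fin 2 → Euc Q := fun i j => fderiv ℝ g p (e i) (e j)
  have hH₁ : changeTwo C H₁ = fun i j => secondFundForm M (inChart Φ c) i j y := by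
    rw [changeTwo_changeTwo, Matrix.mul_nonsing_inv _ hC, changeTwo_one]
  have hH₂ : changeTwo C H₂ = fun i j =>
      fderiv ℝ g p (frame (inChart Φ c) y i) (frame (inChart Φ c) y j) := by
    rw [ha]
    exact (changeTwo_bilin C (fderiv ℝ g p) e).symm
  refine ⟨e, C, fun i j => H₁ i j + H₂ i j, he, hC, ha, hgram, hspan, ?_, ?_⟩
  · rw [changeTwo_add, hH₁, hH₂]
    ext1 i; ext1 j
    have h1 := h.hess_eq hg hgM c hy i j
    beta_reduce
    rw [h.secondFundForm_eq hgM c hy]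
    nth_rewrite 1 [h1]
    abel
  · have h1 : secondFundFormSq M (inChart Φ c) y = ∑ i, ∑ j, ‖H₁ i j‖ ^ 2 := by
      rw [secondFundFormSq, metric_eq_gram, hgram, ← hH₁, normSqTwo_changeTwo hC]
    have h2 : ∀ i j, ‖H₂ i j‖ ^ 2 ≤ κ ^ 2 := fun i j => by
      have h3 : ‖H₂ i j‖ ≤ κ := by
        refine ((fderiv ℝ g p (e i)).le_opNorm (e j)).trans ?_
        rw [he.1 j, mul_one]
        refine ((fderiv ℝ g p).le_opNorm (e i)).trans ?_
        rw [he.1 i, mul_one]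
        exact hκ p (h.inChart_mem c y)
      gcongr
    -- Each of the four entries contributes `2 κ²`, whence `8 κ²`.
    calc ∑ i, ∑ j, ‖H₁ i j + H₂ i j‖ ^ 2
        ≤ ∑ i, ∑ j, (2 * ‖H₁ i j‖ ^ 2 + 2 * κ ^ 2) := by
          refine Finset.sum_le_sum fun i _ => Finset.sum_le_sum fun j _ => ?_
          have := norm_add_sq_le (H₁ i j) (H₂ i j)
          have := h2 i j
          linarith
      _ = 2 * secondFundFormSq M (inChart Φ c) y + 8 * κ ^ 2 := by
          rw [h1]
          simp only [Fin.sum_univ_two]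
          ring

theorem abs_det_eq_areaDensity {u : Plane → Euc Q} {y : Plane}
    {C : Matrix (Fin 2) (Fin 2) ℝ} (h : metric u y = C * Cᵀ) : |C.det| = areaDensity u y := by
  rw [areaDensity, h, Matrix.det_mul, Matrix.det_transpose, Real.sqrt_mul_self_eq_abs]

theorem IsAdmissible.secondFundFormSq_nonneg (h : IsAdmissible M N Φ)
    (c : S) {y : Plane} (hy : y ∈ (extChartAt (𝓡∂ 2) c).target) :
    0 ≤ secondFundFormSq M (inChart Φ c) y := by
  obtain ⟨e, C, he, hC, ha, hgram, hspan, -⟩ :=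
    exists_orthonormal_frame (h.det_gram_frame_ne_zero c hy)
  have hH₁ : changeTwo C (changeTwo C⁻¹ fun i j => secondFundForm M (inChart Φ c) i j y)
      = fun i j => secondFundForm M (inChart Φ c) i j y := by
    rw [changeTwo_changeTwo, Matrix.mul_nonsing_inv _ hC, changeTwo_one]
  rw [secondFundFormSq, metric_eq_gram, hgram, ← hH₁, normSqTwo_changeTwo hC]
  positivity

theorem exists_bound_fderiv_proj (hMc : IsCompact M) (hg : ContDiff ℝ ∞ g) :
    ∃ κ, 0 ≤ κ ∧ ∀ p ∈ M, ‖fderiv ℝ g p‖ ≤ κ := by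
  obtain ⟨κ, hκ⟩ := hMc.exists_bound_of_continuousOn (hg.continuous_fderiv (by simp)).continuousOn
  exact ⟨max κ 0, le_max_right _ _, fun p hp => (hκ p hp).trans (le_max_left _ _)⟩

/-- The bending energy as an integral of `bendDensity`. -/
theorem IsAdmissible.bend_integrand_eq (h : IsAdmissible M N Φ)
    (hgM : ∀ q ∈ M, g q = tangentProj M q) (c : S) {y : Plane}
    (hy : y ∈ (extChartAt (𝓡∂ 2) c).target) :
    secondFundFormSq M (inChart Φ c) y ^ 2 * areaDensity (inChart Φ c) y
      = bendDensity (g (inChart Φ c y)) (frame (inChart Φ c) y) (hess (inChart Φ c) y) := by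
  rw [secondFundFormSq, bendDensity, metric_eq_gram, areaDensity_eq]
  simp only [h.secondFundForm_eq hgM c hy]

theorem IsAdmissible.continuousOn_bend_integrand (h : IsAdmissible M N Φ) (hg : ContDiff ℝ ∞ g)
    (hgM : ∀ q ∈ M, g q = tangentProj M q) (c : S) :
    ContinuousOn (fun y => secondFundFormSq M (inChart Φ c) y ^ 2 * areaDensity (inChart Φ c) y)
      (extChartAt (𝓡∂ 2) c).target := by
  refine ContinuousOn.congr ?_ fun y hy => h.bend_integrand_eq hgM c hy
  exact (contDiffOn_bendDensity (n := ∞) (hg.comp_contDiffOn (contDiffOn_inChart h.smooth c))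
    (h.contDiffOn_frame c) (fun y hy => h.det_gram_frame_ne_zero c hy)
    (h.contDiffOn_hess c)).continuousOn

end NormalizedFrames

/-! ### First variation of the bending energy -/

section BendingVariation

variable {Q : ℕ} {M N : Set (Euc Q)} {ε : ℝ} {F : ℝ → Euc Q → Euc Q} {U : Set (Euc Q)}
  {g : Euc Q → Euc Q →L[ℝ] Euc Q}

/-- Points, frames, a scalar, and second derivatives. -/
abbrev BendJet (Q : ℕ) : Type :=
  Euc Q × (Fin 2 → Euc Q) × ℝ × (Fin 2 → Fin 2 → Euc Q)

/-- The image of a frame under the differential of `F_t`. -/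
def jetFrame (F : ℝ → Euc Q → Euc Q) (t : ℝ) (p : Euc Q) (a : Fin 2 → Euc Q) : Fin 2 → Euc Q :=
  fun i => fderiv ℝ (F t) p (a i)

/-- The second derivatives of the composition with `F_t`; the contribution of the second derivative
of `F_t` is scaled by `r`. -/
def jetHess (F : ℝ → Euc Q → Euc Q) (t : ℝ) (p : Euc Q) (a : Fin 2 → Euc Q) (r : ℝ)
    (b : Fin 2 → Fin 2 → Euc Q) : Fin 2 → Fin 2 → Euc Q :=
  fun i j => r • fderiv ℝ (fderiv ℝ (F t)) p (a i) (a j) + fderiv ℝ (F t) p (b i j)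

/-- The density of the bending energy of the composition with `F_t`. -/
def bendJet (F : ℝ → Euc Q → Euc Q) (g : Euc Q → Euc Q →L[ℝ] Euc Q) (x : ℝ × BendJet Q) : ℝ :=
  bendDensity (g (F x.1 x.2.1)) (jetFrame F x.1 x.2.1 x.2.2.1)
    (jetHess F x.1 x.2.1 x.2.2.1 x.2.2.2.1 x.2.2.2.2)

/-- The domain on which `bendJet` is smooth. -/
def bendJetDomain (F : ℝ → Euc Q → Euc Q) (ε : ℝ) (U : Set (Euc Q)) : Set (ℝ × BendJet Q) :=
  {x | x.1 ∈ Ioo (-ε) ε ∧ x.2.1 ∈ U}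
    ∩ {x | (Matrix.gram ℝ (jetFrame F x.1 x.2.1 x.2.2.1)).det ≠ 0}

theorem contDiffOn_comp_base {Y : Type*} [NormedAddCommGroup Y] [NormedSpace ℝ Y]
    {G : ℝ → Euc Q → Y}
    (hG : ContDiffOn ℝ ∞ (fun q : ℝ × Euc Q => G q.1 q.2) (Ioo (-ε) ε ×ˢ U)) :
    ContDiffOn ℝ 1 (fun x : ℝ × BendJet Q => G x.1 x.2.1) {x | x.1 ∈ Ioo (-ε) ε ∧ x.2.1 ∈ U} :=
  (hG.of_le (by simp)).comp (g := fun q : ℝ × Euc Q => G q.1 q.2)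
    (f := fun x : ℝ × BendJet Q => (x.1, x.2.1))
    (contDiff_fst.prodMk (contDiff_fst.comp contDiff_snd)).contDiffOn fun _ hx => ⟨hx.1, hx.2⟩

theorem contDiff_bendJet_frame (i : Fin 2) :
    ContDiff ℝ 1 (fun x : ℝ × BendJet Q => x.2.2.1 i) := by fun_prop

theorem contDiff_bendJet_scalar : ContDiff ℝ 1 (fun x : ℝ × BendJet Q => x.2.2.2.1) := by fun_prop

theorem contDiff_bendJet_hess (i j : Fin 2) :
    ContDiff ℝ 1 (fun x : ℝ × BendJet Q => x.2.2.2.2 i j) := by fun_prop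

theorem contDiffOn_jetFrame (hU : IsOpen U)
    (hs : ContDiffOn ℝ ∞ (fun q : ℝ × Euc Q => F q.1 q.2) (Ioo (-ε) ε ×ˢ U)) (i : Fin 2) :
    ContDiffOn ℝ 1 (fun x : ℝ × BendJet Q => jetFrame F x.1 x.2.1 x.2.2.1 i)
      {x | x.1 ∈ Ioo (-ε) ε ∧ x.2.1 ∈ U} :=
  (contDiffOn_comp_base (G := fun t p => fderiv ℝ (F t) p)
    (contDiffOn_fderiv_slice hU hs)).clm_apply (contDiff_bendJet_frame i).contDiffOn

theorem contDiffOn_jetHess (hU : IsOpen U)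
    (hs : ContDiffOn ℝ ∞ (fun q : ℝ × Euc Q => F q.1 q.2) (Ioo (-ε) ε ×ˢ U)) (i j : Fin 2) :
    ContDiffOn ℝ 1
      (fun x : ℝ × BendJet Q => jetHess F x.1 x.2.1 x.2.2.1 x.2.2.2.1 x.2.2.2.2 i j)
      {x | x.1 ∈ Ioo (-ε) ε ∧ x.2.1 ∈ U} := by
  have h1 := contDiffOn_fderiv_slice hU hs
  have h2 := contDiffOn_comp_base (G := fun t p => fderiv ℝ (fderiv ℝ (F t)) p)
    (contDiffOn_fderiv_slice (G := fun t p => fderiv ℝ (F t) p) hU h1)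
  exact (contDiff_bendJet_scalar.contDiffOn.smul
    ((h2.clm_apply (contDiff_bendJet_frame i).contDiffOn).clm_apply
      (contDiff_bendJet_frame j).contDiffOn)).add
    ((contDiffOn_comp_base (G := fun t p => fderiv ℝ (F t) p) h1).clm_apply (contDiff_bendJet_hess i j).contDiffOn)

theorem isOpen_bendJetDomain (hU : IsOpen U)
    (hs : ContDiffOn ℝ ∞ (fun q : ℝ × Euc Q => F q.1 q.2) (Ioo (-ε) ε ×ˢ U)) :
    IsOpen (bendJetDomain F ε U) := by
  have hO : IsOpen {x : ℝ × BendJet Q | x.1 ∈ Ioo (-ε) ε ∧ x.2.1 ∈ U} :=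
    (isOpen_Ioo.preimage continuous_fst).inter
      (hU.preimage (continuous_fst.comp continuous_snd))
  exact (contDiffOn_matrix_det (contDiffOn_gram
    (contDiffOn_jetFrame hU hs))).continuousOn.isOpen_inter_preimage hO isOpen_compl_singleton

theorem contDiffOn_bendJet (hg : ContDiff ℝ ∞ g) (hU : IsOpen U)
    (hs : ContDiffOn ℝ ∞ (fun q : ℝ × Euc Q => F q.1 q.2) (Ioo (-ε) ε ×ˢ U)) :
    ContDiffOn ℝ 1 (bendJet F g) (bendJetDomain F ε U) :=
  contDiffOn_bendDensity
    ((contDiffOn_comp_base (G := fun t p => g (F t p)) (hg.comp_contDiffOn hs)).mono inter_subset_left)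
    (fun i => (contDiffOn_jetFrame hU hs i).mono inter_subset_left) (fun _ hx => hx.2)
    (fun i j => (contDiffOn_jetHess hU hs i j).mono inter_subset_left)

/-- The second derivative of `F t` adds a term to the Hessian that does not scale with `b`. Treating
its coefficient `r` as a further variable restores homogeneity. -/
theorem bendJet_smul (t : ℝ) (p : Euc Q) (a : Fin 2 → Euc Q) (r s : ℝ)
    (b : Fin 2 → Fin 2 → Euc Q) :
    bendJet F g (t, p, a, s * r, fun i j => s • b i j) = s ^ 4 * bendJet F g (t, p, a, r, b) := by
  simp only [bendJet]
  rw [← bendDensity_smul]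
  congr 1
  ext1 i; ext1 j
  simp only [jetHess, map_smul, smul_add, smul_smul]

theorem IsFreeBoundaryIsotopy.mem_bendJetDomain (hF : IsFreeBoundaryIsotopy M N ε F)
    (hU : IsOpen U) (hMU : M ⊆ U)
    (hs : ContDiffOn ℝ ∞ (fun q : ℝ × Euc Q => F q.1 q.2) (Ioo (-ε) ε ×ˢ U)) {p : Euc Q}
    (hp : p ∈ M) {a : Fin 2 → Euc Q} (ha : ∀ i, a i ∈ tangentSpaceAt M p)
    (hdet : (Matrix.gram ℝ a).det ≠ 0) (r : ℝ) (b : Fin 2 → Fin 2 → Euc Q) :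
    ((0 : ℝ), ((p, a, r, b) : BendJet Q)) ∈ bendJetDomain F ε U := by
  refine ⟨⟨hF.zero_mem, hMU hp⟩, ?_⟩
  have h1 : jetFrame F 0 p a = a := funext fun i => hF.fderiv_zero hU hMU hs hp (ha i)
  change (Matrix.gram ℝ (jetFrame F 0 p a)).det ≠ 0
  rwa [h1]

/-- Dividing `(1, b)` by `s = √(1 + |b|²)` lands in a compact set of jets, and degree-four
homogeneity returns the factor `s⁴ = (1 + |b|²)² ≤ 2 (1 + |b|⁴)`. -/
theorem IsFreeBoundaryIsotopy.exists_timeDeriv_bendJet_le (hF : IsFreeBoundaryIsotopy M N ε F)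
    (hMc : IsCompact M) (hg : ContDiff ℝ ∞ g) (hgM : ∀ q ∈ M, g q = tangentProj M q)
    (hU : IsOpen U) (hMU : M ⊆ U)
    (hs : ContDiffOn ℝ ∞ (fun q : ℝ × Euc Q => F q.1 q.2) (Ioo (-ε) ε ×ˢ U)) :
    ∃ C, 0 ≤ C ∧ ∀ p ∈ M, ∀ e : Fin 2 → Euc Q, Orthonormal ℝ e →
      (∀ i, e i ∈ tangentSpaceAt M p) → ∀ b : Fin 2 → Fin 2 → Euc Q,
      |timeDeriv (bendJet F g) (p, e, 1, b)| ≤ C * (1 + (∑ i, ∑ j, ‖b i j‖ ^ 2) ^ 2) := by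
  -- Orthonormal tangent frames with bounded scalar and Hessian. Orthonormality keeps the Gram
  -- determinant away from zero, while the scalar is allowed to vanish.
  let K : Set (BendJet Q) := (M ×ˢ Metric.closedBall 0 1 ×ˢ Metric.closedBall 0 1 ×ˢ
    Metric.closedBall 0 1) ∩ {x | (∀ i j, ⟪x.2.1 i, x.2.1 j⟫ = (1 : Matrix (Fin 2) (Fin 2) ℝ) i j) ∧ ∀ i, g x.1 (x.2.1 i) = x.2.1 i}
  have hK : IsCompact K := by
    refine (hMc.prod ((isCompact_closedBall _ _).prod ((isCompact_closedBall _ _).prod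
      (isCompact_closedBall _ _)))).inter_right (IsClosed.inter ?_ ?_)
    · change IsClosed {x : BendJet Q | ∀ i j, ⟪x.2.1 i, x.2.1 j⟫
        = (1 : Matrix (Fin 2) (Fin 2) ℝ) i j}
      simp only [ofPred_forall]
      exact isClosed_iInter fun i => isClosed_iInter fun j =>
        isClosed_eq (by fun_prop) continuous_const
    · change IsClosed {x : BendJet Q | ∀ i, g x.1 (x.2.1 i) = x.2.1 i}
      rw [ofPred_forall]
      refine isClosed_iInter fun i => isClosed_eq ?_ (by fun_prop)
      exact (hg.continuous.comp continuous_fst).clm_apply (by fun_prop)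
  have hO := isOpen_bendJetDomain hU hs
  have hΨ := contDiffOn_bendJet hg hU hs
  have hKO : ∀ w ∈ K, ((0 : ℝ), w) ∈ bendJetDomain F ε U := by
    rintro ⟨p, a, r, b⟩ ⟨⟨hp, -⟩, hgram, hga⟩
    refine hF.mem_bendJetDomain hU hMU hs hp
      (fun i => mem_tangentSpaceAt_of_proj hgM hp (hga i)) ?_ r b
    have h1 : Matrix.gram ℝ a = 1 := Matrix.ext hgram
    rw [h1]
    simp
  obtain ⟨C, hC⟩ := hK.exists_bound_of_continuousOn (continuousOn_timeDeriv hO hΨ hKO)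
  refine ⟨2 * max C 0, by positivity, fun p hp e he heM b => ?_⟩
  set B := ∑ i, ∑ j, ‖b i j‖ ^ 2 with hB
  have hB0 : 0 ≤ B := by positivity
  set s := √ (1 + B) with hsdef
  have hs1 : 1 ≤ s := Real.one_le_sqrt.2 (by linarith)
  have hs0 : 0 < s := by linarith
  have hs2 : s ^ 2 = 1 + B := Real.sq_sqrt (by linarith)
  have hbs : ∀ i j, ‖b i j‖ ≤ s := fun i j => by
    refine Real.le_sqrt_of_sq_le ?_
    have h1 : ‖b i j‖ ^ 2 ≤ ∑ j, ‖b i j‖ ^ 2 :=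
      Finset.single_le_sum (f := fun j => ‖b i j‖ ^ 2) (fun _ _ => sq_nonneg _) (Finset.mem_univ j)
    have h2 : ∑ j, ‖b i j‖ ^ 2 ≤ B :=
      Finset.single_le_sum (f := fun i => ∑ j, ‖b i j‖ ^ 2)
        (fun _ _ => Finset.sum_nonneg fun _ _ => sq_nonneg _) (Finset.mem_univ i)
    linarith
  have hmem : ((p, e, s⁻¹, fun i j => s⁻¹ • b i j) : BendJet Q) ∈ K := by
    refine ⟨⟨hp, ?_, ?_, ?_⟩, fun i j => congrFun (congrFun (gram_orthonormal he) i) j, fun i => ?_⟩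
    · rw [mem_closedBall_zero_iff, pi_norm_le_iff_of_nonneg zero_le_one]
      exact fun i => (he.1 i).le
    · rw [mem_closedBall_zero_iff, Real.norm_of_nonneg (inv_nonneg.2 hs0.le)]
      exact inv_le_one_of_one_le₀ hs1
    · rw [mem_closedBall_zero_iff, pi_norm_le_iff_of_nonneg zero_le_one]
      intro i
      rw [pi_norm_le_iff_of_nonneg zero_le_one]
      intro j
      rw [norm_smul, Real.norm_of_nonneg (inv_nonneg.2 hs0.le), inv_mul_le_iff₀ hs0, mul_one]
      exact hbs i j
    · change g p (e i) = e i
      rw [hgM p hp]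
      exact Submodule.starProjection_eq_self_iff.2 (heM i)
  have h1 : timeDeriv (bendJet F g) (p, e, 1, b)
      = s ^ 4 * timeDeriv (bendJet F g) (p, e, s⁻¹, fun i j => s⁻¹ • b i j) := by
    refine timeDeriv_eq_mul hO hΨ (hF.mem_bendJetDomain hU hMU hs hp heM
      (by rw [gram_orthonormal he]; simp) _ _) (hKO _ hmem) (.of_forall fun t => ?_)
    rw [← bendJet_smul]
    simp only [smul_smul, mul_inv_cancel₀ hs0.ne', one_smul]
  have h2 : s ^ 4 ≤ 2 * (1 + B ^ 2) := by
    have : s ^ 4 = (1 + B) ^ 2 := by rw [← hs2]; ring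
    nlinarith [sq_nonneg (1 - B)]
  rw [h1, abs_mul, abs_of_nonneg (by positivity : (0 : ℝ) ≤ s ^ 4)]
  calc s ^ 4 * |timeDeriv (bendJet F g) (p, e, s⁻¹, fun i j => s⁻¹ • b i j)|
      ≤ (2 * (1 + B ^ 2)) * max C 0 := by
        refine mul_le_mul h2 ((hC _ hmem).trans (le_max_left _ _)) (abs_nonneg _) (by positivity)
    _ = 2 * max C 0 * (1 + B ^ 2) := by ring

theorem jetFrame_change (t : ℝ) (p : Euc Q) (C : Matrix (Fin 2) (Fin 2) ℝ) (e : Fin 2 → Euc Q) :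
    jetFrame F t p (fun i => ∑ k, C i k • e k) = fun i => ∑ k, C i k • jetFrame F t p e k := by
  ext1 i
  simp only [jetFrame, map_sum, map_smul]

theorem jetHess_one (t : ℝ) (p : Euc Q) (a : Fin 2 → Euc Q) (b : Fin 2 → Fin 2 → Euc Q) :
    jetHess F t p a 1 b
      = fun i j => fderiv ℝ (fderiv ℝ (F t)) p (a i) (a j) + fderiv ℝ (F t) p (b i j) := by
  ext1 i; ext1 j
  rw [jetHess, one_smul]

theorem jetHess_change (t : ℝ) (p : Euc Q) (C : Matrix (Fin 2) (Fin 2) ℝ) (e : Fin 2 → Euc Q)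
    (b : Fin 2 → Fin 2 → Euc Q) :
    jetHess F t p (fun i => ∑ k, C i k • e k) 1 (changeTwo C b)
      = changeTwo C (jetHess F t p e 1 b) := by
  have h1 := changeTwo_bilin C (fderiv ℝ (fderiv ℝ (F t)) p) e
  have h2 : (fun i j => fderiv ℝ (F t) p (changeTwo C b i j))
      = changeTwo C fun i j => fderiv ℝ (F t) p (b i j) :=
    changeTwo_map C (fderiv ℝ (F t) p).toLinearMap b
  rw [jetHess_one, jetHess_one, changeTwo_add, ← h1, ← h2]

/-- Reduction of the bending density to an orthonormal frame. -/
theorem IsFreeBoundaryIsotopy.bendJet_eq_orthonormal (hF : IsFreeBoundaryIsotopy M N ε F)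
    (hgM : ∀ q ∈ M, g q = tangentProj M q) (hU : IsOpen U) (hMU : M ⊆ U)
    (hs : ContDiffOn ℝ ∞ (fun q : ℝ × Euc Q => F q.1 q.2) (Ioo (-ε) ε ×ˢ U))
    {t : ℝ} (ht : t ∈ Ioo (-ε) ε) {p : Euc Q} (hp : p ∈ M) {a e : Fin 2 → Euc Q}
    {C : Matrix (Fin 2) (Fin 2) ℝ} {b H : Fin 2 → Fin 2 → Euc Q}
    (haM : ∀ i, a i ∈ tangentSpaceAt M p) (ha : a = fun i => ∑ k, C i k • e k)
    (hC : IsUnit C.det) (hdet : (Matrix.gram ℝ (jetFrame F t p a)).det ≠ 0)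
    (hb : (fun i j => b i j - frameProj a (b i j)) = changeTwo C H) :
    bendJet F g (t, p, a, 1, b) = |C.det| * bendJet F g (t, p, e, 1, H) := by
  have hdet' : (Matrix.gram ℝ (jetFrame F t p e)).det ≠ 0 := by
    intro h0
    apply hdet
    rw [ha, jetFrame_change, gram_change, Matrix.det_mul, Matrix.det_mul, h0]
    simp
  have hspan : ∀ v ∈ Submodule.span ℝ (range a),
      fderiv ℝ (F t) p v ∈ Submodule.span ℝ (range (jetFrame F t p a)) := by
    intro v hv
    refine (Submodule.span_le (p := (Submodule.span ℝ (range (jetFrame F t p a))).comap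
      (fderiv ℝ (F t) p).toLinearMap)).2 ?_ hv
    rintro _ ⟨i, rfl⟩
    exact Submodule.subset_span ⟨i, rfl⟩
  -- The differential of `F t` sends the tangential part of `b` to vectors tangent to the image
  -- surface, which the bending density ignores.
  have h1 : jetHess F t p a 1 b = fun i j => jetHess F t p a 1 (changeTwo C H) i j
      + fderiv ℝ (F t) p (frameProj a (b i j)) := by
    rw [← hb]
    ext1 i; ext1 j
    simp only [jetHess, map_sub]
    abel
  have hFp : F t p ∈ M := (hF.bijOn t ht).mapsTo hp
  have h2 : ∀ v ∈ Submodule.span ℝ (range (jetFrame F t p a)), g (F t p) v = v := by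
    intro v hv
    rw [hgM _ hFp]
    refine Submodule.starProjection_eq_self_iff.2 ((Submodule.span_le.2 ?_) hv)
    rintro _ ⟨i, rfl⟩
    exact hF.fderiv_mem hU hMU hs ht hp (haM i)
  simp only [bendJet]
  rw [h1, bendDensity_add_tangential hdet h2 _ _
    fun i j => hspan _ (frameProj_mem_span a (b i j))]
  subst ha
  rw [jetFrame_change, jetHess_change, bendDensity_change _ hC hdet']

variable {S : Type*} [TopologicalSpace S] [T2Space S] [CompactSpace S]
  [ChartedSpace (EuclideanHalfSpace 2) S] [IsManifold (𝓡∂ 2) ∞ S]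

/-- Differentiation takes place in the coordinate frame, where the jet is smooth; the pointwise
estimate takes place in an orthonormal frame with only the nontangential Hessian. The two differ by
the area density, which does not depend on time. -/
theorem IsFreeBoundaryIsotopy.exists_hasDerivAt_bendingEnergy
    (hF : IsFreeBoundaryIsotopy M N ε F) (hMc : IsCompact M) (hg : ContDiff ℝ ∞ g)
    (hgM : ∀ q ∈ M, g q = tangentProj M q) :
    ∃ C, 0 ≤ C ∧ ∀ Φ : S → Euc Q, IsAdmissible M N Φ → ∃ r,
      HasDerivAt (fun t => bendingEnergy M (fun x => F t (Φ x))) r 0 ∧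
      |r| ≤ C * (area Φ + bendingEnergy M Φ) := by
  obtain ⟨U, hU, hMU, hs⟩ := hF.smooth
  obtain ⟨C, hC0, hC⟩ := hF.exists_timeDeriv_bendJet_le hMc hg hgM hU hMU hs
  obtain ⟨κ, hκ0, hκ⟩ := exists_bound_fderiv_proj hMc hg
  have hO := isOpen_bendJetDomain hU hs
  have hΨ := contDiffOn_bendJet hg hU hs
  -- From `(2 |II|² + 8 κ²)² ≤ 8 |II|⁴ + 128 κ⁴`.
  refine ⟨C * (8 + 128 * κ ^ 4), by positivity, fun Φ hΦ => ?_⟩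
  have h0 : ∀ c, ∀ y ∈ (extChartAt (𝓡∂ 2) c).target, ((0 : ℝ), ((inChart Φ c y,
      frame (inChart Φ c) y, 1, hess (inChart Φ c) y) : BendJet Q)) ∈ bendJetDomain F ε U :=
    fun c y hy => hF.mem_bendJetDomain hU hMU hs (hΦ.inChart_mem c y) (hΦ.frame_mem c hy)
      (hΦ.det_gram_frame_ne_zero c hy) _ _
  refine ⟨_, hasDerivAt_surfaceIntegral (W := BendJet Q)
    (j := fun c y => (inChart Φ c y, frame (inChart Φ c) y, 1, hess (inChart Φ c) y))
    hF.pos (fun c => ?_) hO hΨ h0 fun t ht c y hy => ?_, ?_⟩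
  · refine (contDiffOn_inChart hΦ.smooth c).continuousOn.prodMk
      (ContinuousOn.prodMk ?_ (continuousOn_const.prodMk ?_))
    · exact continuousOn_pi.2 fun i => (hΦ.contDiffOn_frame c i).continuousOn
    · exact continuousOn_pi.2 fun i => continuousOn_pi.2 fun j =>
        (hΦ.contDiffOn_hess c i j).continuousOn
  · have h1 := (hF.isAdmissible_comp hΦ ht).bend_integrand_eq hgM c hy
    rw [h1, frame_isotopy_comp hΦ hU hMU hs ht c hy]
    have h2 : hess (inChart (fun x => F t (Φ x)) c) y
        = jetHess F t (inChart Φ c y) (frame (inChart Φ c) y) 1 (hess (inChart Φ c) y) := by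
      ext1 i; ext1 j
      rw [hess_isotopy_comp hΦ hU hMU hs ht c hy, jetHess, one_smul]
    rw [h2]
    rfl
  · have hA := hΦ.continuousOn_areaDensity
    have hBc := hΦ.continuousOn_bend_integrand hg hgM
    rw [area, bendingEnergy, ← surfaceIntegral_add hA hBc, ← surfaceIntegral_const_mul]
    refine abs_surfaceIntegral_le (fun c => continuousOn_const.mul ((hA c).add (hBc c)))
      fun c y hy => ?_
    obtain ⟨e, A, H, he, hAdet, ha, hmet, hspan, hb, hH⟩ :=
      hΦ.exists_normalized_frame hg hgM hκ c hy
    have heM : ∀ i, e i ∈ tangentSpaceAt M (inChart Φ c y) := by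
      intro i
      have h3 : e i ∈ Submodule.span ℝ (range (frame (inChart Φ c) y)) := by
        rw [← hspan]; exact Submodule.subset_span ⟨i, rfl⟩
      refine (Submodule.span_le.2 ?_) h3
      rintro _ ⟨k, rfl⟩
      exact hΦ.frame_mem c hy k
    have h4 : timeDeriv (bendJet F g) (inChart Φ c y, frame (inChart Φ c) y, 1,
        hess (inChart Φ c) y) = |A.det| * timeDeriv (bendJet F g) (inChart Φ c y, e, 1, H) := by
      refine timeDeriv_eq_mul hO hΨ (h0 c y hy) (hF.mem_bendJetDomain hU hMU hs
        (hΦ.inChart_mem c y) heM (by rw [gram_orthonormal he]; simp) _ _) ?_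
      filter_upwards [isOpen_Ioo.mem_nhds hF.zero_mem] with t ht
      refine hF.bendJet_eq_orthonormal hgM hU hMU hs ht (hΦ.inChart_mem c y)
        (hΦ.frame_mem c hy) ha hAdet ?_ hb
      have h5 := (hF.isAdmissible_comp hΦ ht).det_gram_frame_ne_zero c hy
      rw [frame_isotopy_comp hΦ hU hMU hs ht c hy] at h5
      exact h5
    change |timeDeriv (bendJet F g) _| ≤ _
    rw [h4, abs_mul, abs_abs, abs_det_eq_areaDensity hmet]
    have h6 := hC _ (hΦ.inChart_mem c y) e he heM H
    have h7 := areaDensity_nonneg (inChart Φ c) y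
    have h8 := hΦ.secondFundFormSq_nonneg c hy
    set II := secondFundFormSq M (inChart Φ c) y
    set a := areaDensity (inChart Φ c) y
    have h9 : 1 + (∑ i, ∑ j, ‖H i j‖ ^ 2) ^ 2 ≤ (8 + 128 * κ ^ 4) * (1 + II ^ 2) := by
      have h10 : (∑ i, ∑ j, ‖H i j‖ ^ 2) ^ 2 ≤ (2 * II + 8 * κ ^ 2) ^ 2 := by
        gcongr
      nlinarith [sq_nonneg (II - 4 * κ ^ 2), sq_nonneg (κ ^ 2 * II), sq_nonneg II]
    calc a * |timeDeriv (bendJet F g) (inChart Φ c y, e, 1, H)|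
        ≤ a * (C * ((8 + 128 * κ ^ 4) * (1 + II ^ 2))) := by gcongr; exact h6.trans (by gcongr)
      _ = _ := by ring

end BendingVariation

/-! ### The norm of the velocity of an isotopy along an immersion -/

section FinslerNorm

variable {Q : ℕ} {M N : Set (Euc Q)} {U : Set (Euc Q)} {g : Euc Q → Euc Q →L[ℝ] Euc Q}
  {X : Euc Q → Euc Q}
  {S : Type*} [TopologicalSpace S] [T2Space S] [CompactSpace S]
  [ChartedSpace (EuclideanHalfSpace 2) S] [IsManifold (𝓡∂ 2) ∞ S] {Φ : S → Euc Q}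

/-- The tangential derivative of a vector field. -/
def tangentialDeriv (g : Euc Q → Euc Q →L[ℝ] Euc Q) (X : Euc Q → Euc Q) (p : Euc Q) :
    Euc Q →L[ℝ] Euc Q := (g p).comp (fderiv ℝ X p)

theorem contDiffOn_tangentialDeriv (hg : ContDiff ℝ ∞ g) (hU : IsOpen U)
    (hX : ContDiffOn ℝ ∞ X U) : ContDiffOn ℝ ∞ (tangentialDeriv g X) U :=
  hg.contDiffOn.clm_comp (hX.fderiv_of_isOpen hU (by simp))

theorem IsAdmissible.covDeriv_eq (h : IsAdmissible M N Φ)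
    (hgM : ∀ q ∈ M, g q = tangentProj M q) (hU : IsOpen U) (hMU : M ⊆ U)
    (hX : ContDiffOn ℝ ∞ X U) (c : S) {y : Plane} (hy : y ∈ (extChartAt (𝓡∂ 2) c).target)
    (i : Fin 2) :
    covDeriv M (inChart Φ c) (inChart (fun x => X (Φ x)) c) i y
      = tangentialDeriv g X (inChart Φ c y) (frame (inChart Φ c) y i) := by
  have h1 : pd (inChart (fun x => X (Φ x)) c) i y
      = fderiv ℝ X (inChart Φ c y) (frame (inChart Φ c) y i) :=
    pd_comp (chartTarget_subset_range c hy)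
      ((hX.contDiffAt (hU.mem_nhds (hMU (h.inChart_mem c y)))).differentiableAt (by simp))
      (ContDiffOn.differentiableWithinAt_range (chartTarget_mem_nhdsWithin c)
        (contDiffOn_inChart h.smooth c) hy) i
  rw [covDeriv, h1, ← hgM _ (h.inChart_mem c y)]
  rfl

/-- The chain rule produces the full Hessian and the Christoffel term removes its tangential part.
What remains is controlled by the second fundamental form. -/
theorem IsAdmissible.covDerivTwo_eq (h : IsAdmissible M N Φ) (hg : ContDiff ℝ ∞ g)
    (hgM : ∀ q ∈ M, g q = tangentProj M q) (hU : IsOpen U) (hMU : M ⊆ U)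
    (hX : ContDiffOn ℝ ∞ X U) (c : S) {y : Plane} (hy : y ∈ (extChartAt (𝓡∂ 2) c).target)
    (i j : Fin 2) :
    covDerivTwo M (inChart Φ c) (inChart (fun x => X (Φ x)) c) i j y
      = g (inChart Φ c y) (fderiv ℝ (tangentialDeriv g X) (inChart Φ c y)
          (frame (inChart Φ c) y i) (frame (inChart Φ c) y j))
        + tangentialDeriv g X (inChart Φ c y) (hess (inChart Φ c) y i j
          - frameProj (frame (inChart Φ c) y) (hess (inChart Φ c) y i j)) := by
  have hT := chartTarget_mem_nhdsWithin c
  have hTr := chartTarget_subset_range c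
  have hu := contDiffOn_inChart h.smooth c
  have hp := h.inChart_mem c y
  have h1 : DifferentiableAt ℝ (tangentialDeriv g X) (inChart Φ c y) :=
    ((contDiffOn_tangentialDeriv hg hU hX).contDiffAt (hU.mem_nhds (hMU hp))).differentiableAt
      (by simp)
  have h2 : pd (covDeriv M (inChart Φ c) (inChart (fun x => X (Φ x)) c) j) i y
      = fderiv ℝ (tangentialDeriv g X) (inChart Φ c y) (frame (inChart Φ c) y i)
          (frame (inChart Φ c) y j)
        + tangentialDeriv g X (inChart Φ c y) (hess (inChart Φ c) y i j) := by
    rw [pd_congr (hT y hy) hy (g := fun z => tangentialDeriv g X (inChart Φ c z)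
      (pd (inChart Φ c) j z)) (fun z hz => h.covDeriv_eq hgM hU hMU hX c hz j) i]
    exact pd_clm_comp (hTr hy) h1 (ContDiffOn.differentiableWithinAt_range hT hu hy)
      (ContDiffOn.differentiableWithinAt_range hT (contDiffOn_pd hTr hT hu j) hy) i
  have h3 : ∀ v, g (inChart Φ c y) (tangentialDeriv g X (inChart Φ c y) v)
      = tangentialDeriv g X (inChart Φ c y) v := by
    intro v
    rw [tangentialDeriv, hgM _ hp]
    exact Submodule.starProjection_eq_self_iff.2 (Submodule.starProjection_apply_mem _ _)
  rw [covDerivTwo]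
  simp only [h.covDeriv_eq hgM hU hMU hX c hy]
  rw [covDeriv, h2, ← hgM _ hp, map_add, h3, map_sub, ← sum_christoffel_smul, map_sum]
  simp only [map_smul]
  abel

theorem norm_tangentProj_le (p : Euc Q) : ‖tangentProj M p‖ ≤ 1 :=
  Submodule.starProjection_norm_le _

/-- A crude bound suffices: the norm is multiplied by `σ_k^5`, while `σ_k^4` already makes the
bending energy vanish. -/
theorem rpow_quarter_le {x : ℝ} (hx : 0 ≤ x) : x ^ (1 / 4 : ℝ) ≤ 1 + x := by
  rcases le_total x 1 with h | h
  · have := Real.rpow_le_one hx h (by norm_num : (0 : ℝ) ≤ 1 / 4)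
    linarith
  · have := Real.rpow_le_rpow_of_exponent_le h (by norm_num : (1 / 4 : ℝ) ≤ 1)
    rw [Real.rpow_one] at this
    linarith

theorem exists_norm_bound {Y : Type*} [NormedAddCommGroup Y] {f : Euc Q → Y} (hMc : IsCompact M)
    (hf : ContinuousOn f M) : ∃ C, 0 ≤ C ∧ ∀ p ∈ M, ‖f p‖ ≤ C := by
  obtain ⟨C, hC⟩ := hMc.exists_bound_of_continuousOn hf
  exact ⟨max C 0, le_max_right _ _, fun p hp => (hC p hp).trans (le_max_left _ _)⟩

theorem IsAdmissible.normSqOne_covDeriv_le (hΦ : IsAdmissible M N Φ)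
    (hgM : ∀ q ∈ M, g q = tangentProj M q) (hU : IsOpen U) (hMU : M ⊆ U)
    (hX : ContDiffOn ℝ ∞ X U) {C₂ : ℝ} (hC₂ : ∀ p ∈ M, ‖tangentialDeriv g X p‖ ≤ C₂)
    (c : S) {y : Plane} (hy : y ∈ (extChartAt (𝓡∂ 2) c).target) :
    normSqOne (metric (inChart Φ c) y)
      (fun i => covDeriv M (inChart Φ c) (inChart (fun x => X (Φ x)) c) i y) ≤ 2 * C₂ ^ 2 := by
  obtain ⟨e, A, he, hA, ha, hmet, -⟩ :=
    exists_orthonormal_frame (hΦ.det_gram_frame_ne_zero c hy)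
  have h3 : (fun i => covDeriv M (inChart Φ c) (inChart (fun x => X (Φ x)) c) i y)
      = fun i => ∑ k, A i k • tangentialDeriv g X (inChart Φ c y) (e k) := by
    ext1 i
    rw [hΦ.covDeriv_eq hgM hU hMU hX c hy, ha, map_sum]
    simp only [map_smul]
  have h4 := normSqOne_change hA 1 fun k => tangentialDeriv g X (inChart Φ c y) (e k)
  rw [Matrix.mul_one, normSqOne_one] at h4
  rw [h3, metric_eq_gram, hmet, h4]
  have h5 : ∀ k, ‖tangentialDeriv g X (inChart Φ c y) (e k)‖ ^ 2 ≤ C₂ ^ 2 := fun k => by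
    have := (tangentialDeriv g X _).le_of_opNorm_le (hC₂ _ (hΦ.inChart_mem c y)) (e k)
    rw [he.1 k, mul_one] at this
    gcongr
  have h6 := h5 0
  have h7 := h5 1
  rw [Fin.sum_univ_two]
  linarith

/-- In an orthonormal frame the components are a bounded term plus a bounded linear map applied to
the normalized Hessian. -/
theorem IsAdmissible.normSqTwo_covDerivTwo_le (hΦ : IsAdmissible M N Φ) (hg : ContDiff ℝ ∞ g)
    (hgM : ∀ q ∈ M, g q = tangentProj M q) (hU : IsOpen U) (hMU : M ⊆ U)
    (hX : ContDiffOn ℝ ∞ X U) {C₂ C₃ κ : ℝ} (hC₂ : ∀ p ∈ M, ‖tangentialDeriv g X p‖ ≤ C₂)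
    (hC₃ : ∀ p ∈ M, ‖fderiv ℝ (tangentialDeriv g X) p‖ ≤ C₃)
    (hκ : ∀ p ∈ M, ‖fderiv ℝ g p‖ ≤ κ)
    (c : S) {y : Plane} (hy : y ∈ (extChartAt (𝓡∂ 2) c).target) :
    0 ≤ normSqTwo (metric (inChart Φ c) y)
      (fun i j => covDerivTwo M (inChart Φ c) (inChart (fun x => X (Φ x)) c) i j y) ∧
    normSqTwo (metric (inChart Φ c) y)
      (fun i j => covDerivTwo M (inChart Φ c) (inChart (fun x => X (Φ x)) c) i j y)
      ≤ 8 * C₃ ^ 2 + 2 * C₂ ^ 2 * (2 * secondFundFormSq M (inChart Φ c) y + 8 * κ ^ 2) := by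
  have hp := hΦ.inChart_mem c y
  obtain ⟨e, A, H, he, hAdet, ha, hmet, -, hb, hH⟩ :=
    hΦ.exists_normalized_frame hg hgM hκ c hy
  let D := tangentialDeriv g X (inChart Φ c y)
  let D' := fderiv ℝ (tangentialDeriv g X) (inChart Φ c y)
  let B : Fin 2 → Fin 2 → Euc Q := fun i j => g (inChart Φ c y) (D' (e i) (e j)) + D (H i j)
  have h4 : (fun i j => covDerivTwo M (inChart Φ c) (inChart (fun x => X (Φ x)) c) i j y)
      = changeTwo A B := by
    have h5 := changeTwo_bilin A D' e
    have h6 := changeTwo_map A (g (inChart Φ c y)).toLinearMap (fun i j => D' (e i) (e j))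
    have h7 := changeTwo_map A D.toLinearMap H
    rw [changeTwo_add]
    ext1 i; ext1 j
    rw [hΦ.covDerivTwo_eq hg hgM hU hMU hX c hy]
    have h8 := congrFun (congrFun h5 i) j
    have h9 := congrFun (congrFun h6 i) j
    have h10 := congrFun (congrFun h7 i) j
    have h11 := congrFun (congrFun hb i) j
    beta_reduce at h8 h9 h10 h11
    rw [h11, ha]
    exact congrArg₂ (· + ·) ((congrArg (g (inChart Φ c y)) h8).trans h9) h10
  have hB : ∀ i j, ‖B i j‖ ^ 2 ≤ 2 * C₃ ^ 2 + 2 * (C₂ ^ 2 * ‖H i j‖ ^ 2) := by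
    intro i j
    refine (norm_add_sq_le _ _).trans ?_
    have h5 : ‖g (inChart Φ c y) (D' (e i) (e j))‖ ≤ C₃ := by
      rw [hgM _ hp]
      refine ((tangentProj M _).le_of_opNorm_le (norm_tangentProj_le _) _).trans ?_
      rw [one_mul]
      refine ((D' (e i)).le_opNorm (e j)).trans ?_
      rw [he.1 j, mul_one]
      refine (D'.le_opNorm (e i)).trans ?_
      rw [he.1 i, mul_one]
      exact hC₃ _ hp
    have h6 : ‖D (H i j)‖ ≤ C₂ * ‖H i j‖ := D.le_of_opNorm_le (hC₂ _ hp) _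
    rw [← mul_pow]
    gcongr
  rw [h4, hmet, normSqTwo_changeTwo hAdet]
  refine ⟨by positivity, ?_⟩
  calc ∑ i, ∑ j, ‖B i j‖ ^ 2
      ≤ ∑ i, ∑ j, (2 * C₃ ^ 2 + 2 * (C₂ ^ 2 * ‖H i j‖ ^ 2)) :=
        Finset.sum_le_sum fun i _ => Finset.sum_le_sum fun j _ => hB i j
    _ = 8 * C₃ ^ 2 + 2 * C₂ ^ 2 * ∑ i, ∑ j, ‖H i j‖ ^ 2 := by
        simp only [Fin.sum_univ_two]; ring
    _ ≤ _ := by gcongr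

theorem sq_le_of_le_affine {x z K a b : ℝ} (hx : 0 ≤ x) (hz : 0 ≤ z) (ha : 0 ≤ a) (hb : 0 ≤ b)
    (h : x ≤ a + b * z) (hK : K = a + b) : x ^ 2 ≤ 2 * K ^ 2 * (1 + z ^ 2) := by
  have h1 : x ≤ K * (1 + z) := by
    rw [hK]
    nlinarith [mul_nonneg ha hz]
  have h2 : x ^ 2 ≤ (K * (1 + z)) ^ 2 := by gcongr
  nlinarith [mul_nonneg (sq_nonneg K) (sq_nonneg (1 - z))]

theorem area_nonneg (Φ : S → Euc Q) : 0 ≤ area Φ :=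
  surfaceIntegral_nonneg fun _ y => areaDensity_nonneg _ y

theorem bendingEnergy_nonneg (M : Set (Euc Q)) (Φ : S → Euc Q) : 0 ≤ bendingEnergy M Φ :=
  surfaceIntegral_nonneg fun _ y => mul_nonneg (sq_nonneg _) (areaDensity_nonneg _ y)

theorem boundaryLength_nonneg (Φ : S → Euc Q) : 0 ≤ boundaryLength Φ :=
  boundaryIntegral_nonneg fun _ _ => norm_nonneg _

theorem exists_surfaceIntegral_covDerivTwo_le (hMc : IsCompact M) (hg : ContDiff ℝ ∞ g)
    (hgM : ∀ q ∈ M, g q = tangentProj M q) (hU : IsOpen U) (hMU : M ⊆ U)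
    (hX : ContDiffOn ℝ ∞ X U) :
    ∃ C, 0 ≤ C ∧ ∀ Φ : S → Euc Q, IsAdmissible M N Φ →
      (surfaceIntegral fun c y => normSqTwo (metric (inChart Φ c) y)
        (fun i j => covDerivTwo M (inChart Φ c) (inChart (fun x => X (Φ x)) c) i j y) ^ 2
        * areaDensity (inChart Φ c) y) ≤ C * (area Φ + bendingEnergy M Φ) := by
  have hT := contDiffOn_tangentialDeriv hg hU hX
  obtain ⟨C₂, hC₂0, hC₂⟩ := exists_norm_bound hMc (hT.continuousOn.mono hMU)
  obtain ⟨C₃, hC₃0, hC₃⟩ := exists_norm_bound hMc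
    ((hT.continuousOn_fderiv_of_isOpen hU (by simp)).mono hMU)
  obtain ⟨κ, hκ0, hκ⟩ := exists_bound_fderiv_proj hMc hg
  refine ⟨2 * (8 * C₃ ^ 2 + 16 * C₂ ^ 2 * κ ^ 2 + 4 * C₂ ^ 2) ^ 2, by positivity, fun Φ hΦ => ?_⟩
  have hA := hΦ.continuousOn_areaDensity
  have hBc := hΦ.continuousOn_bend_integrand hg hgM
  rw [area, bendingEnergy, ← surfaceIntegral_add hA hBc, ← surfaceIntegral_const_mul]
  refine (le_abs_self _).trans (abs_surfaceIntegral_le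
    (fun c => continuousOn_const.mul ((hA c).add (hBc c))) fun c y hy => ?_)
  obtain ⟨h1, h2⟩ := hΦ.normSqTwo_covDerivTwo_le hg hgM hU hMU hX hC₂ hC₃ hκ c hy
  have ha0 := areaDensity_nonneg (inChart Φ c) y
  have h3 := sq_le_of_le_affine (a := 8 * C₃ ^ 2 + 16 * C₂ ^ 2 * κ ^ 2) (b := 4 * C₂ ^ 2) h1
    (hΦ.secondFundFormSq_nonneg c hy) (by positivity) (by positivity)
    (h2.trans (by linarith)) rfl
  rw [abs_of_nonneg (mul_nonneg (sq_nonneg _) ha0)]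
  refine (mul_le_mul_of_nonneg_right h3 ha0).trans (le_of_eq ?_)
  ring

theorem exists_finslerNorm_le (hMc : IsCompact M) (hg : ContDiff ℝ ∞ g)
    (hgM : ∀ q ∈ M, g q = tangentProj M q) (hU : IsOpen U) (hMU : M ⊆ U)
    (hX : ContDiffOn ℝ ∞ X U) :
    ∃ C, 0 ≤ C ∧ ∀ Φ : S → Euc Q, IsAdmissible M N Φ →
      finslerNorm M Φ (fun x => X (Φ x)) ≤ C * (1 + area Φ + bendingEnergy M Φ) := by
  obtain ⟨C₁, hC₁0, hC₁⟩ := exists_norm_bound hMc (hX.continuousOn.mono hMU)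
  obtain ⟨C₂, hC₂0, hC₂⟩ := exists_norm_bound hMc
    ((contDiffOn_tangentialDeriv hg hU hX).continuousOn.mono hMU)
  obtain ⟨C₄, hC₄0, hC₄⟩ := exists_surfaceIntegral_covDerivTwo_le (S := S) (N := N) hMc hg hgM hU
    hMU hX
  refine ⟨C₁ + √ (2 * C₂ ^ 2) + (1 + C₄), by positivity, fun Φ hΦ => ?_⟩
  -- Nonnegativity of the bound covers an empty surface, where the real supremum is zero.
  have h1 : ⨆ x, ‖X (Φ x)‖ ≤ C₁ := Real.iSup_le (fun x => hC₁ _ (hΦ.mem_ambient x)) hC₁0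
  have h2 : (⨆ x, √ (normSqOne (metric (inChart Φ x) (extChartAt (𝓡∂ 2) x x)) fun i =>
      covDeriv M (inChart Φ x) (inChart (fun x => X (Φ x)) x) i (extChartAt (𝓡∂ 2) x x)))
      ≤ √ (2 * C₂ ^ 2) :=
    Real.iSup_le (fun x => Real.sqrt_le_sqrt (hΦ.normSqOne_covDeriv_le hgM hU hMU hX hC₂ x
      (mem_extChartAt_target x))) (Real.sqrt_nonneg _)
  have h3 := hC₄ Φ hΦ
  have h4 := rpow_quarter_le (x := surfaceIntegral fun c y =>
      normSqTwo (metric (inChart Φ c) y)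
        (fun i j => covDerivTwo M (inChart Φ c) (inChart (fun x => X (Φ x)) c) i j y) ^ 2
        * areaDensity (inChart Φ c) y)
    (surfaceIntegral_nonneg fun c y => mul_nonneg (sq_nonneg _) (areaDensity_nonneg _ y))
  have h5 : finslerNorm M Φ (fun x => X (Φ x))
      ≤ C₁ + √ (2 * C₂ ^ 2) + (1 + C₄ * (area Φ + bendingEnergy M Φ)) :=
    add_le_add (add_le_add h1 h2) (h4.trans (by linarith))
  refine h5.trans ?_
  have h6 : 0 ≤ (C₁ + √ (2 * C₂ ^ 2) + 1) * (area Φ + bendingEnergy M Φ) :=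
    mul_nonneg (by positivity) (add_nonneg (area_nonneg Φ) (bendingEnergy_nonneg M Φ))
  linarith

end FinslerNorm

/-! ### Almost critical sequences satisfying the entropy condition -/

section AlmostCritical

/-- Once `σ k < e⁻¹` the logarithm is at least one, and both summands are nonnegative, so each is
dominated by the sum. -/
theorem tendsto_of_entropy {σ a b : ℕ → ℝ} (hσ : ∀ k, σ k ∈ Ioo (0 : ℝ) 1)
    (hσ0 : Tendsto σ atTop (𝓝 0)) (ha : ∀ k, 0 ≤ a k) (hb : ∀ k, 0 ≤ b k)
    (h : Tendsto (fun k => σ k * Real.log (1 / σ k) * a k + σ k ^ 4 * Real.log (1 / σ k) * b k)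
      atTop (𝓝 0)) :
    Tendsto (fun k => σ k * a k) atTop (𝓝 0) ∧ Tendsto (fun k => σ k ^ 4 * b k) atTop (𝓝 0) := by
  have hlog : ∀ᶠ k in atTop, 1 ≤ Real.log (1 / σ k) := by
    filter_upwards [hσ0.eventually (gt_mem_nhds (Real.exp_pos (-1)))] with k hk
    rw [one_div, Real.log_inv, le_neg]
    exact (Real.log_le_iff_le_exp (hσ k).1).2 hk.le
  have key : ∀ᶠ k in atTop, σ k * a k ≤ σ k * Real.log (1 / σ k) * a k
        + σ k ^ 4 * Real.log (1 / σ k) * b k ∧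
      σ k ^ 4 * b k ≤ σ k * Real.log (1 / σ k) * a k
        + σ k ^ 4 * Real.log (1 / σ k) * b k := by
    filter_upwards [hlog] with k hk
    have h1 : 0 ≤ σ k * a k := mul_nonneg (hσ k).1.le (ha k)
    have h2 : 0 ≤ σ k ^ 4 * b k := mul_nonneg (pow_nonneg (hσ k).1.le _) (hb k)
    have h3 := mul_le_mul_of_nonneg_left hk h1
    have h4 := mul_le_mul_of_nonneg_left hk h2
    constructor <;> linarith
  exact ⟨squeeze_zero' (.of_forall fun k => mul_nonneg (hσ k).1.le (ha k))
      (key.mono fun _ hk => hk.1) h,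
    squeeze_zero' (.of_forall fun k => mul_nonneg (pow_nonneg (hσ k).1.le _) (hb k))
      (key.mono fun _ hk => hk.2) h⟩

variable {Q : ℕ} {M N : Set (Euc Q)} {ε : ℝ} {F : ℝ → Euc Q → Euc Q}
  {g : Euc Q → Euc Q →L[ℝ] Euc Q}
  {S : Type*} [TopologicalSpace S] [T2Space S] [CompactSpace S]
  [ChartedSpace (EuclideanHalfSpace 2) S] [IsManifold (𝓡∂ 2) ∞ S]
  [MeasurableSpace S] [BorelSpace S]

/-- The first variation of the area of an almost critical immersion along an isotopy is controlled
by the lower order terms of the energy. -/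
theorem IsFreeBoundaryIsotopy.exists_abs_integral_massVariation_le
    (hF : IsFreeBoundaryIsotopy M N ε F) [CompactSpace (GrBundle M)] (hMc : IsCompact M)
    (hg : ContDiff ℝ ∞ g) (hgM : ∀ q ∈ M, g q = tangentProj M q) :
    ∃ C, 0 ≤ C ∧ ∀ (σ δ : ℝ) (Φ : S → Euc Q) (hΦ : IsAdmissible M N Φ), 0 ≤ σ → 0 ≤ δ →
      IsAlmostCritical M N σ δ Φ →
      |∫ q, massVariation F q ∂hΦ.inducedVarifold| ≤ C * (σ * boundaryLength Φ
        + σ ^ 4 * (area Φ + bendingEnergy M Φ) + δ * (1 + area Φ + bendingEnergy M Φ)) := by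
  obtain ⟨C₁, hC₁0, hC₁⟩ :=
    hF.exists_hasDerivAt_boundaryLength (S := S) hMc hg.continuous hgM
  obtain ⟨C₂, hC₂0, hC₂⟩ := hF.exists_hasDerivAt_bendingEnergy (S := S) hMc hg hgM
  obtain ⟨U, hU, hMU, hFU⟩ := hF.smooth
  obtain ⟨C₃, hC₃0, hC₃⟩ := exists_finslerNorm_le (S := S) (N := N) hMc hg hgM hU hMU
    (contDiffOn_velocity hF.pos hU hFU)
  refine ⟨C₁ + C₂ + C₃, by positivity, fun σ δ Φ hΦ hσ hδ hcrit => ?_⟩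
  obtain ⟨r₁, hr₁, hr₁'⟩ := hC₁ Φ hΦ
  obtain ⟨r₂, hr₂, hr₂'⟩ := hC₂ Φ hΦ
  have hE : HasDerivAt (fun t => energy M σ fun x => F t (Φ x))
      ((∫ q, massVariation F q ∂hΦ.inducedVarifold) + σ * r₁ + σ ^ 4 * r₂) 0 :=
    ((hF.hasDerivAt_area hΦ).add (hr₁.const_mul σ)).add (hr₂.const_mul (σ ^ 4))
  have hc := hcrit ε _ (hF.isVariation hΦ)
  rw [hE.deriv] at hc
  replace hc := hc.trans (mul_le_mul_of_nonneg_left (hC₃ Φ hΦ) hδ)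
  have hl := boundaryLength_nonneg Φ
  have hA := area_nonneg Φ
  have hB := bendingEnergy_nonneg M Φ
  have hσ4 : 0 ≤ σ ^ 4 := by positivity
  have h1 := mul_le_mul_of_nonneg_left hr₁' hσ
  have h2 := mul_le_mul_of_nonneg_left hr₂' hσ4
  rw [← abs_of_nonneg hσ, ← abs_mul, abs_of_nonneg hσ] at h1
  rw [← abs_of_nonneg hσ4, ← abs_mul, abs_of_nonneg hσ4] at h2
  set L := σ * boundaryLength Φ with hL
  set B := σ ^ 4 * (area Φ + bendingEnergy M Φ) with hBdef
  set D := δ * (1 + area Φ + bendingEnergy M Φ) with hD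
  have hL0 : 0 ≤ L := by positivity
  have hB0 : 0 ≤ B := by positivity
  have hD0 : 0 ≤ D := by positivity
  have h1' : |σ * r₁| ≤ C₁ * L := h1.trans_eq (by rw [hL]; ring)
  have h2' : |σ ^ 4 * r₂| ≤ C₂ * B := h2.trans_eq (by rw [hBdef]; ring)
  have h3' : |(∫ q, massVariation F q ∂hΦ.inducedVarifold) + σ * r₁ + σ ^ 4 * r₂| ≤ C₃ * D :=
    hc.trans_eq (by rw [hD]; ring)
  have h4 : C₁ * L + C₂ * B + C₃ * D ≤ (C₁ + C₂ + C₃) * (L + B + D) := by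
    have : 0 ≤ C₁ * (B + D) + C₂ * (L + D) + C₃ * (L + B) := by positivity
    linarith
  refine le_trans ?_ h4
  -- The area term is the energy derivative minus the length and bending terms; the triangle
  -- inequality concludes.
  rw [abs_le] at h1' h2' h3' ⊢
  constructor <;> linarith [h1'.1, h1'.2, h2'.1, h2'.2, h3'.1, h3'.2]

/-- The error terms are `σ_k · length`, `σ_k^4 · bending` and powers of `σ_k` times the bounded
area; all vanish. The bending term from the norm carries `σ_k^5 ≤ σ_k^4`. -/
theorem IsFreeBoundaryIsotopy.tendsto_integral_massVariation
    (hF : IsFreeBoundaryIsotopy M N ε F) [CompactSpace (GrBundle M)] (hMc : IsCompact M)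
    (hg : ContDiff ℝ ∞ g) (hgM : ∀ q ∈ M, g q = tangentProj M q)
    {σ : ℕ → ℝ} (hσ : ∀ k, σ k ∈ Ioo (0 : ℝ) 1) (hσ0 : Tendsto σ atTop (𝓝 0))
    {Φ : ℕ → S → Euc Q} (hΦ : ∀ k, IsAdmissible M N (Φ k)) {A : ℝ} (hA : ∀ k, area (Φ k) ≤ A)
    (hcrit : ∀ k, IsAlmostCritical M N (σ k) (σ k ^ 5) (Φ k))
    (hl : Tendsto (fun k => σ k * boundaryLength (Φ k)) atTop (𝓝 0))
    (hb : Tendsto (fun k => σ k ^ 4 * bendingEnergy M (Φ k)) atTop (𝓝 0)) :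
    Tendsto (fun k => ∫ q, massVariation F q ∂(hΦ k).inducedVarifold) atTop (𝓝 0) := by
  obtain ⟨C, hC0, hC⟩ := hF.exists_abs_integral_massVariation_le (S := S) hMc hg hgM
  have hlim : Tendsto (fun k => C * (σ k * boundaryLength (Φ k)
      + (σ k ^ 4 * A + σ k ^ 4 * bendingEnergy M (Φ k))
      + (σ k ^ 5 * (1 + A) + σ k ^ 4 * bendingEnergy M (Φ k)))) atTop (𝓝 0) := by
    have h4 := (hσ0.pow 4).mul_const A
    have h5 := (hσ0.pow 5).mul_const (1 + A)
    simpa using ((hl.add (h4.add hb)).add (h5.add hb)).const_mul C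
  refine squeeze_zero_norm (fun k => ?_) hlim
  have hs := hσ k
  have hB := bendingEnergy_nonneg M (Φ k)
  have h4 : 0 ≤ σ k ^ 4 := pow_nonneg hs.1.le 4
  have h5 : 0 ≤ σ k ^ 5 := pow_nonneg hs.1.le 5
  refine (hC _ _ _ (hΦ k) hs.1.le h5 (hcrit k)).trans (mul_le_mul_of_nonneg_left ?_ hC0)
  have h54 : σ k ^ 5 ≤ σ k ^ 4 := pow_le_pow_of_le_one hs.1.le hs.2.le (by norm_num)
  have e1 := mul_le_mul_of_nonneg_left (hA k) h4
  have e2 := mul_le_mul_of_nonneg_left (hA k) h5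
  have e3 := mul_le_mul_of_nonneg_right h54 hB
  linarith

end AlmostCritical

end FreeBoundary

end

/-! ### Extraction of the limit varifold and its stationarity -/

theorem mainTheorem4 {Q m n : ℕ} (hn : 1 ≤ n) (hnm : n < m)
    (M N : Set (FreeBoundary.Euc Q))
    (hMc : IsCompact M) (hM : FreeBoundary.IsEmbeddedSubmanifold m M)
    (hNc : IsCompact N) (hN : FreeBoundary.IsEmbeddedSubmanifold n N) (hNM : N ⊆ M)
    {S : Type*} [TopologicalSpace S] [T2Space S] [CompactSpace S]
    [ChartedSpace (EuclideanHalfSpace 2) S] [IsManifold (𝓡∂ 2) ∞ S]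
    [MeasurableSpace S] [BorelSpace S]
    (σ : ℕ → ℝ) (hσ : ∀ k, σ k ∈ Set.Ioo (0 : ℝ) 1) (hσ0 : Tendsto σ atTop (𝓝 0))
    (Φ : ℕ → S → FreeBoundary.Euc Q)
    (hΦ : ∀ k, FreeBoundary.IsAdmissible M N (Φ k))
    (harea : ∃ C : ℝ, ∀ k, FreeBoundary.area (Φ k) ≤ C)
    (hcrit : ∀ k, FreeBoundary.IsAlmostCritical M N (σ k) (σ k ^ 5) (Φ k))
    (hentropy : Tendsto (fun k =>
        σ k * Real.log (1 / σ k) * FreeBoundary.boundaryLength (Φ k)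
          + σ k ^ 4 * Real.log (1 / σ k) * FreeBoundary.bendingEnergy M (Φ k))
      atTop (𝓝 0)) :
    ∃ φ : ℕ → ℕ, StrictMono φ ∧
      ∃ v : MeasureTheory.Measure (FreeBoundary.GrBundle M),
        FreeBoundary.IsVarifold v ∧
        FreeBoundary.VarifoldTendsto (fun k => (hΦ (φ k)).inducedVarifold) v ∧
        FreeBoundary.IsFreeBoundaryStationary M N v := by
  obtain ⟨g, hg, hgM⟩ := FreeBoundary.exists_smooth_tangentProj hM hMc.isClosed
  obtain ⟨A, hA⟩ := harea
  have : CompactSpace (FreeBoundary.GrBundle M) :=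
    FreeBoundary.GrBundle.compactSpace hMc hg.continuous hgM
  have : TopologicalSpace.MetrizableSpace (FreeBoundary.GrBundle M) :=
    FreeBoundary.GrBundle.metrizableSpace
  obtain ⟨φ, hφ, v, hv, hlim⟩ := FreeBoundary.exists_subseq_tendsto_of_mass_le
    (fun k => (hΦ k).inducedVarifold) (C := A) fun k => by
      rw [(hΦ k).inducedVarifold_univ]
      exact ENNReal.ofReal_le_ofReal (hA k)
  obtain ⟨hl, hb⟩ := FreeBoundary.tendsto_of_entropy hσ hσ0
    (fun k => FreeBoundary.boundaryLength_nonneg (Φ k))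
    (fun k => FreeBoundary.bendingEnergy_nonneg M (Φ k)) hentropy
  refine ⟨φ, hφ, v, hv, hlim, fun ε F hF => ?_⟩
  have h0 := (hF.tendsto_integral_massVariation hMc hg hgM hσ hσ0 hΦ hA hcrit hl hb).comp
    hφ.tendsto_atTop
  -- The first variations along the subsequence tend to the first variation of `v` by weak
  -- convergence, and to zero by almost criticality. The subsequence was chosen before the isotopy,
  -- so it serves all isotopies.
  have h1 : ∫ q, FreeBoundary.massVariation F q ∂v = 0 :=
    tendsto_nhds_unique (hlim ⟨_, hF.continuous_massVariation⟩) h0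
  exact h1 ▸ hF.hasDerivAt_mass hMc.isClosed v
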